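/- **Theorem (Spacetime Penrose inequality in spherical symmetry).** Let $n\ge 3$ and let $(M,g,k)$ be a smooth, spherically symmetric initial data set on $M=[0,\infty)\times S^{n-1}$; that is, $g$ is a Riemannian metric and $k$ a symmetric $2$-tensor, both smooth up to the boundary and invariant under the standard action of $SO(n)$ on $S^{n-1}$. Define $\mu$ and $J$ by $$16\pi\mu = R_g + (\mathrm{tr}_g k)^2 - |k|_g^2,\qquad 8\pi J=\mathrm{div}_g\big(k-(\mathrm{tr}_g k)g\big).$$ For an orbit sphere $S$ let $H_S$ be its mean curvature with respect to the unit normal pointing to infinity, and $\Theta_\pm = H_S\pm \mathrm{tr}_S k$ its null expansions. Assume: 1. (Asymptotic flatness) the complement of a compact set in $M$ is diffeomorphic to $\mathbb R^n\setminus \overline{B_R(0)}$, with infinity corresponding to infinity, and for some constant $C$, in the coordinates $x$ given by this diffeomorphism, $$|\partial^{\beta}(g_{ij}-\delta_{ij})|\le \frac{C}{|x|^{n-2+|\beta|}}\ (|\beta|\le 2),\quad |\partial^{\beta}k_{ij}|\le \frac{C}{|x|^{n-1+|\beta|}}\ (|\beta|\le 1),\quad |R_g|\le \frac{C}{|x|^{n+1}},\quad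 |\mathrm{tr}_g k|\le \frac{C}{|x|^{n}};$$ 2. (Apparent horizon condition) $\Theta_+>0$ and $\Theta_->0$ on $M\setminus\partial M$, and $\Theta_+=0$ on $\partial M$ or $\Theta_-=0$ on $\partial M$; 3. (Dominant energy condition) $\mu\ge |J|_g$ on $M$. Let $\omega_{n-1}$ be the area of the round unit sphere $S^{n-1}$ and $m_0=\frac12\left(\frac{|\partial M|}{\omega_{n-1}}\right)^{\frac{n-2}{n-1}}$ the half area radius. Then the ADM mass $$m_{ADM}=\lim_{S\to\infty}\ \frac12\left(\frac{|S|}{\omega_{n-1}}\right)^{\frac{n-2}{n-1}}\left[1-\frac{1}{(n-1)^2\left(\omega_{n-1}^2|S|^{n-3}\right)^{\frac1{n-1}}}\int_{S}H_{S}^2\right],$$ the limit of the Hawking masses of the orbit spheres $S$ going to infinity, exists, and $$m_{ADM}\ge m_0 .$$ If $m_{ADM}=m_0$, then there is a smooth isometric embedding of $(M,g)$ into the (maximally extended) $(n+1)$-dimensional Schwarzschild spacetime of mass $m_0$ whose second fundamental form, with respect to the future unit normal, is $k$. It maps $\partial M$ into the horizon and $M\setminus\partial M$ into the exterior region $\{\rho>\rho_0\}$,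 with metric $-\phi^2dt^2+\phi^{-2}d\rho^2+\rho^2d\Omega^2$, $\phi^2=1-2m_0/\rho^{n-2}$, $\rho_0=(2m_0)^{1/(n-2)}$. -/

import Mathlib

open scoped ContDiff

noncomputable section

namespace Penrose

/-! ### Tensor calculus in a global Cartesian chart -/

/-- Euclidean `n`-space. -/
abbrev Eucl (n : ℕ) : Type := EuclideanSpace ℝ (Fin n)

/-- Bilinear forms on Euclidean `n`-space. -/
abbrev Form (n : ℕ) : Type := Eucl n →L[ℝ] Eucl n →L[ℝ] ℝ

/-- The `i`-th standard basis vector. -/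
def stdVec {n : ℕ} (i : Fin n) : Eucl n := EuclideanSpace.single i (1 : ℝ)

/-- The partial derivative `∂ᵢ f`. -/
def pd {n : ℕ} (i : Fin n) (f : Eucl n → ℝ) (x : Eucl n) : ℝ := fderiv ℝ f x (stdVec i)

/-- The component `b_{ij}` of a field of bilinear forms. -/
def comp {n : ℕ} (b : Eucl n → Form n) (i j : Fin n) (x : Eucl n) : ℝ :=
  b x (stdVec i) (stdVec j)

/-- The matrix `(g_{ij})`. -/
def gram {n : ℕ} (g : Eucl n → Form n) (x : Eucl n) : Matrix (Fin n) (Fin n) ℝ :=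
  Matrix.of fun i j => comp g i j x

/-- The inverse matrix `(g^{ij})`. -/
def gInv {n : ℕ} (g : Eucl n → Form n) (x : Eucl n) : Matrix (Fin n) (Fin n) ℝ :=
  (gram g x)⁻¹

/-- The Riemannian volume density `√(det g)`. -/
def volDensity {n : ℕ} (g : Eucl n → Form n) (x : Eucl n) : ℝ := √(gram g x).det

/-- The Christoffel symbol `Γ^l_{ij}`. -/
def christoffel {n : ℕ} (g : Eucl n → Form n) (l i j : Fin n) (x : Eucl n) : ℝ :=
  (1 / 2) * ∑ m, gInv g x l m *
    (pd i (comp g j m) x + pd j (comp g i m) x - pd m (comp g i j) x)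

/-- The Ricci tensor
`R_{ij} = ∂_l Γ^l_{ij} - ∂_j Γ^l_{il} + Γ^l_{lm} Γ^m_{ij} - Γ^l_{jm} Γ^m_{il}`. -/
def ricci {n : ℕ} (g : Eucl n → Form n) (i j : Fin n) (x : Eucl n) : ℝ :=
  (∑ l, (pd l (christoffel g l i j) x - pd j (christoffel g l i l) x)) +
    ∑ l, ∑ m, (christoffel g l l m x * christoffel g m i j x -
      christoffel g l j m x * christoffel g m i l x)

/-- The scalar curvature `R_g`. -/
def scalarCurvature {n : ℕ} (g : Eucl n → Form n) (x : Eucl n) : ℝ :=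
  ∑ i, ∑ j, gInv g x i j * ricci g i j x

/-- The trace `tr_g b`. -/
def trace {n : ℕ} (g b : Eucl n → Form n) (x : Eucl n) : ℝ :=
  ∑ i, ∑ j, gInv g x i j * comp b i j x

/-- The squared norm `|b|_g²` of a 2-tensor. -/
def tensorNormSq {n : ℕ} (g b : Eucl n → Form n) (x : Eucl n) : ℝ :=
  ∑ i, ∑ j, ∑ p, ∑ q, gInv g x i p * gInv g x j q * comp b i j x * comp b p q x

/-- The norm `|α|_g` of a covector with components `α i`. -/
def covectorNorm {n : ℕ} (g : Eucl n → Form n) (x : Eucl n) (α : Fin n → ℝ) : ℝ :=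
  √(∑ i, ∑ j, gInv g x i j * α i * α j)

/-- The `j`-th component of the divergence of a 2-tensor, `g^{il} ∇_l b_{ij}`. -/
def tensorDiv {n : ℕ} (g b : Eucl n → Form n) (j : Fin n) (x : Eucl n) : ℝ :=
  ∑ i, ∑ l, gInv g x i l *
    (pd l (comp b i j) x -
      ∑ m, (christoffel g m l i x * comp b m j x + christoffel g m l j x * comp b i m x))

/-! ### Centred spheres -/

/-- The `g`-unit normal to the centred sphere through `x`, pointing to infinity. -/
def unitNormal {n : ℕ} (g : Eucl n → Form n) (x : Eucl n) (i : Fin n) : ℝ :=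
  (∑ j, gInv g x i j * x j) / covectorNorm g x (fun j => x j)

/-- The mean curvature of the centred sphere through `x`: the `g`-divergence of its unit normal. -/
def meanCurvature {n : ℕ} (g : Eucl n → Form n) (x : Eucl n) : ℝ :=
  (volDensity g x)⁻¹ * ∑ i, pd i (fun z => volDensity g z * unitNormal g z i) x

/-- The trace of `k` over the tangent space of the centred sphere through `x`. -/
def sphereTrace {n : ℕ} (g k : Eucl n → Form n) (x : Eucl n) : ℝ :=
  trace g k x - ∑ i, ∑ j, comp k i j x * unitNormal g x i * unitNormal g x j

/-- The future null expansion `Θ₊ = H + tr_S k`. -/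
def expansionPlus {n : ℕ} (g k : Eucl n → Form n) (x : Eucl n) : ℝ :=
  meanCurvature g x + sphereTrace g k x

/-- The past null expansion `Θ₋ = H - tr_S k`. -/
def expansionMinus {n : ℕ} (g k : Eucl n → Form n) (x : Eucl n) : ℝ :=
  meanCurvature g x - sphereTrace g k x

/-- The integral `∫_{S_r} F dσ_g` over the centred sphere of coordinate radius `r`; here
`dσ_g = √(det g) |ν|_g dσ` where `ν` is the Euclidean unit conormal and `dσ` the Euclidean
surface measure. -/
def sphereIntegral {n : ℕ} (g : Eucl n → Form n) (r : ℝ) (F : Eucl n → ℝ) : ℝ :=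
  ∫ θ : Metric.sphere (0 : Eucl n) 1,
    F (r • (θ : Eucl n)) *
      (r ^ (n - 1) * (volDensity g (r • (θ : Eucl n)) *
        covectorNorm g (r • (θ : Eucl n)) (fun j => (θ : Eucl n) j)))
    ∂(MeasureTheory.volume : MeasureTheory.Measure (Eucl n)).toSphere

/-- The `g`-area `|S_r|`. -/
def sphereArea {n : ℕ} (g : Eucl n → Form n) (r : ℝ) : ℝ := sphereIntegral g r fun _ => 1

/-- The area `ω_{n-1}` of the round unit sphere in Euclidean `n`-space. -/
def unitSphereArea (n : ℕ) : ℝ :=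
  (MeasureTheory.volume : MeasureTheory.Measure (Eucl n)).toSphere.real Set.univ

/-- The Hawking mass of the centred sphere `S_r`. -/
def hawkingMass {n : ℕ} (g : Eucl n → Form n) (r : ℝ) : ℝ :=
  (1 / 2) * (sphereArea g r / unitSphereArea n) ^ (((n : ℝ) - 2) / ((n : ℝ) - 1)) *
    (1 - 1 / (((n : ℝ) - 1) ^ 2 *
        (unitSphereArea n ^ 2 * sphereArea g r ^ (n - 3)) ^ (1 / ((n : ℝ) - 1))) *
      sphereIntegral g r fun x => meanCurvature g x ^ 2)

/-! ### Initial data -/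

/-- The underlying manifold with boundary `[0, ∞) × S^{n-1}`, realized as the complement of the
open unit ball; its boundary is the unit sphere. -/
def exteriorDomain (n : ℕ) : Set (Eucl n) := {x | 1 ≤ ‖x‖}

/-- Smoothness up to the boundary on a closed domain `M`: the map is smooth on an open
neighbourhood of `M`. -/
def SmoothNear {E F : Type*} [NormedAddCommGroup E] [NormedSpace ℝ E] [NormedAddCommGroup F]
    [NormedSpace ℝ F] (M : Set E) (f : E → F) : Prop :=
  ∃ U : Set E, IsOpen U ∧ M ⊆ U ∧ ContDiffOn ℝ ∞ f U

/-- An initial data set `(M, g, k)` on `M = [0, ∞) × S^{n-1}`: a smooth Riemannian metric `g` and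
a smooth symmetric 2-tensor `k`. Only the values on `M` matter. -/
structure InitialData (n : ℕ) where
  /-- the metric -/
  g : Eucl n → Form n
  /-- the candidate for the second fundamental form -/
  k : Eucl n → Form n
  g_smooth : SmoothNear (exteriorDomain n) g
  k_smooth : SmoothNear (exteriorDomain n) k
  g_symm : ∀ x ∈ exteriorDomain n, ∀ u v, g x u v = g x v u
  k_symm : ∀ x ∈ exteriorDomain n, ∀ u v, k x u v = k x v u
  g_pos : ∀ x ∈ exteriorDomain n, ∀ u, u ≠ 0 → 0 < g x u u

namespace InitialData

variable {n : ℕ}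

/-- The energy density: `16 π μ = R_g + (tr_g k)² - |k|_g²`. -/
def energyDensity (D : InitialData n) (x : Eucl n) : ℝ :=
  (scalarCurvature D.g x + trace D.g D.k x ^ 2 - tensorNormSq D.g D.k x) / (16 * Real.pi)

/-- The momentum density: `8 π J = div_g (k - (tr_g k) g)`. -/
def momentumDensity (D : InitialData n) (x : Eucl n) (j : Fin n) : ℝ :=
  tensorDiv D.g (fun z => D.k z - trace D.g D.k z • D.g z) j x / (8 * Real.pi)

/-- The dominant energy condition `μ ≥ |J|_g`. -/
def DominantEnergyCondition (D : InitialData n) : Prop :=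
  ∀ x ∈ exteriorDomain n, covectorNorm D.g x (D.momentumDensity x) ≤ D.energyDensity x

/-- Spherical symmetry: `g` and `k` are invariant under `SO(n)`. -/
def IsSphericallySymmetric (D : InitialData n) : Prop :=
  ∀ A : Eucl n ≃ₗᵢ[ℝ] Eucl n, LinearMap.det (A.toLinearEquiv : Eucl n →ₗ[ℝ] Eucl n) = 1 →
    ∀ x ∈ exteriorDomain n, ∀ u v,
      D.g (A x) (A u) (A v) = D.g x u v ∧ D.k (A x) (A u) (A v) = D.k x u v

/-- The pullback of a field of bilinear forms. -/
def pullback (Φ : Eucl n → Eucl n) (b : Eucl n → Form n) (y : Eucl n) : Form n :=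
  (b (Φ y)).bilinearComp (fderiv ℝ Φ y) (fderiv ℝ Φ y)

/-- Asymptotic flatness: outside a compact set, `M` is diffeomorphic, by `Φ`, to the complement
of a ball, and in the coordinates `y` thus provided `g` and `k` satisfy the fall-off conditions. -/
def IsAsymptoticallyFlat (D : InitialData n) : Prop :=
  ∃ (R C : ℝ) (K : Set (Eucl n)) (Φ : Eucl n → Eucl n), 0 < R ∧ IsCompact K ∧
    ContDiffOn ℝ ∞ Φ {y | R < ‖y‖} ∧
    (∀ y, R < ‖y‖ → Function.Injective (fderiv ℝ Φ y)) ∧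
    Set.BijOn Φ {y | R < ‖y‖} (exteriorDomain n \ K) ∧
    Filter.Tendsto Φ (Bornology.cobounded (Eucl n)) (Bornology.cobounded (Eucl n)) ∧
    ∀ y, R < ‖y‖ →
      (∀ i j, ∀ m ≤ 2,
        ‖iteratedFDeriv ℝ m
            (fun z => comp (pullback Φ D.g) i j z - if i = j then 1 else 0) y‖
          ≤ C / ‖y‖ ^ (n - 2 + m)) ∧
      (∀ i j, ∀ m ≤ 1,
        ‖iteratedFDeriv ℝ m (comp (pullback Φ D.k) i j) y‖ ≤ C / ‖y‖ ^ (n - 1 + m)) ∧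
      |scalarCurvature D.g (Φ y)| ≤ C / ‖y‖ ^ (n + 1) ∧
      |trace D.g D.k (Φ y)| ≤ C / ‖y‖ ^ n

/-- The boundary is an outermost apparent horizon: one of the null expansions vanishes on the
boundary, and both are positive away from it. -/
def ApparentHorizonCondition (D : InitialData n) : Prop :=
  (∀ x, 1 < ‖x‖ → 0 < expansionPlus D.g D.k x ∧ 0 < expansionMinus D.g D.k x) ∧
  ((∀ x, ‖x‖ = 1 → expansionPlus D.g D.k x = 0) ∨
    ∀ x, ‖x‖ = 1 → expansionMinus D.g D.k x = 0)

/-- The half area radius `m₀ = (1/2) (|∂M| / ω_{n-1})^{(n-2)/(n-1)}`. -/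
def halfAreaRadius (D : InitialData n) : ℝ :=
  (1 / 2) * (sphereArea D.g 1 / unitSphereArea n) ^ (((n : ℝ) - 2) / ((n : ℝ) - 1))

/-- `m` is the ADM mass: the limit of the Hawking masses of the spheres going to infinity. -/
def HasADMMass (D : InitialData n) (m : ℝ) : Prop :=
  Filter.Tendsto (hawkingMass D.g) Filter.atTop (nhds m)

end InitialData

/-! ### Schwarzschild spacetime

The maximally extended Schwarzschild spacetime of dimension `n + 1` is written in the global
coordinates `(X, Y, θ)`, `θ ∈ S^{n-1}`, in which the area radius is `ρ = ρ₀ + X Y`. It is thus a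
hypersurface (`‖θ‖ = 1`) in an open subset of `ℝ × ℝ × ℝⁿ`. The exterior region is `X, Y > 0`,
and `X Y = 0` is the horizon. The theorems `bijOn_staticMap` and `staticMap_isometry` below identify
the exterior region with the usual static form `-φ² dt² + φ⁻² dρ² + ρ² dΩ²`,
`φ² = 1 - 2 m / ρ^{n-2}`. -/

/-- The coordinate space `ℝ × ℝ × ℝⁿ`. -/
abbrev Ambient (n : ℕ) : Type := ℝ × ℝ × Eucl n

/-- The horizon radius `ρ₀ = (2 m)^{1/(n-2)}`. -/
def horizonRadius (n : ℕ) (m : ℝ) : ℝ := (2 * m) ^ (1 / ((n : ℝ) - 2))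

/-- The area radius `ρ = ρ₀ + X Y`. -/
def areaRadius {n : ℕ} (m : ℝ) (q : Ambient n) : ℝ := horizonRadius n m + q.1 * q.2.1

/-- The (extended) Schwarzschild spacetime as a set. -/
def schwarzschild (n : ℕ) (m : ℝ) : Set (Ambient n) := {q | 0 < areaRadius m q ∧ ‖q.2.2‖ = 1}

/-- The exterior region. -/
def schwarzschildExterior (n : ℕ) : Set (Ambient n) :=
  {q | 0 < q.1 ∧ 0 < q.2.1 ∧ ‖q.2.2‖ = 1}

/-- The function `(ρ₀ ρ)⁻¹ ∑_{j < n-2} ∑_{i ≤ j} (ρ₀/ρ)^i`, which for `ρ ≠ ρ₀` is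
`((n-2) (ρ - ρ₀) / ρ₀ - φ²) / (ρ - ρ₀)²`. -/
def regularFactor (n : ℕ) (a ρ : ℝ) : ℝ :=
  (a * ρ)⁻¹ * ∑ j ∈ Finset.range (n - 2), ∑ i ∈ Finset.range (j + 1), (a / ρ) ^ i

/-- The Schwarzschild metric
`(4ρ₀/(n-2)) dX dY + (4ρ₀²/(n-2)²) b(ρ) Y² dX² + ρ² dΩ²`, with `b` the function `regularFactor`. -/
def schwarzschildMetric {n : ℕ} (m : ℝ) (q u v : Ambient n) : ℝ :=
  2 * horizonRadius n m / ((n : ℝ) - 2) * (u.1 * v.2.1 + u.2.1 * v.1) +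
    (2 * horizonRadius n m / ((n : ℝ) - 2)) ^ 2 *
      regularFactor n (horizonRadius n m) (areaRadius m q) * q.2.1 ^ 2 * (u.1 * v.1) +
    areaRadius m q ^ 2 * inner ℝ u.2.2 v.2.2

/-- `G_q(∇_A B, C)` for constant vector fields `A, B`, where `∇` is the Levi-Civita connection of
the metric `G` (Koszul formula). -/
def koszul {W : Type*} [NormedAddCommGroup W] [NormedSpace ℝ W] (G : W → W → W → ℝ)
    (q A B C : W) : ℝ :=
  (1 / 2) * (fderiv ℝ (fun p => G p B C) q A + fderiv ℝ (fun p => G p A C) q B -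
    fderiv ℝ (fun p => G p A B) q C)

/-- The second fundamental form at `x` of the hypersurface parametrized by `Ψ`, with respect to
the unit normal `ν`: `K(u, v) = G(∇_u ν, v) = - G(ν, ∇_u (dΨ v))`.
When the image of `Ψ` lies in a submanifold `N` to which `ν` is tangent, this is the second
fundamental form inside `N`, because the connection of `N` is the tangential part of that of the
surrounding space. -/
def secondFundamentalForm {E W : Type*} [NormedAddCommGroup E] [NormedSpace ℝ E]
    [NormedAddCommGroup W] [NormedSpace ℝ W] (G : W → W → W → ℝ) (Ψ : E → W) (ν : W)
    (x u v : E) : ℝ :=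
  -(G (Ψ x) ν (fderiv ℝ (fun z => fderiv ℝ Ψ z v) x u) +
    koszul G (Ψ x) (fderiv ℝ Ψ x u) (fderiv ℝ Ψ x v) ν)

/-- `ν` is the future unit normal at `x` of the hypersurface of Schwarzschild spacetime
parametrized by `Ψ`: it is tangent to the spacetime, normal to the hypersurface, unit timelike and
future directed (the function `X` increases along future directed timelike curves). -/
def IsFutureUnitNormal {n : ℕ} (m : ℝ) (Ψ : Eucl n → Ambient n) (x : Eucl n)
    (ν : Ambient n) : Prop :=
  inner ℝ (Ψ x).2.2 ν.2.2 = 0 ∧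
  (∀ u, schwarzschildMetric m (Ψ x) ν (fderiv ℝ Ψ x u) = 0) ∧
  schwarzschildMetric m (Ψ x) ν ν = -1 ∧
  0 < ν.1

/-- `Ψ` is a smooth isometric embedding of `(M, g)` into the Schwarzschild spacetime of mass `m`
with second fundamental form `k`; the interior of `M` lies in the exterior region and the boundary
lies on the horizon. -/
structure IsSchwarzschildEmbedding {n : ℕ} (m : ℝ) (D : InitialData n)
    (Ψ : Eucl n → Ambient n) : Prop where
  smooth : SmoothNear (exteriorDomain n) Ψ
  mapsTo : Set.MapsTo Ψ (exteriorDomain n) (schwarzschild n m)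
  embedding : Topology.IsEmbedding ((exteriorDomain n).domRestrict Ψ)
  isometric : ∀ x ∈ exteriorDomain n, ∀ u v,
    schwarzschildMetric m (Ψ x) (fderiv ℝ Ψ x u) (fderiv ℝ Ψ x v) = D.g x u v
  sff : ∀ x ∈ exteriorDomain n, ∃ ν, IsFutureUnitNormal m Ψ x ν ∧
    ∀ u v, secondFundamentalForm (schwarzschildMetric m) Ψ ν x u v = D.k x u v
  exterior : ∀ x, 1 < ‖x‖ → Ψ x ∈ schwarzschildExterior n
  horizon : ∀ x, ‖x‖ = 1 → areaRadius m (Ψ x) = horizonRadius n m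

/-! ### Comparison with the static form of the exterior region -/

/-- `φ² = 1 - 2 m / ρ^{n-2}`. -/
def potentialSq (n : ℕ) (m ρ : ℝ) : ℝ := 1 - 2 * m / ρ ^ (n - 2)

/-- The static metric `-φ² dt² + φ⁻² dρ² + ρ² dΩ²` at the point `(t, ρ, θ)`. -/
def staticMetric {n : ℕ} (m : ℝ) (q u v : Ambient n) : ℝ :=
  -potentialSq n m q.2.1 * (u.1 * v.1) + (potentialSq n m q.2.1)⁻¹ * (u.2.1 * v.2.1) +
    q.2.1 ^ 2 * inner ℝ u.2.2 v.2.2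

/-- The tortoise coordinate, a primitive of `φ⁻²`. -/
def tortoise (n : ℕ) (m ρ : ℝ) : ℝ :=
  ∫ s in (2 * horizonRadius n m)..ρ, (potentialSq n m s)⁻¹

/-- The map from static coordinates `(t, ρ, θ)` to the coordinates `(X, Y, θ)`. -/
def staticMap {n : ℕ} (m : ℝ) (q : Ambient n) : Ambient n :=
  (Real.exp (((n : ℝ) - 2) / (2 * horizonRadius n m) * (q.1 + tortoise n m q.2.1)),
    (q.2.1 - horizonRadius n m) *
      Real.exp (-(((n : ℝ) - 2) / (2 * horizonRadius n m) * (q.1 + tortoise n m q.2.1))),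
    q.2.2)

theorem horizonRadius_pos {n : ℕ} {m : ℝ} (hm : 0 < m) : 0 < horizonRadius n m :=
  Real.rpow_pos_of_pos (by linarith) _

theorem horizonRadius_pow {n : ℕ} (hn : 3 ≤ n) {m : ℝ} (hm : 0 < m) :
    horizonRadius n m ^ (n - 2) = 2 * m := by
  have h2 : ((n - 2 : ℕ) : ℝ) = (n : ℝ) - 2 := by
    rw [Nat.cast_sub (by omega)]; norm_num
  have h3 : (3 : ℝ) ≤ n := by exact_mod_cast hn
  rw [horizonRadius, ← Real.rpow_natCast, ← Real.rpow_mul (by linarith), h2,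
    one_div_mul_cancel (by linarith), Real.rpow_one]

theorem potentialSq_pos {n : ℕ} (hn : 3 ≤ n) {m ρ : ℝ} (hm : 0 < m)
    (hρ : horizonRadius n m < ρ) : 0 < potentialSq n m ρ := by
  have ha := horizonRadius_pos (n := n) hm
  have hρ0 : 0 < ρ := ha.trans hρ
  rw [potentialSq, ← horizonRadius_pow hn hm, sub_pos, div_lt_one (by positivity)]
  exact pow_lt_pow_left₀ hρ ha.le (by omega)

theorem regularFactor_eq {n : ℕ} (hn : 3 ≤ n) {m ρ : ℝ} (hm : 0 < m)
    (hρ : horizonRadius n m < ρ) :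
    regularFactor n (horizonRadius n m) ρ * (ρ - horizonRadius n m) ^ 2 =
      ((n : ℝ) - 2) * (ρ - horizonRadius n m) / horizonRadius n m - potentialSq n m ρ := by
  have ha := horizonRadius_pos (n := n) hm
  have hρ0 : 0 < ρ := ha.trans hρ
  have h2 : ((n - 2 : ℕ) : ℝ) = (n : ℝ) - 2 := by
    rw [Nat.cast_sub (by omega)]; norm_num
  rw [regularFactor, potentialSq, ← horizonRadius_pow hn hm, ← h2, ← div_pow]
  generalize n - 2 = N
  generalize horizonRadius n m = a at *
  have key : ∀ N : ℕ, (∑ j ∈ Finset.range N, ∑ i ∈ Finset.range (j + 1), (a / ρ) ^ i) *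
      (1 - a / ρ) ^ 2 = N * (1 - a / ρ) - a / ρ * (1 - (a / ρ) ^ N) := by
    intro N
    induction N with
    | zero => simp
    | succ N ih =>
      rw [Finset.sum_range_succ, add_mul, ih]
      have := geom_sum_mul_neg (a / ρ) (N + 1)
      rw [sq, ← mul_assoc, this]
      push_cast
      ring
  have h1 : ρ - a = ρ * (1 - a / ρ) := by field_simp
  have h3 := key N
  rw [h1, mul_pow, mul_assoc, mul_left_comm _ (ρ ^ 2), h3]
  field_simp

theorem hasDerivAt_tortoise {n : ℕ} (hn : 3 ≤ n) {m ρ : ℝ} (hm : 0 < m)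
    (hρ : horizonRadius n m < ρ) :
    HasDerivAt (tortoise n m) (potentialSq n m ρ)⁻¹ ρ := by
  have ha := horizonRadius_pos (n := n) hm
  have hcont : ContinuousOn (fun s => (potentialSq n m s)⁻¹) (Set.Ioi (horizonRadius n m)) := by
    refine ContinuousOn.inv₀ ?_ fun s hs => (potentialSq_pos hn hm hs).ne'
    unfold potentialSq
    refine continuousOn_const.sub (continuousOn_const.div (by fun_prop) ?_)
    intro s hs
    exact pow_ne_zero _ (ha.trans hs).ne'
  have hsub : Set.uIcc (2 * horizonRadius n m) ρ ⊆ Set.Ioi (horizonRadius n m) := by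
    intro s hs
    have := hs.1
    rcases min_le_iff.1 this with h | h <;> simp only [Set.mem_Ioi] <;> linarith
  refine intervalIntegral.integral_hasDerivAt_right ((hcont.mono hsub).intervalIntegrable) ?_
    (hcont.continuousAt (Ioi_mem_nhds hρ))
  exact hcont.stronglyMeasurableAtFilter isOpen_Ioi ρ hρ

/-- The static exterior `{ρ > ρ₀}` corresponds bijectively to the exterior region. -/
theorem bijOn_staticMap {n : ℕ} (hn : 3 ≤ n) {m : ℝ} (hm : 0 < m) :
    Set.BijOn (staticMap m) {q : Ambient n | horizonRadius n m < q.2.1 ∧ ‖q.2.2‖ = 1}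
      (schwarzschildExterior n) := by
  have ha := horizonRadius_pos (n := n) hm
  have h3 : (3 : ℝ) ≤ n := by exact_mod_cast hn
  have hκ : 0 < ((n : ℝ) - 2) / (2 * horizonRadius n m) := by
    apply div_pos <;> linarith
  refine ⟨?_, ?_, ?_⟩
  · rintro ⟨t, ρ, θ⟩ ⟨h1, h2⟩
    exact ⟨Real.exp_pos _, mul_pos (sub_pos.2 h1) (Real.exp_pos _), h2⟩
  · rintro ⟨t, ρ, θ⟩ - ⟨t', ρ', θ'⟩ - h
    simp only [staticMap, Prod.mk.injEq, Real.exp_eq_exp] at h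
    obtain ⟨h1, h2, h4⟩ := h
    rw [h1] at h2
    have h5 : ρ = ρ' := by
      have := mul_right_cancel₀ (Real.exp_pos _).ne' h2
      linarith
    subst h5
    have := mul_left_cancel₀ hκ.ne' h1
    simp only [Prod.mk.injEq, h4, and_true]
    linarith
  · rintro ⟨X, Y, θ⟩ ⟨hX, hY, hθ⟩
    simp only at hX hY hθ
    refine ⟨(Real.log X / (((n : ℝ) - 2) / (2 * horizonRadius n m)) -
      tortoise n m (horizonRadius n m + X * Y), horizonRadius n m + X * Y, θ), ⟨?_, hθ⟩, ?_⟩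
    · simp only
      nlinarith [mul_pos hX hY]
    · simp only [staticMap, sub_add_cancel, Prod.mk.injEq, and_true]
      rw [mul_div_cancel₀ _ hκ.ne', Real.exp_neg, Real.exp_log hX]
      refine ⟨rfl, ?_⟩
      field_simp
      ring

/-- On the exterior region the metric is the static one. -/
theorem staticMap_isometry {n : ℕ} (hn : 3 ≤ n) {m : ℝ} (hm : 0 < m) (q : Ambient n)
    (hq : horizonRadius n m < q.2.1) (u v : Ambient n) :
    DifferentiableAt ℝ (staticMap m) q ∧
    schwarzschildMetric m (staticMap m q) (fderiv ℝ (staticMap m) q u)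
      (fderiv ℝ (staticMap m) q v) = staticMetric m q u v := by
  have ha := horizonRadius_pos (n := n) hm
  have h3 : (3 : ℝ) ≤ n := by exact_mod_cast hn
  have hn2 : (n : ℝ) - 2 ≠ 0 := by linarith
  have hF := potentialSq_pos hn hm hq
  have hreg := regularFactor_eq hn hm hq
  have hκ : ∃ κ : ℝ, κ = ((n : ℝ) - 2) / (2 * horizonRadius n m) := ⟨_, rfl⟩
  obtain ⟨κ, hκ⟩ := hκ
  have hκ0 : κ ≠ 0 := by rw [hκ]; exact div_ne_zero hn2 (by linarith)
  have d1 : HasFDerivAt (fun q : Ambient n => q.1) (ContinuousLinearMap.fst ℝ ℝ (ℝ × Eucl n)) q :=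
    hasFDerivAt_fst
  have d2 : HasFDerivAt (fun q : Ambient n => q.2.1)
      ((ContinuousLinearMap.fst ℝ ℝ (Eucl n)).comp
        (ContinuousLinearMap.snd ℝ ℝ (ℝ × Eucl n))) q :=
    ((ContinuousLinearMap.fst ℝ ℝ (Eucl n)).comp
        (ContinuousLinearMap.snd ℝ ℝ (ℝ × Eucl n))).hasFDerivAt
  have d3 : HasFDerivAt (fun q : Ambient n => q.2.2)
      ((ContinuousLinearMap.snd ℝ ℝ (Eucl n)).comp
        (ContinuousLinearMap.snd ℝ ℝ (ℝ × Eucl n))) q :=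
    ((ContinuousLinearMap.snd ℝ ℝ (Eucl n)).comp
        (ContinuousLinearMap.snd ℝ ℝ (ℝ × Eucl n))).hasFDerivAt
  have d4 := (d1.add ((hasDerivAt_tortoise hn hm hq).comp_hasFDerivAt q d2)).const_mul κ
  have d5 := d4.exp
  have d6 := (d2.sub_const (horizonRadius n m)).mul d4.neg.exp
  have d7 := d5.prodMk (d6.prodMk d3)
  have hmap : staticMap m = fun q : Ambient n =>
      (Real.exp (κ * (q.1 + tortoise n m q.2.1)),
        (q.2.1 - horizonRadius n m) * Real.exp (-(κ * (q.1 + tortoise n m q.2.1))), q.2.2) := by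
    funext q
    rw [hκ]
    rfl
  have d8 := d7.congr_of_eventuallyEq (Filter.Eventually.of_forall fun z => congrFun hmap z)
  refine ⟨d8.differentiableAt, ?_⟩
  rw [d8.fderiv]
  have hrad : areaRadius m (staticMap m q) = q.2.1 := by
    simp only [areaRadius, staticMap, Real.exp_neg]
    field_simp
    ring
  have hY : (staticMap m q).2.1 =
      (q.2.1 - horizonRadius n m) * (Real.exp (κ * (q.1 + tortoise n m q.2.1)))⁻¹ := by
    rw [hmap, ← Real.exp_neg]
  have hc : 2 * horizonRadius n m / ((n : ℝ) - 2) = κ⁻¹ := by rw [hκ, inv_div]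
  have hreg' : regularFactor n (horizonRadius n m) q.2.1 * (q.2.1 - horizonRadius n m) ^ 2 =
      2 * κ * (q.2.1 - horizonRadius n m) - potentialSq n m q.2.1 := by
    rw [hreg, hκ]
    field_simp
  unfold schwarzschildMetric staticMetric
  rw [hrad, hY, hc]
  simp only [ContinuousLinearMap.prod_apply, add_apply,
    smul_apply, neg_apply, ContinuousLinearMap.comp_apply,
    ContinuousLinearMap.coe_fst', ContinuousLinearMap.coe_snd', smul_eq_mul, Real.exp_neg,
    Function.comp_apply, Pi.add_apply, Pi.neg_apply]
  have hE := (Real.exp_pos (κ * (q.1 + tortoise n m q.2.1))).ne'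
  generalize Real.exp (κ * (q.1 + tortoise n m q.2.1)) = X at hE ⊢
  generalize regularFactor n (horizonRadius n m) q.2.1 = b at hreg' ⊢
  generalize potentialSq n m q.2.1 = F at hF hreg' ⊢
  have hF0 := hF.ne'
  congr 1
  field_simp
  linear_combination (u.1 * F + u.2.1) * (F * v.1 + v.2.1) * hreg'

end Penrose

end

noncomputable section

namespace Penrose

variable {n : ℕ}

/-! ### Rotations and invariant bilinear forms -/

/-! Spherical symmetry reduces the problem to functions of z = ‖x‖². With s the g-arclength from the
boundary, let ρ be the area radius, v = dρ/ds, and let p and q be the radial and tangential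
eigenvalues of k. Then Θ± = (n-1)(v/ρ ± q), so the horizon condition says ρ|q| < v off the boundary
and v² = ρ²q² on it.

The inequality is monotonicity of the Misner–Sharp mass ½ρ^(n-2)(1 - v² + ρ²q²). Its s-derivative is
ρ^(n-1)(v·16πμ - ρq·16πJ)/(2(n-1)), with J the radial momentum
(`RadialData.hasDerivAt_misnerSharp`). This is nonnegative because |J| ≤ μ and ρ|q| < v. On the
boundary the mass equals m₀. It differs from the Hawking mass by ½ρⁿq², which tends to zero. The
Hawking mass converges because its derivative contains only the scalar curvature, whose fall-off
makes it integrable (`RadialData.exists_tendsto_radHawking`). The asymptotically flat chart need not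
respect the symmetry, so decay is transferred along a single coordinate ray
(`InitialData.IsAsymptoticallyFlat.exists_fallOff`).

In the equality case the mass is constant, and the strict inequality ρ|q| < v forces μ = J = 0
(`RadialData.vacuum`). The vacuum constraints are then the structure equations of a rotationally
symmetric hypersurface of Schwarzschild spacetime. Its profile curve is written explicitly in the
coordinates (X, Y) with XY = ρ - ρ₀ (`RadialData.exists_isEmbedding`). These are regular across both
branches of the horizon and at the bifurcation sphere, so it does not matter which of Θ± vanishes on
the boundary. Identities that require division by X are proved off the boundary and extended by
continuity. -/

theorem exists_ne_zero_orthogonal_pair (hn : 3 ≤ n) (a b : Eucl n) :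
    ∃ w : Eucl n, w ≠ 0 ∧ inner ℝ w a = 0 ∧ inner ℝ w b = 0 := by
  set S : Submodule ℝ (Eucl n) := Submodule.span ℝ ({a, b} : Set (Eucl n)) with hS
  have h1 : Module.finrank ℝ S ≤ 2 := by
    have h := finrank_span_le_card (R := ℝ) ({a, b} : Set (Eucl n))
    refine h.trans ?_
    rw [Set.toFinset_insert, Set.toFinset_singleton]
    exact Finset.card_le_two
  have h2 := S.finrank_add_finrank_orthogonal
  rw [finrank_euclideanSpace, Fintype.card_fin] at h2
  have h3 : Sᗮ ≠ ⊥ := by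
    intro h
    rw [h, finrank_bot] at h2
    omega
  obtain ⟨w, hw, hw0⟩ := Submodule.exists_mem_ne_zero_of_ne_bot h3
  refine ⟨w, hw0, ?_, ?_⟩
  · exact Submodule.inner_left_of_mem_orthogonal (K := S) (Submodule.subset_span (by simp)) hw
  · exact Submodule.inner_left_of_mem_orthogonal (K := S) (Submodule.subset_span (by simp)) hw

/-- The reflection in the hyperplane orthogonal to `w`. -/
def hyperplaneReflection (w : Eucl n) : Eucl n ≃ₗᵢ[ℝ] Eucl n := (ℝ ∙ w)ᗮ.reflection

theorem hyperplaneReflection_of_inner_eq_zero {w u : Eucl n} (h : inner ℝ w u = 0) :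
    hyperplaneReflection w u = u :=
  Submodule.reflection_mem_subspace_eq_self (Submodule.mem_orthogonal_singleton_iff_inner_right.2 h)

theorem hyperplaneReflection_sub {a b : Eucl n} (h : ‖a‖ = ‖b‖) :
    hyperplaneReflection (a - b) a = b := Submodule.reflection_sub h

theorem det_hyperplaneReflection_cases (w : Eucl n) :
    LinearMap.det ((hyperplaneReflection w).toLinearEquiv : Eucl n →ₗ[ℝ] Eucl n) = 1 ∨
    LinearMap.det ((hyperplaneReflection w).toLinearEquiv : Eucl n →ₗ[ℝ] Eucl n) = -1 := by
  have h := Submodule.det_reflection (𝕜 := ℝ) ((ℝ ∙ w)ᗮ)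
  change LinearMap.det ((hyperplaneReflection w).toLinearEquiv : Eucl n →ₗ[ℝ] Eucl n) = _ at h
  rw [h]
  exact neg_one_pow_eq_or ℝ _

theorem det_hyperplaneReflection {w : Eucl n} (hw : w ≠ 0) :
    LinearMap.det ((hyperplaneReflection w).toLinearEquiv : Eucl n →ₗ[ℝ] Eucl n) = -1 := by
  have h := Submodule.det_reflection (𝕜 := ℝ) ((ℝ ∙ w)ᗮ)
  change LinearMap.det ((hyperplaneReflection w).toLinearEquiv : Eucl n →ₗ[ℝ] Eucl n) = _ at h
  rw [h, Submodule.orthogonal_orthogonal, finrank_span_singleton hw, pow_one]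

theorem det_trans_linearIsometryEquiv (A B : Eucl n ≃ₗᵢ[ℝ] Eucl n) :
    LinearMap.det ((A.trans B).toLinearEquiv : Eucl n →ₗ[ℝ] Eucl n) =
      LinearMap.det (B.toLinearEquiv : Eucl n →ₗ[ℝ] Eucl n) *
      LinearMap.det (A.toLinearEquiv : Eucl n →ₗ[ℝ] Eucl n) := by
  rw [← LinearMap.det_comp]
  rfl

/-- `SO(n)` acts transitively on orthonormal pairs when `n ≥ 3`. -/
theorem exists_rotation (hn : 3 ≤ n) {a b a' b' : Eucl n} (ha : ‖a‖ = 1) (hb : ‖b‖ = 1)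
    (hab : inner ℝ a b = 0) (ha' : ‖a'‖ = 1) (hb' : ‖b'‖ = 1) (hab' : inner ℝ a' b' = 0) :
    ∃ A : Eucl n ≃ₗᵢ[ℝ] Eucl n,
      LinearMap.det (A.toLinearEquiv : Eucl n →ₗ[ℝ] Eucl n) = 1 ∧ A a = a' ∧ A b = b' := by
  set R₁ := hyperplaneReflection (a - a')
  have h1 : R₁ a = a' := hyperplaneReflection_sub (ha.trans ha'.symm)
  set R₂ := hyperplaneReflection (R₁ b - b')
  have h2 : R₂ (R₁ b) = b' := hyperplaneReflection_sub (by rw [R₁.norm_map, hb, hb'])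
  -- The mirror of `R₂` has normal R₁ b - b', which is orthogonal to a', so the second reflection
  -- does not disturb the first match.
  have h3 : R₂ a' = a' := by
    apply hyperplaneReflection_of_inner_eq_zero
    rw [inner_sub_left, real_inner_comm, real_inner_comm a' b', hab', ← h1, R₁.inner_map_map, hab,
      sub_zero]
  -- In dimension at least three a further reflection can fix both targets, and it corrects the
  -- determinant when that is -1.
  obtain ⟨w, hw, hwa, hwb⟩ := exists_ne_zero_orthogonal_pair hn a' b'
  have hdet := det_trans_linearIsometryEquiv R₁ R₂
  have hcases : LinearMap.det ((R₁.trans R₂).toLinearEquiv : Eucl n →ₗ[ℝ] Eucl n) = 1 ∨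
      LinearMap.det ((R₁.trans R₂).toLinearEquiv : Eucl n →ₗ[ℝ] Eucl n) = -1 := by
    rw [hdet]
    rcases det_hyperplaneReflection_cases (a - a') with h | h <;>
      rcases det_hyperplaneReflection_cases (R₁ b - b') with h' | h' <;>
      rw [h, h'] <;> norm_num
  rcases hcases with h | h
  · exact ⟨R₁.trans R₂, h, by simp [h1, h3], by simp [h2]⟩
  · refine ⟨(R₁.trans R₂).trans (hyperplaneReflection w), ?_, ?_, ?_⟩
    · rw [det_trans_linearIsometryEquiv, h, det_hyperplaneReflection hw]; norm_num
    · simp [h1, h3, hyperplaneReflection_of_inner_eq_zero hwa]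
    · simp [h2, hyperplaneReflection_of_inner_eq_zero hwb]

/-- A bilinear form with the symmetries of a spherically symmetric tensor is determined by its
values on one orthonormal pair. -/
theorem form_eq_of_invariant {r A B : ℝ} {x : Eucl n} (hr : 0 < r) (hx : ‖x‖ = r) (b : Form n)
    (hsymm : ∀ u v, b u v = b v u)
    (h : ∀ u, ‖u‖ = 1 → inner ℝ x u = 0 → b (r⁻¹ • x) (r⁻¹ • x) = A ∧ b u u = B ∧
      b (r⁻¹ • x) u = 0) (hne : ∃ u : Eucl n, ‖u‖ = 1 ∧ inner ℝ x u = 0) (u v : Eucl n) :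
    b u v = B * inner ℝ u v + (A - B) / r ^ 2 * (inner ℝ x u * inner ℝ x v) := by
  set e := r⁻¹ • x with he
  have hee : inner ℝ e e = 1 := by
    rw [real_inner_self_eq_norm_sq, he, norm_smul, hx, norm_inv, Real.norm_of_nonneg hr.le,
      inv_mul_cancel₀ hr.ne', one_pow]
  have hxe : x = r • e := by rw [he, smul_smul, mul_inv_cancel₀ hr.ne', one_smul]
  have hA : b e e = A := by obtain ⟨u, hu, hu'⟩ := hne; exact (h u hu hu').1
  have hperp : ∀ w, inner ℝ x w = 0 → b w w = B * inner ℝ w w ∧ b e w = 0 := by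
    intro w hw
    by_cases hw0 : w = 0
    · simp [hw0]
    have hw1 : ‖w‖ ≠ 0 := norm_ne_zero_iff.2 hw0
    obtain ⟨-, h1, h2⟩ := h (‖w‖⁻¹ • w) (by rw [norm_smul, norm_inv, norm_norm,
      inv_mul_cancel₀ hw1]) (by rw [inner_smul_right, hw, mul_zero])
    simp only [map_smul, smul_apply, smul_eq_mul] at h1 h2
    rw [real_inner_self_eq_norm_sq]
    constructor
    · field_simp at h1
      linarith
    · exact (mul_eq_zero.1 h2).resolve_left (inv_ne_zero hw1)
  have hdiag : ∀ u, b u u = B * inner ℝ u u + (A - B) * inner ℝ e u ^ 2 := by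
    intro u
    set w := u - (inner ℝ e u : ℝ) • e with hw
    have hxw : inner ℝ x w = 0 := by
      rw [hxe, hw, inner_smul_left, inner_sub_right, inner_smul_right, hee]; simp
    obtain ⟨h1, h2⟩ := hperp w hxw
    have hu : u = w + (inner ℝ e u : ℝ) • e := by rw [hw]; abel
    have hww : inner ℝ w w = inner ℝ u u - inner ℝ e u ^ 2 := by
      rw [hw]
      simp only [inner_sub_left, inner_sub_right, inner_smul_left, inner_smul_right, hee,
        real_inner_comm e u]
      simp
      ring
    rw [hww] at h1
    have h3 := hsymm w e
    rw [h2] at h3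
    calc b u u = b (w + (inner ℝ e u : ℝ) • e) (w + (inner ℝ e u : ℝ) • e) := by rw [← hu]
      _ = _ := by
        simp only [map_add, map_smul, add_apply, smul_apply, smul_eq_mul, h1, h2, h3, hA]
        ring
  -- Polarization: the quadratic form determines the symmetric bilinear form.
  have h1 := hdiag (u + v)
  simp only [map_add, add_apply, inner_add_left, inner_add_right, hdiag u, hdiag v,
    real_inner_comm v u, hsymm v u] at h1
  rw [real_inner_comm v u]
  have h2 : inner ℝ x u * inner ℝ x v = r ^ 2 * (inner ℝ e u * inner ℝ e v) := by
    have h3 : ∀ y, inner ℝ x y = r * inner ℝ e y := fun y => by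
      conv_lhs => rw [hxe]
      rw [inner_smul_left]; simp
    rw [h3, h3]; ring
  rw [h2]
  field_simp
  linarith

/-- On `M`, the field `b` of bilinear forms is `β ⟨u, v⟩ + η ⟨x, u⟩ ⟨x, v⟩`, with `β` and `η`
evaluated at `‖x‖²`, and the profiles are smooth on a neighbourhood of `[1, ∞)`. -/
structure HasProfile (b : Eucl n → Form n) (a : ℝ) (β η : ℝ → ℝ) : Prop where
  apply_eq : ∀ x ∈ exteriorDomain n, ∀ u v,
    b x u v = β (‖x‖ ^ 2) * inner ℝ u v + η (‖x‖ ^ 2) * (inner ℝ x u * inner ℝ x v)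
  smooth_fst : ContDiffOn ℝ ∞ β (Set.Ioi a)
  smooth_snd : ContDiffOn ℝ ∞ η (Set.Ioi a)

/-- Openness is needed only at the endpoint 1. Keeping a positive makes √z and division by z smooth
on (a, ∞). -/
theorem exists_Ioi_subset_of_isOpen {U : Set ℝ} (hU : IsOpen U) (h : Set.Ici 1 ⊆ U) :
    ∃ a, 0 < a ∧ a < 1 ∧ Set.Ioi a ⊆ U := by
  obtain ⟨l, hl, hl'⟩ := exists_Ioc_subset_of_mem_nhds (hU.mem_nhds (h (Set.mem_Ici.2 le_rfl)))
    ⟨0, zero_lt_one⟩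
  refine ⟨max l (1 / 2), by positivity, max_lt hl (by norm_num), fun z hz => ?_⟩
  rcases le_total z 1 with h1 | h1
  · exact hl' ⟨(le_max_left _ _).trans_lt hz, h1⟩
  · exact h h1

/-- An invariant smooth symmetric 2-tensor has smooth profiles. -/
theorem exists_hasProfile (hn : 3 ≤ n) {b : Eucl n → Form n} (hb : SmoothNear (exteriorDomain n) b)
    (hsymm : ∀ x ∈ exteriorDomain n, ∀ u v, b x u v = b x v u)
    (hinv : ∀ A : Eucl n ≃ₗᵢ[ℝ] Eucl n,
      LinearMap.det (A.toLinearEquiv : Eucl n →ₗ[ℝ] Eucl n) = 1 →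
      ∀ x ∈ exteriorDomain n, ∀ u v, b (A x) (A u) (A v) = b x u v) :
    ∃ a β η, 0 < a ∧ a < 1 ∧ HasProfile b a β η := by
  set e₀ : Eucl n := stdVec ⟨0, by omega⟩ with he₀
  set e₁ : Eucl n := stdVec ⟨1, by omega⟩ with he₁
  have hn₀ : ‖e₀‖ = 1 := by simp [he₀, stdVec]
  have hn₁ : ‖e₁‖ = 1 := by simp [he₁, stdVec]
  have h₀₁ : inner ℝ e₀ e₁ = 0 := by simp [he₀, he₁, stdVec, EuclideanSpace.inner_single_left]
  obtain ⟨U, hU, hMU, hbU⟩ := hb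
  have hVo : IsOpen ((fun z : ℝ => √z • e₀) ⁻¹' U) := hU.preimage (by fun_prop)
  have hnorm : ∀ z : ℝ, ‖√z • e₀‖ = √z := fun z => by
    rw [norm_smul, hn₀, mul_one, Real.norm_of_nonneg (Real.sqrt_nonneg z)]
  obtain ⟨a, ha0, ha1, haU⟩ := exists_Ioi_subset_of_isOpen hVo fun z (hz : 1 ≤ z) => hMU (by
    change 1 ≤ ‖√z • e₀‖
    rw [hnorm]
    exact Real.one_le_sqrt.2 hz)
  have hpos : ∀ z ∈ Set.Ioi a, z ≠ 0 := fun z hz => (ha0.trans hz).ne'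
  have hs : ContDiffOn ℝ ∞ (fun z : ℝ => b (√z • e₀)) (Set.Ioi a) := by
    refine hbU.comp ?_ haU
    exact (contDiffOn_id.sqrt hpos).smul contDiffOn_const
  have hsm : ∀ u v : Eucl n, ContDiffOn ℝ ∞ (fun z : ℝ => b (√z • e₀) u v) (Set.Ioi a) :=
    fun u v => (hs.clm_apply contDiffOn_const).clm_apply contDiffOn_const
  -- The profiles are read off on the ray through e₀: the tangential value, and the excess of the
  -- radial over the tangential value divided by z.
  refine ⟨a, fun z => b (√z • e₀) e₁ e₁,
    fun z => (b (√z • e₀) e₀ e₀ - b (√z • e₀) e₁ e₁) / z, ha0, ha1, ?_, hsm _ _,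
    ((hsm _ _).sub (hsm _ _)).div contDiffOn_id hpos⟩
  intro x hx u v
  have hx1 : 1 ≤ ‖x‖ := hx
  have hr : 0 < ‖x‖ := by linarith
  have hsqrt : √(‖x‖ ^ 2) = ‖x‖ := Real.sqrt_sq hr.le
  simp only [hsqrt]
  have hxn : ‖‖x‖⁻¹ • x‖ = 1 := by
    rw [norm_smul, norm_inv, norm_norm, inv_mul_cancel₀ hr.ne']
  have hM : ‖x‖ • e₀ ∈ exteriorDomain n := by
    change 1 ≤ ‖‖x‖ • e₀‖
    rwa [norm_smul, hn₀, mul_one, norm_norm]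
  have key : ∀ u, ‖u‖ = 1 → inner ℝ x u = 0 →
      b x (‖x‖⁻¹ • x) (‖x‖⁻¹ • x) = b (‖x‖ • e₀) e₀ e₀ ∧ b x u u = b (‖x‖ • e₀) e₁ e₁ ∧
      b x (‖x‖⁻¹ • x) u = b (‖x‖ • e₀) e₀ e₁ := by
    intro u hu hxu
    obtain ⟨A, hA, h1, h2⟩ := exists_rotation hn hn₀ hn₁ h₀₁ hxn hu
      (by rw [inner_smul_left, hxu, mul_zero])
    have hAx : A (‖x‖ • e₀) = x := by
      rw [map_smul, h1, smul_smul, mul_inv_cancel₀ hr.ne', one_smul]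
    have h3 := hinv A hA _ hM
    rw [hAx] at h3
    refine ⟨?_, ?_, ?_⟩
    · rw [← h3 e₀ e₀, h1]
    · rw [← h3 e₁ e₁, h2]
    · rw [← h3 e₀ e₁, h1, h2]
  refine form_eq_of_invariant hr rfl (b x) (hsymm x hx) (fun u hu hxu => ?_) ?_ u v
  · obtain ⟨h1, h2, h3⟩ := key u hu hxu
    refine ⟨h1, h2, ?_⟩
    -- Rotations carry e₁ to u and also to -u, so the mixed component equals its own negative.
    have h4 := (key (-u) (by rwa [norm_neg]) (by rw [inner_neg_right, hxu, neg_zero])).2.2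
    rw [map_neg, ← h3] at h4
    linarith
  · obtain ⟨w, hw, hwx, -⟩ := exists_ne_zero_orthogonal_pair hn x x
    refine ⟨‖w‖⁻¹ • w, ?_, ?_⟩
    · rw [norm_smul, norm_inv, norm_norm, inv_mul_cancel₀ (norm_ne_zero_iff.2 hw)]
    · rw [inner_smul_right, real_inner_comm, hwx, mul_zero]

end Penrose

namespace Penrose

variable {n : ℕ}

/-! ### Partial derivatives of radial expressions -/

/-- The Kronecker symbol. -/
def kd (i j : Fin n) : ℝ := if i = j then 1 else 0

theorem kd_comm (i j : Fin n) : kd i j = kd j i := by simp [kd, eq_comm]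

theorem kd_mul_self (i j : Fin n) : kd i j * kd i j = kd i j := by simp [kd]

theorem kd_self (i : Fin n) : kd i i = 1 := by simp [kd]

theorem stdVec_apply (i j : Fin n) : (stdVec i : Eucl n) j = kd i j := by
  simp [stdVec, kd, eq_comm]

theorem inner_stdVec (x : Eucl n) (i : Fin n) : inner ℝ x (stdVec i) = x i := by
  simp [stdVec, EuclideanSpace.inner_single_right]

theorem inner_stdVec_stdVec (i j : Fin n) : inner ℝ (stdVec i) (stdVec j : Eucl n) = kd i j := by
  rw [inner_stdVec, stdVec_apply]

theorem norm_sq_eq_sum (x : Eucl n) : ‖x‖ ^ 2 = ∑ i, x i * x i := by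
  rw [EuclideanSpace.real_norm_sq_eq]
  simp [sq]

/-- `f` is differentiable at `x` with `l`-th partial derivative `f'`. -/
def HasPd (l : Fin n) (f : Eucl n → ℝ) (f' : ℝ) (x : Eucl n) : Prop :=
  DifferentiableAt ℝ f x ∧ pd l f x = f'

namespace HasPd

variable {l : Fin n} {f h : Eucl n → ℝ} {f' h' : ℝ} {x : Eucl n}

theorem add (hf : HasPd l f f' x) (hh : HasPd l h h' x) :
    HasPd l (fun z => f z + h z) (f' + h') x := by
  refine ⟨hf.1.add hh.1, ?_⟩
  rw [← hf.2, ← hh.2, pd, fderiv_fun_add hf.1 hh.1]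
  rfl

theorem mul (hf : HasPd l f f' x) (hh : HasPd l h h' x) :
    HasPd l (fun z => f z * h z) (f' * h x + f x * h') x := by
  refine ⟨hf.1.mul hh.1, ?_⟩
  rw [← hf.2, ← hh.2, pd, fderiv_fun_mul hf.1 hh.1]
  simp [pd]
  ring

theorem const (c : ℝ) : HasPd l (fun _ => c) 0 x := by
  refine ⟨differentiableAt_const c, ?_⟩
  simp [pd]

theorem coord (i : Fin n) : HasPd l (fun z => z i) (kd l i) x := by
  have h : HasFDerivAt (fun z : Eucl n => z i) (EuclideanSpace.proj (𝕜 := ℝ) i : Eucl n →L[ℝ] ℝ) x :=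
    (EuclideanSpace.proj (𝕜 := ℝ) i : Eucl n →L[ℝ] ℝ).hasFDerivAt
  refine ⟨h.differentiableAt, ?_⟩
  rw [pd, h.fderiv]
  simp [stdVec_apply]

theorem radial {F : ℝ → ℝ} {F' : ℝ} (hF : HasDerivAt F F' (‖x‖ ^ 2)) :
    HasPd l (fun z => F (‖z‖ ^ 2)) (2 * F' * x l) x := by
  have h := hF.comp_hasFDerivAt x (hasStrictFDerivAt_norm_sq x).hasFDerivAt
  refine ⟨h.differentiableAt, ?_⟩
  rw [pd]
  erw [h.fderiv]
  simp [inner_stdVec]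
  ring

theorem congr (hf : HasPd l f f' x) (hfh : h =ᶠ[nhds x] f) (he : f' = h') : HasPd l h h' x := by
  refine ⟨hf.1.congr_of_eventuallyEq hfh, ?_⟩
  rw [pd, hfh.fderiv_eq, ← he]
  exact hf.2

end HasPd

theorem eventually_mem_exteriorDomain {x : Eucl n} (hx : 1 < ‖x‖) :
    ∀ᶠ z in nhds x, 1 < ‖z‖ :=
  (isOpen_lt continuous_const continuous_norm).mem_nhds hx

/-- Contraction of one index. -/
theorem sum_contract (x : Eucl n) (i j l : Fin n) (C0 C1 C2 C3 C4 C5 C6 C7 C8 : ℝ) :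
    ∑ m, (C0 + C1 * (x m * x m) + C2 * (kd m i * x m) + C3 * (kd m j * x m) +
      C4 * (kd m l * x m) + C5 * (kd m i * kd m j) + C6 * (kd m i * kd m l) +
      C7 * (kd m j * kd m l) + C8 * kd m l) =
    n * C0 + C1 * ‖x‖ ^ 2 + C2 * x i + C3 * x j + C4 * x l + C5 * kd i j + C6 * kd i l +
      C7 * kd j l + C8 := by
  rw [kd_comm i j, kd_comm i l, kd_comm j l]
  simp only [Finset.sum_add_distrib, ← Finset.mul_sum, norm_sq_eq_sum]
  simp [kd, ite_mul, Finset.sum_ite_eq']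

/-! ### The metric and its inverse -/

section Metric

variable {g : Eucl n → Form n} {a : ℝ} {β η : ℝ → ℝ} {x : Eucl n}

theorem HasProfile.comp_eq (hg : HasProfile g a β η) (hx : x ∈ exteriorDomain n) (i j : Fin n) :
    comp g i j x = β (‖x‖ ^ 2) * kd i j + η (‖x‖ ^ 2) * (x i * x j) := by
  rw [comp, hg.apply_eq x hx, inner_stdVec_stdVec, inner_stdVec, inner_stdVec]

theorem one_le_norm_sq (hx : x ∈ exteriorDomain n) : 1 ≤ ‖x‖ ^ 2 := one_le_pow₀ hx

/-- The profile describes a positive definite form: `β > 0` and `β + η z > 0`. -/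
structure PosProfile (a : ℝ) (β η : ℝ → ℝ) : Prop where
  nonneg : 0 < a
  lt_one : a < 1
  fst_pos : ∀ z, a < z → 0 < β z
  snd_pos : ∀ z, a < z → 0 < β z + η z * z

/-- Sherman–Morrison inversion of a rank-one perturbation of a multiple of the identity. -/
theorem gInv_eq_of_comp_eq {b e : ℝ} (hb : b ≠ 0) (he : b + e * ‖x‖ ^ 2 ≠ 0)
    (h : ∀ i j, comp g i j x = b * kd i j + e * (x i * x j)) (i j : Fin n) :
    gInv g x i j = b⁻¹ * (kd i j - e / (b + e * ‖x‖ ^ 2) * (x i * x j)) := by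
  have : gInv g x = Matrix.of fun i j => b⁻¹ * (kd i j - e / (b + e * ‖x‖ ^ 2) * (x i * x j)) := by
    refine Matrix.inv_eq_right_inv ?_
    ext i j
    rw [Matrix.mul_apply, Matrix.one_apply]
    change ∑ m, gram g x i m * _ = kd i j
    simp only [gram, Matrix.of_apply, h]
    have h1 := sum_contract x i j j 0 (-(e * x i * x j * b⁻¹ * (e / (b + e * ‖x‖ ^ 2))))
      (-(x j * (e / (b + e * ‖x‖ ^ 2)))) (e * x i * b⁻¹) 0 1 0 0 0
    refine (Finset.sum_congr rfl fun m _ => ?_).trans (h1.trans ?_)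
    · rw [kd_comm i m]
      field_simp
      ring
    · field_simp
      ring
  rw [this, Matrix.of_apply]

theorem gInv_eq (hg : HasProfile g a β η) (hp : PosProfile a β η) (hx : x ∈ exteriorDomain n)
    (i j : Fin n) :
    gInv g x i j = (β (‖x‖ ^ 2))⁻¹ *
      (kd i j - η (‖x‖ ^ 2) / (β (‖x‖ ^ 2) + η (‖x‖ ^ 2) * ‖x‖ ^ 2) * (x i * x j)) :=
  have h1 : a < ‖x‖ ^ 2 := hp.lt_one.trans_le (one_le_norm_sq hx)
  gInv_eq_of_comp_eq (hp.fst_pos _ h1).ne' (hp.snd_pos _ h1).ne' (hg.comp_eq hx) i j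

theorem HasProfile.hasDerivAt_fst (hg : HasProfile g a β η) {z : ℝ} (hz : a < z) :
    HasDerivAt β (deriv β z) z :=
  ((hg.smooth_fst.contDiffAt (Ioi_mem_nhds hz)).differentiableAt (by simp)).hasDerivAt

theorem HasProfile.hasDerivAt_snd (hg : HasProfile g a β η) {z : ℝ} (hz : a < z) :
    HasDerivAt η (deriv η z) z :=
  ((hg.smooth_snd.contDiffAt (Ioi_mem_nhds hz)).differentiableAt (by simp)).hasDerivAt

theorem contDiffOn_deriv {f : ℝ → ℝ} (hf : ContDiffOn ℝ ∞ f (Set.Ioi a)) :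
    ContDiffOn ℝ ∞ (deriv f) (Set.Ioi a) :=
  hf.deriv_of_isOpen isOpen_Ioi (by simp)

theorem hasDerivAt_of_contDiffOn {f : ℝ → ℝ} (hf : ContDiffOn ℝ ∞ f (Set.Ioi a)) {z : ℝ}
    (hz : a < z) : HasDerivAt f (deriv f z) z :=
  ((hf.contDiffAt (Ioi_mem_nhds hz)).differentiableAt (by simp)).hasDerivAt

theorem pd_comp (hg : HasProfile g a β η) (ha : a < 1) (hx : 1 < ‖x‖) (l i j : Fin n) :
    pd l (comp g i j) x =
      2 * deriv β (‖x‖ ^ 2) * x l * kd i j + (2 * deriv η (‖x‖ ^ 2) * x l * (x i * x j) +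
        η (‖x‖ ^ 2) * (kd l i * x j + x i * kd l j)) := by
  have h1 : a < ‖x‖ ^ 2 := ha.trans_le (one_le_norm_sq hx.le)
  have h := ((HasPd.radial (l := l) (hg.hasDerivAt_fst h1)).mul (HasPd.const (kd i j))).add
    ((HasPd.radial (hg.hasDerivAt_snd h1)).mul ((HasPd.coord i).mul (HasPd.coord j)))
  refine (h.congr (h' := _) ?_ rfl).2.trans (by ring)
  filter_upwards [eventually_mem_exteriorDomain hx] with z hz using hg.comp_eq hz.le i j

/-! ### Curvature -/

/-- The coefficient of `xᵢ δⱼₗ + xⱼ δᵢₗ` in the Christoffel symbol. -/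
def chrA (β : ℝ → ℝ) (z : ℝ) : ℝ := deriv β z / β z

/-- The coefficient of `δᵢⱼ xₗ` in the Christoffel symbol. -/
def chrB (β η : ℝ → ℝ) (z : ℝ) : ℝ := (η z - deriv β z) / (β z + η z * z)

/-- The coefficient of `xᵢ xⱼ xₗ` in the Christoffel symbol. -/
def chrC (β η : ℝ → ℝ) (z : ℝ) : ℝ :=
  (deriv η z - 2 * deriv β z * η z / β z) / (β z + η z * z)

/-- Symmetry leaves only three index structures. As in the later contractions, the summand is
matched to the fixed template of `sum_contract`, whose arguments are the coefficients of the
monomials in the summed index. -/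
theorem christoffel_eq (hg : HasProfile g a β η) (hp : PosProfile a β η) (hx : 1 < ‖x‖)
    (l i j : Fin n) :
    christoffel g l i j x = chrA β (‖x‖ ^ 2) * (x i * kd l j + x j * kd l i) +
      chrB β η (‖x‖ ^ 2) * (kd i j * x l) + chrC β η (‖x‖ ^ 2) * (x i * x j * x l) := by
  have h1 : a < ‖x‖ ^ 2 := hp.lt_one.trans_le (one_le_norm_sq hx.le)
  have hb := (hp.fst_pos _ h1).ne'
  have hA := (hp.snd_pos _ h1).ne'
  simp only [christoffel, gInv_eq hg hp hx.le, pd_comp hg hp.lt_one hx, chrA, chrB, chrC]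
  generalize deriv β (‖x‖ ^ 2) = b1 at *
  generalize deriv η (‖x‖ ^ 2) = e1 at *
  generalize β (‖x‖ ^ 2) = b at *
  generalize η (‖x‖ ^ 2) = e at *
  have h2 := sum_contract x i j l 0
    (-(b⁻¹ * (e / (b + e * ‖x‖ ^ 2)) * x l *
      (2 * e1 * x i * x j - 2 * b1 * kd i j + 2 * e * kd i j)))
    (-(b⁻¹ * (e / (b + e * ‖x‖ ^ 2)) * x l * 2 * b1 * x j))
    (-(b⁻¹ * (e / (b + e * ‖x‖ ^ 2)) * x l * 2 * b1 * x i))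
    (b⁻¹ * (2 * e1 * x i * x j - 2 * b1 * kd i j + 2 * e * kd i j)) 0
    (b⁻¹ * 2 * b1 * x j) (b⁻¹ * 2 * b1 * x i) 0
  refine (congrArg (fun t => 1 / 2 * t)
    ((Finset.sum_congr rfl fun m _ => ?_).trans h2)).trans ?_
  · rw [kd_comm l m, kd_comm i m, kd_comm j m, kd_comm j i]
    ring
  · rw [kd_comm l i, kd_comm l j]
    field_simp
    ring

end Metric

end Penrose

namespace Penrose

variable {n : ℕ}

section Curvature

variable {g : Eucl n → Form n} {a : ℝ} {β η : ℝ → ℝ} {x : Eucl n}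

theorem contDiffOn_radial (hg : HasProfile g a β η) :
    ContDiffOn ℝ ∞ (fun z => β z + η z * z) (Set.Ioi a) :=
  hg.smooth_fst.add (hg.smooth_snd.mul contDiffOn_id)

theorem contDiffOn_chrA (hg : HasProfile g a β η) (hp : PosProfile a β η) :
    ContDiffOn ℝ ∞ (chrA β) (Set.Ioi a) :=
  (contDiffOn_deriv hg.smooth_fst).div hg.smooth_fst fun z hz => (hp.fst_pos z hz).ne'

theorem contDiffOn_chrB (hg : HasProfile g a β η) (hp : PosProfile a β η) :
    ContDiffOn ℝ ∞ (chrB β η) (Set.Ioi a) :=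
  (hg.smooth_snd.sub (contDiffOn_deriv hg.smooth_fst)).div (contDiffOn_radial hg)
    fun z hz => (hp.snd_pos z hz).ne'

theorem contDiffOn_chrC (hg : HasProfile g a β η) (hp : PosProfile a β η) :
    ContDiffOn ℝ ∞ (chrC β η) (Set.Ioi a) :=
  ((contDiffOn_deriv hg.smooth_snd).sub
    (((contDiffOn_const.mul (contDiffOn_deriv hg.smooth_fst)).mul hg.smooth_snd).div hg.smooth_fst
      fun z hz => (hp.fst_pos z hz).ne')).div (contDiffOn_radial hg)
    fun z hz => (hp.snd_pos z hz).ne'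

/-- The closed form of the symbols is valid on the open set 1 < ‖x‖ and may be differentiated there.
The curvature is therefore computed only off the boundary, which is enough because the monotonicity
argument uses the constraints only for z > 1. -/
theorem pd_christoffel (hg : HasProfile g a β η) (hp : PosProfile a β η) (hx : 1 < ‖x‖)
    (k l i j : Fin n) :
    pd k (christoffel g l i j) x =
      2 * deriv (chrA β) (‖x‖ ^ 2) * x k * (x i * kd l j + x j * kd l i) +
      chrA β (‖x‖ ^ 2) * (kd k i * kd l j + kd k j * kd l i) +
      2 * deriv (chrB β η) (‖x‖ ^ 2) * x k * (kd i j * x l) +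
      chrB β η (‖x‖ ^ 2) * (kd i j * kd k l) +
      2 * deriv (chrC β η) (‖x‖ ^ 2) * x k * (x i * x j * x l) +
      chrC β η (‖x‖ ^ 2) * (kd k i * x j * x l + x i * kd k j * x l + x i * x j * kd k l) := by
  have h1 : a < ‖x‖ ^ 2 := hp.lt_one.trans_le (one_le_norm_sq hx.le)
  have hA := HasPd.radial (l := k) (hasDerivAt_of_contDiffOn (contDiffOn_chrA hg hp) h1)
  have hB := HasPd.radial (l := k) (hasDerivAt_of_contDiffOn (contDiffOn_chrB hg hp) h1)
  have hC := HasPd.radial (l := k) (hasDerivAt_of_contDiffOn (contDiffOn_chrC hg hp) h1)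
  have hc := fun i => HasPd.coord (l := k) (x := x) i
  have h := ((hA.mul (((hc i).mul (HasPd.const (kd l j))).add
    ((hc j).mul (HasPd.const (kd l i))))).add
    (hB.mul ((HasPd.const (kd i j)).mul (hc l)))).add (hC.mul (((hc i).mul (hc j)).mul (hc l)))
  refine (h.congr (h' := _) ?_ rfl).2.trans (by ring)
  filter_upwards [eventually_mem_exteriorDomain hx] with z hz using christoffel_eq hg hp hz l i j

theorem sum_christoffel_diag (hg : HasProfile g a β η) (hp : PosProfile a β η) (hx : 1 < ‖x‖)
    (i : Fin n) :
    ∑ l, christoffel g l l i x = ((n + 1) * chrA β (‖x‖ ^ 2) + chrB β η (‖x‖ ^ 2) +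
      chrC β η (‖x‖ ^ 2) * ‖x‖ ^ 2) * x i := by
  simp only [christoffel_eq hg hp hx, kd_self]
  generalize chrA β (‖x‖ ^ 2) = A
  generalize chrB β η (‖x‖ ^ 2) = B
  generalize chrC β η (‖x‖ ^ 2) = C
  refine (Finset.sum_congr rfl fun m _ => ?_).trans ((sum_contract x i i i (A * x i) (C * x i)
    (A + B) 0 0 0 0 0 0).trans ?_) <;> ring

theorem sum_christoffel_mul (hg : HasProfile g a β η) (hp : PosProfile a β η) (hx : 1 < ‖x‖)
    (i j : Fin n) :
    ∑ m, x m * christoffel g m i j x =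
      chrB β η (‖x‖ ^ 2) * ‖x‖ ^ 2 * kd i j +
      (2 * chrA β (‖x‖ ^ 2) + chrC β η (‖x‖ ^ 2) * ‖x‖ ^ 2) * (x i * x j) := by
  simp only [christoffel_eq hg hp hx]
  generalize chrA β (‖x‖ ^ 2) = A
  generalize chrB β η (‖x‖ ^ 2) = B
  generalize chrC β η (‖x‖ ^ 2) = C
  refine (Finset.sum_congr rfl fun m _ => ?_).trans ((sum_contract x i j j 0
    (B * kd i j + C * (x i * x j)) (A * x j) (A * x i) 0 0 0 0 0).trans ?_) <;> ring

theorem sum_christoffel_sq (hg : HasProfile g a β η) (hp : PosProfile a β η) (hx : 1 < ‖x‖)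
    (i j : Fin n) :
    ∑ l, ∑ m, christoffel g l j m x * christoffel g m i l x =
      2 * chrA β (‖x‖ ^ 2) * chrB β η (‖x‖ ^ 2) * ‖x‖ ^ 2 * kd i j +
      (chrA β (‖x‖ ^ 2) ^ 2 * (n + 3) + 2 * chrA β (‖x‖ ^ 2) * chrB β η (‖x‖ ^ 2) +
        chrB β η (‖x‖ ^ 2) ^ 2 + 4 * chrA β (‖x‖ ^ 2) * chrC β η (‖x‖ ^ 2) * ‖x‖ ^ 2 +
        2 * chrB β η (‖x‖ ^ 2) * chrC β η (‖x‖ ^ 2) * ‖x‖ ^ 2 +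
        chrC β η (‖x‖ ^ 2) ^ 2 * (‖x‖ ^ 2) ^ 2) * (x i * x j) := by
  simp only [christoffel_eq hg hp hx]
  generalize chrA β (‖x‖ ^ 2) = A
  generalize chrB β η (‖x‖ ^ 2) = B
  generalize chrC β η (‖x‖ ^ 2) = C
  have inner : ∀ l, ∑ m, (A * (x j * kd l m + x m * kd l j) + B * (kd j m * x l) +
        C * (x j * x m * x l)) *
      (A * (x i * kd m l + x l * kd m i) + B * (kd i l * x m) + C * (x i * x l * x m)) =
      A ^ 2 * x i * x j + (3 * A * C + B * C + C ^ 2 * ‖x‖ ^ 2) * x i * x j * (x l * x l) +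
      A * B * kd i j * (x l * x l) +
      (A ^ 2 + A * B + B * C * ‖x‖ ^ 2 + B ^ 2) * x j * (kd l i * x l) +
      (2 * A ^ 2 + A * C * ‖x‖ ^ 2 + A * B) * x i * (kd l j * x l) +
      A * B * ‖x‖ ^ 2 * (kd l i * kd l j) := by
    intro l
    refine (Finset.sum_congr rfl fun m _ => ?_).trans ((sum_contract x i j l 0
      (A * B * kd l j * kd l i + A * C * x i * x l * kd l j + B * C * x j * x l * kd l i +
        C ^ 2 * x i * x j * (x l * x l))
      (A ^ 2 * x l * kd l j + A * C * x j * x l * x l)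
      (B ^ 2 * x l * kd l i + B * C * x i * (x l * x l))
      (A ^ 2 * x i * kd l j + A * B * x j * kd l i + 2 * A * C * x i * x j * x l)
      (A * B * (x l * x l))
      (A ^ 2 * x j * x l) (A * B * x i * x l) (A ^ 2 * x i * x j)).trans ?_)
    · rw [kd_comm l m, kd_comm j m, kd_comm i l]
      -- The square of a Kronecker symbol is not in the template and has to be reduced first.
      linear_combination (A ^ 2 * x i * x j) * kd_mul_self m l
    · rw [kd_comm i l, kd_comm j l]
      ring
  rw [Finset.sum_congr rfl fun l _ => inner l]
  refine (Finset.sum_congr rfl fun m _ => ?_).trans ((sum_contract x i j j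
    (A ^ 2 * x i * x j)
    ((3 * A * C + B * C + C ^ 2 * ‖x‖ ^ 2) * x i * x j + A * B * kd i j)
    ((A ^ 2 + A * B + B * C * ‖x‖ ^ 2 + B ^ 2) * x j)
    ((2 * A ^ 2 + A * C * ‖x‖ ^ 2 + A * B) * x i) 0 (A * B * ‖x‖ ^ 2) 0 0 0).trans ?_)
  · ring
  · ring

theorem sum_pd_christoffel (hg : HasProfile g a β η) (hp : PosProfile a β η) (hx : 1 < ‖x‖)
    (i j : Fin n) :
    ∑ l, (pd l (christoffel g l i j) x - pd j (christoffel g l i l) x) =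
      (2 * deriv (chrB β η) (‖x‖ ^ 2) * ‖x‖ ^ 2 + (n - 1) * chrB β η (‖x‖ ^ 2) -
        (n - 1) * chrA β (‖x‖ ^ 2) - chrC β η (‖x‖ ^ 2) * ‖x‖ ^ 2) * kd i j +
      ((2 - 2 * n) * deriv (chrA β) (‖x‖ ^ 2) - 2 * deriv (chrB β η) (‖x‖ ^ 2) +
        n * chrC β η (‖x‖ ^ 2)) * (x i * x j) := by
  simp only [pd_christoffel hg hp hx, kd_self]
  generalize deriv (chrA β) (‖x‖ ^ 2) = A1
  generalize deriv (chrB β η) (‖x‖ ^ 2) = B1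
  generalize deriv (chrC β η) (‖x‖ ^ 2) = C1
  generalize chrA β (‖x‖ ^ 2) = A
  generalize chrB β η (‖x‖ ^ 2) = B
  generalize chrC β η (‖x‖ ^ 2) = C
  refine (Finset.sum_congr rfl fun m _ => ?_).trans ((sum_contract x i j j
    (B * kd i j + C * x i * x j - 2 * A1 * x i * x j - A * kd i j)
    (2 * B1 * kd i j - C * kd i j) (C * x j - 2 * B1 * x j) (2 * A1 * x i - C * x i) 0
    (A - B) 0 0 0).trans ?_)
  · rw [kd_comm j i, kd_comm j m, kd_comm i m]
    ring
  · ring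

theorem ricci_eq (hg : HasProfile g a β η) (hp : PosProfile a β η) (hx : 1 < ‖x‖)
    (i j : Fin n) :
    ricci g i j x =
      (2 * deriv (chrB β η) (‖x‖ ^ 2) * ‖x‖ ^ 2 + (n - 1) * chrB β η (‖x‖ ^ 2) -
        (n - 1) * chrA β (‖x‖ ^ 2) - chrC β η (‖x‖ ^ 2) * ‖x‖ ^ 2 +
        ((n - 1) * chrA β (‖x‖ ^ 2) + chrB β η (‖x‖ ^ 2) + chrC β η (‖x‖ ^ 2) * ‖x‖ ^ 2) *
          chrB β η (‖x‖ ^ 2) * ‖x‖ ^ 2) * kd i j +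
      ((2 - 2 * n) * deriv (chrA β) (‖x‖ ^ 2) - 2 * deriv (chrB β η) (‖x‖ ^ 2) +
        n * chrC β η (‖x‖ ^ 2) + (n - 1) * chrA β (‖x‖ ^ 2) ^ 2 +
        (n - 1) * chrA β (‖x‖ ^ 2) * chrC β η (‖x‖ ^ 2) * ‖x‖ ^ 2 - chrB β η (‖x‖ ^ 2) ^ 2 -
        chrB β η (‖x‖ ^ 2) * chrC β η (‖x‖ ^ 2) * ‖x‖ ^ 2) * (x i * x j) := by
  -- The contracted symbol is a multiple of x m, so the double sum collapses to a single contraction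
  -- with x.
  have h1 : ∑ l, ∑ m, christoffel g l l m x * christoffel g m i j x =
      ((n + 1) * chrA β (‖x‖ ^ 2) + chrB β η (‖x‖ ^ 2) +
        chrC β η (‖x‖ ^ 2) * ‖x‖ ^ 2) * ∑ m, x m * christoffel g m i j x := by
    rw [Finset.sum_comm, Finset.mul_sum]
    refine Finset.sum_congr rfl fun m _ => ?_
    rw [← Finset.sum_mul, sum_christoffel_diag hg hp hx]
    ring
  rw [ricci, sum_pd_christoffel hg hp hx]
  simp only [Finset.sum_sub_distrib]
  rw [sum_christoffel_sq hg hp hx, h1, sum_christoffel_mul hg hp hx]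
  ring

theorem sum_gInv_mul (hg : HasProfile g a β η) (hp : PosProfile a β η)
    (hx : x ∈ exteriorDomain n) (U V : ℝ) :
    ∑ i, ∑ j, gInv g x i j * (U * kd i j + V * (x i * x j)) =
      (n - 1) * (U / β (‖x‖ ^ 2)) +
        (U + V * ‖x‖ ^ 2) / (β (‖x‖ ^ 2) + η (‖x‖ ^ 2) * ‖x‖ ^ 2) := by
  have h1 : a < ‖x‖ ^ 2 := hp.lt_one.trans_le (one_le_norm_sq hx)
  have hb := (hp.fst_pos _ h1).ne'
  have hA := (hp.snd_pos _ h1).ne'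
  simp only [gInv_eq hg hp hx]
  generalize β (‖x‖ ^ 2) = b at *
  generalize η (‖x‖ ^ 2) = e at *
  set c := e / (b + e * ‖x‖ ^ 2) with hc
  have inner : ∀ i, ∑ j, b⁻¹ * (kd i j - c * (x i * x j)) * (U * kd i j + V * (x i * x j)) =
      b⁻¹ * U + b⁻¹ * (V - c * U - c * V * ‖x‖ ^ 2) * (x i * x i) := fun i => by
    refine (Finset.sum_congr rfl fun m _ => ?_).trans ((sum_contract x i i i 0
      (-(b⁻¹ * c * V * (x i * x i))) (b⁻¹ * (V - c * U) * x i) 0 0 0 0 0 (b⁻¹ * U)).trans ?_)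
    · rw [kd_comm i m]
      linear_combination b⁻¹ * U * kd_mul_self m i
    · ring
  rw [Finset.sum_congr rfl fun i _ => inner i]
  rw [Finset.sum_add_distrib, ← Finset.mul_sum, ← Finset.mul_sum, ← norm_sq_eq_sum,
    Finset.sum_const,
    Finset.card_univ, Fintype.card_fin, nsmul_eq_mul, hc]
  field_simp
  ring

/-- The scalar curvature in terms of the profiles of the metric. -/
theorem scalarCurvature_eq (hg : HasProfile g a β η) (hp : PosProfile a β η) (hx : 1 < ‖x‖)
    {z b b1 b2 e e1 A A1 : ℝ} (hz : z = ‖x‖ ^ 2) (hb : b = β z) (hb1 : b1 = deriv β z)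
    (hb2 : b2 = deriv (deriv β) z) (he : e = η z) (he1 : e1 = deriv η z) (hA : A = b + e * z)
    (hA1 : A1 = b1 + e + z * e1) :
    scalarCurvature g x =
      (n - 1) * (n - 2) * (b * e - 2 * b * b1 - z * b1 ^ 2) / (b ^ 2 * A) -
      4 * (n - 1) * ((2 * b1 + z * b2) -
        (b + z * b1) * (b1 * A + b * A1) / (2 * b * A)) / (b * A) := by
  have h1 : a < z := hz ▸ hp.lt_one.trans_le (one_le_norm_sq hx.le)
  have hb0 : b ≠ 0 := hb ▸ (hp.fst_pos _ h1).ne'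
  have hA0 : A ≠ 0 := by rw [hA, hb, he]; exact (hp.snd_pos _ h1).ne'
  have dβ : HasDerivAt β b1 z := hb1 ▸ hg.hasDerivAt_fst h1
  have dβ1 : HasDerivAt (deriv β) b2 z :=
    hb2 ▸ hasDerivAt_of_contDiffOn (contDiffOn_deriv hg.smooth_fst) h1
  have dη : HasDerivAt η e1 z := he1 ▸ hg.hasDerivAt_snd h1
  have dA : deriv (chrA β) z = (b2 * b - b1 * b1) / b ^ 2 := by
    have := (dβ1.div dβ (hb ▸ hb0)).deriv
    rw [← hb, ← hb1] at this
    exact this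
  have dB : deriv (chrB β η) z = ((e1 - b2) * A - (e - b1) * A1) / A ^ 2 := by
    have h2 := (dη.sub dβ1).div (dβ.add (dη.mul (hasDerivAt_id z)))
      (by simp only [Pi.add_apply, Pi.mul_apply, id]; rw [← hb, ← he, ← hA]; exact hA0)
    have h3 := h2.deriv
    simp only [Pi.add_apply, Pi.mul_apply, Pi.sub_apply, id, ← hb, ← he, ← hb1, ← hA, mul_one] at h3
    rw [hA1]
    refine Eq.trans ?_ (h3.trans ?_)
    · rfl
    · ring
  rw [scalarCurvature]
  simp only [ricci_eq hg hp hx]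
  rw [sum_gInv_mul hg hp hx.le, ← hz, dA, dB, chrA, chrB, chrC, ← hb, ← he, ← hb1, ← he1, ← hA]
  have he' : e * z = A - b := by rw [hA]; ring
  have hz0 : z ≠ 0 := (hp.nonneg.trans h1).ne'
  -- With A = b + ez as a variable in place of e, all denominators are monomials.
  obtain rfl : e = (A - b) / z := by field_simp; linarith
  rw [hA1]
  field_simp
  ring

end Curvature

end Penrose

namespace Penrose

variable {n : ℕ}

/-! ### Traces, norms and divergences -/

section Tensors

variable {g k b : Eucl n → Form n} {a : ℝ} {β η γ ζ : ℝ → ℝ} {x : Eucl n}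

theorem trace_eq (hg : HasProfile g a β η) (hp : PosProfile a β η) (hk : HasProfile k a γ ζ)
    (hx : x ∈ exteriorDomain n) :
    trace g k x = (n - 1) * (γ (‖x‖ ^ 2) / β (‖x‖ ^ 2)) +
      (γ (‖x‖ ^ 2) + ζ (‖x‖ ^ 2) * ‖x‖ ^ 2) / (β (‖x‖ ^ 2) + η (‖x‖ ^ 2) * ‖x‖ ^ 2) := by
  rw [trace, ← sum_gInv_mul hg hp hx]
  simp only [hk.comp_eq hx]

theorem sum_gInv_raise (hg : HasProfile g a β η) (hp : PosProfile a β η)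
    (hx : x ∈ exteriorDomain n) (U V : ℝ) (i p : Fin n) :
    ∑ j, gInv g x i j * (U * kd p j + V * (x p * x j)) =
      U / β (‖x‖ ^ 2) * kd p i + (V * β (‖x‖ ^ 2) - η (‖x‖ ^ 2) * U) /
        (β (‖x‖ ^ 2) * (β (‖x‖ ^ 2) + η (‖x‖ ^ 2) * ‖x‖ ^ 2)) * (x p * x i) := by
  have h1 : a < ‖x‖ ^ 2 := hp.lt_one.trans_le (one_le_norm_sq hx)
  have hb := (hp.fst_pos _ h1).ne'
  have hA := (hp.snd_pos _ h1).ne'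
  simp only [gInv_eq hg hp hx]
  generalize β (‖x‖ ^ 2) = b at *
  generalize η (‖x‖ ^ 2) = e at *
  set c := e / (b + e * ‖x‖ ^ 2) with hc
  refine (Finset.sum_congr rfl fun m _ => ?_).trans ((sum_contract x i p p 0
      (-(b⁻¹ * c * V * (x i * x p))) (b⁻¹ * V * x p) (-(b⁻¹ * c * U * x i)) 0 (b⁻¹ * U)
      0 0 0).trans ?_)
  · rw [kd_comm i m, kd_comm p m]
    ring
  · rw [hc, kd_comm i p]
    field_simp
    ring

theorem sum_gInv_coord (hg : HasProfile g a β η) (hp : PosProfile a β η)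
    (hx : x ∈ exteriorDomain n) (i : Fin n) :
    ∑ j, gInv g x i j * x j = x i / (β (‖x‖ ^ 2) + η (‖x‖ ^ 2) * ‖x‖ ^ 2) := by
  have h1 : a < ‖x‖ ^ 2 := hp.lt_one.trans_le (one_le_norm_sq hx)
  have hb := (hp.fst_pos _ h1).ne'
  have hA := (hp.snd_pos _ h1).ne'
  simp only [gInv_eq hg hp hx]
  generalize β (‖x‖ ^ 2) = b at *
  generalize η (‖x‖ ^ 2) = e at *
  set c := e / (b + e * ‖x‖ ^ 2) with hc
  refine (Finset.sum_congr rfl fun m _ => ?_).trans ((sum_contract x i i i 0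
      (-(b⁻¹ * c * x i)) b⁻¹ 0 0 0 0 0 0).trans ?_)
  · rw [kd_comm i m]
    ring
  · rw [hc]
    field_simp
    ring

theorem gInv_symm (hg : HasProfile g a β η) (hp : PosProfile a β η)
    (hx : x ∈ exteriorDomain n) (i j : Fin n) : gInv g x i j = gInv g x j i := by
  rw [gInv_eq hg hp hx, gInv_eq hg hp hx, kd_comm, mul_comm (x i)]

theorem tensorNormSq_eq (hg : HasProfile g a β η) (hp : PosProfile a β η)
    (hk : HasProfile k a γ ζ) (hx : x ∈ exteriorDomain n) :
    tensorNormSq g k x = (n - 1) * (γ (‖x‖ ^ 2) / β (‖x‖ ^ 2)) ^ 2 +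
      ((γ (‖x‖ ^ 2) + ζ (‖x‖ ^ 2) * ‖x‖ ^ 2) /
        (β (‖x‖ ^ 2) + η (‖x‖ ^ 2) * ‖x‖ ^ 2)) ^ 2 := by
  have h1 : a < ‖x‖ ^ 2 := hp.lt_one.trans_le (one_le_norm_sq hx)
  have hb := (hp.fst_pos _ h1).ne'
  have hA := (hp.snd_pos _ h1).ne'
  have h2 := sum_gInv_raise hg hp hx
  simp only [tensorNormSq, hk.comp_eq hx]
  generalize γ (‖x‖ ^ 2) = c at *
  generalize ζ (‖x‖ ^ 2) = d at *
  generalize β (‖x‖ ^ 2) = b at *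
  generalize η (‖x‖ ^ 2) = e at *
  -- (U1, V1) and (U2, V2) are the coefficients of k after one and two indices have been raised.
  obtain ⟨U1, hU1⟩ : ∃ U1, U1 = c / b := ⟨_, rfl⟩
  obtain ⟨V1, hV1⟩ : ∃ V1, V1 = (d * b - e * c) / (b * (b + e * ‖x‖ ^ 2)) := ⟨_, rfl⟩
  obtain ⟨U2, hU2⟩ : ∃ U2, U2 = U1 / b := ⟨_, rfl⟩
  obtain ⟨V2, hV2⟩ : ∃ V2, V2 = (V1 * b - e * U1) / (b * (b + e * ‖x‖ ^ 2)) := ⟨_, rfl⟩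
  have step : ∀ i j, ∑ p, ∑ q, gInv g x i p * gInv g x j q * (c * kd i j + d * (x i * x j)) *
      (c * kd p q + d * (x p * x q)) =
      (c * kd i j + d * (x i * x j)) * (U2 * kd j i + V2 * (x j * x i)) := by
    intro i j
    rw [hU2, hV2, ← h2 U1 V1 i j, Finset.mul_sum]
    refine Finset.sum_congr rfl fun p _ => ?_
    have h3 := h2 c d j p
    rw [← hU1, ← hV1] at h3
    rw [kd_comm j p, mul_comm (x j), ← h3, Finset.mul_sum, Finset.mul_sum]
    refine Finset.sum_congr rfl fun q _ => ?_
    ring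
  rw [Finset.sum_congr rfl fun i _ => Finset.sum_congr rfl fun j _ => step i j]
  have inner : ∀ i, ∑ j, (c * kd i j + d * (x i * x j)) * (U2 * kd j i + V2 * (x j * x i)) =
      c * U2 + (c * V2 + d * U2 + d * V2 * ‖x‖ ^ 2) * (x i * x i) := fun i => by
    refine (Finset.sum_congr rfl fun m _ => ?_).trans ((sum_contract x i i i 0
      (d * V2 * (x i * x i)) ((c * V2 + d * U2) * x i) 0 0 0 0 0 (c * U2)).trans ?_)
    · rw [kd_comm i m]
      linear_combination c * U2 * kd_mul_self m i
    · ring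
  rw [Finset.sum_congr rfl fun i _ => inner i]
  rw [Finset.sum_add_distrib, ← Finset.mul_sum, ← Finset.mul_sum, ← norm_sq_eq_sum,
    Finset.sum_const,
    Finset.card_univ, Fintype.card_fin, nsmul_eq_mul, hU2, hV2, hU1, hV1]
  field_simp
  ring

/-- The divergence of a radial tensor. -/
theorem tensorDiv_eq (hg : HasProfile g a β η) (hp : PosProfile a β η) (hk : HasProfile k a γ ζ)
    (hx : 1 < ‖x‖) (j : Fin n)
    {z b b1 e e1 c c1 d d1 A A1 : ℝ} (hz : z = ‖x‖ ^ 2) (hb : b = β z) (hb1 : b1 = deriv β z)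
    (he : e = η z) (he1 : e1 = deriv η z) (hc : c = γ z) (hc1 : c1 = deriv γ z)
    (hd : d = ζ z) (hd1 : d1 = deriv ζ z) (hA : A = b + e * z)
    (hA1 : A1 = b1 + e + z * e1) :
    tensorDiv g k j x = (2 * ((c1 + d + z * d1) * A - (c + d * z) * A1) / A ^ 2 +
      (n - 1) * (b + z * b1) / (b * z) * ((c + d * z) / A - c / b)) * x j := by
  have h1 : a < z := hz ▸ hp.lt_one.trans_le (one_le_norm_sq hx.le)
  have hb0 : b ≠ 0 := hb ▸ (hp.fst_pos _ h1).ne'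
  have hA0 : A ≠ 0 := by rw [hA, hb, he]; exact (hp.snd_pos _ h1).ne'
  have hz0 : z ≠ 0 := (hp.nonneg.trans h1).ne'
  obtain ⟨P, hP⟩ : ∃ P, P = chrA β z := ⟨_, rfl⟩
  obtain ⟨Q, hQ⟩ : ∃ Q, Q = chrB β η z := ⟨_, rfl⟩
  obtain ⟨S, hS⟩ : ∃ S, S = chrC β η z := ⟨_, rfl⟩
  have inner1 : ∀ i l, ∑ m, christoffel g m l i x * comp k m j x =
      c * christoffel g j l i x + d * x j * (Q * z * kd l i + (2 * P + S * z) * (x l * x i)) := by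
    intro i l
    rw [hP, hQ, hS, hz, ← sum_christoffel_mul hg hp hx, Finset.mul_sum]
    simp only [hk.comp_eq hx.le, ← hz, ← hc, ← hd, mul_add, Finset.sum_add_distrib]
    congr 1
    · simp [kd, mul_comm]
    · exact Finset.sum_congr rfl fun m _ => by ring
  have inner2 : ∀ i l, ∑ m, christoffel g m l j x * comp k i m x =
      c * christoffel g i l j x + d * x i * (Q * z * kd l j + (2 * P + S * z) * (x l * x j)) := by
    intro i l
    rw [hP, hQ, hS, hz, ← sum_christoffel_mul hg hp hx, Finset.mul_sum]
    simp only [hk.comp_eq hx.le, ← hz, ← hc, ← hd, mul_add, Finset.sum_add_distrib]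
    congr 1
    · simp [kd, mul_comm]
    · exact Finset.sum_congr rfl fun m _ => by ring
  -- Coefficients in the covariant derivative: t1 of x i x l x j, t2 of δ_il x j and of δ_lj x i,
  -- and t4 of δ_ij x l.
  obtain ⟨t1, ht1⟩ : ∃ t1, t1 = 2 * d1 - 2 * c * S - 2 * d * (2 * P + S * z) := ⟨_, rfl⟩
  obtain ⟨t2, ht2⟩ : ∃ t2, t2 = d - c * Q - d * Q * z - c * P := ⟨_, rfl⟩
  obtain ⟨t4, ht4⟩ : ∃ t4, t4 = 2 * c1 - 2 * c * P := ⟨_, rfl⟩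
  have term : ∀ i l, pd l (comp k i j) x - ∑ m, (christoffel g m l i x * comp k m j x +
      christoffel g m l j x * comp k i m x) =
      (t2 * x j * kd i l + t1 * x j * (x i * x l)) + (t2 * x i * kd l j + t4 * x l * kd i j) := by
    intro i l
    rw [Finset.sum_add_distrib, inner1, inner2, pd_comp hk hp.lt_one hx, christoffel_eq hg hp hx,
      christoffel_eq hg hp hx, ← hz, ← hP, ← hQ, ← hS, ← hc1, ← hd1, ← hd, ht1, ht2, ht4]
    rw [kd_comm j i, kd_comm j l, kd_comm i l]
    ring
  have s1 : ∑ i, ∑ l, gInv g x i l * (t2 * x i * kd l j) = t2 * (x j / A) := by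
    rw [Finset.sum_comm]
    have : ∀ l, ∑ i, gInv g x i l * (t2 * x i * kd l j) = kd l j * (t2 * (x l / A)) := fun l => by
      rw [hA, hb, he, hz, ← sum_gInv_coord hg hp hx.le, Finset.mul_sum, Finset.mul_sum]
      exact Finset.sum_congr rfl fun i _ => by rw [gInv_symm hg hp hx.le i l]; ring
    rw [Finset.sum_congr rfl fun l _ => this l]
    simp [kd]
  have s2 : ∑ i, ∑ l, gInv g x i l * (t4 * x l * kd i j) = t4 * (x j / A) := by
    have : ∀ i, ∑ l, gInv g x i l * (t4 * x l * kd i j) = kd i j * (t4 * (x i / A)) := fun i => by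
      rw [hA, hb, he, hz, ← sum_gInv_coord hg hp hx.le, Finset.mul_sum, Finset.mul_sum]
      exact Finset.sum_congr rfl fun l _ => by ring
    rw [Finset.sum_congr rfl fun l _ => this l]
    simp [kd]
  simp only [tensorDiv, term]
  simp only [mul_add (gInv _ _ _ _), Finset.sum_add_distrib]
  rw [s1, s2]
  have s3 := sum_gInv_mul hg hp hx.le (t2 * x j) (t1 * x j)
  simp only [mul_add (gInv _ _ _ _), Finset.sum_add_distrib] at s3
  rw [s3, ← hz, ← hb, ← he, ← hA, ht1, ht2, ht4, hP, hQ, hS, chrA, chrB, chrC, ← hb, ← he, ← hb1,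
    ← he1, ← hA]
  obtain rfl : e = (A - b) / z := by field_simp; linarith
  rw [hA1]
  field_simp
  ring

end Tensors

end Penrose

namespace Penrose

variable {n : ℕ}

/-! ### One-sided determination of derivatives -/

/-- The half-space ⟨x, y⟩ ≥ ‖x‖² is convex with nonempty interior, contains x and lies in the
domain. Hence derivatives at boundary points depend only on the values on M, not on the chosen
extension. -/
theorem uniqueDiffWithinAt_exteriorDomain {x : Eucl n} (hx : x ∈ exteriorDomain n) :
    UniqueDiffWithinAt ℝ (exteriorDomain n) x := by
  have hx1 : 1 ≤ ‖x‖ := hx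
  have hx0 : 0 < ‖x‖ := by linarith
  have hlin : IsLinearMap ℝ fun y : Eucl n => inner ℝ x y :=
    ⟨fun y z => inner_add_right _ _ _, fun c y => by rw [inner_smul_right]; rfl⟩
  have hconv : Convex ℝ {y : Eucl n | ‖x‖ ^ 2 ≤ inner ℝ x y} := convex_halfSpace_ge hlin _
  have hsub : {y : Eucl n | ‖x‖ ^ 2 ≤ inner ℝ x y} ⊆ exteriorDomain n := by
    intro y (hy : ‖x‖ ^ 2 ≤ inner ℝ x y)
    have h1 := hy.trans (real_inner_le_norm x y)
    have h2 : ‖x‖ ≤ ‖y‖ := by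
      by_contra! h
      nlinarith
    exact hx1.trans h2
  have hint : (interior {y : Eucl n | ‖x‖ ^ 2 ≤ inner ℝ x y}).Nonempty := by
    refine ⟨(2 : ℝ) • x, interior_mono (s := {y : Eucl n | ‖x‖ ^ 2 < inner ℝ x y})
      (fun y (hy : ‖x‖ ^ 2 < inner ℝ x y) => hy.le) ?_⟩
    rw [IsOpen.interior_eq (isOpen_lt continuous_const (by fun_prop))]
    change ‖x‖ ^ 2 < inner ℝ x ((2 : ℝ) • x)
    rw [inner_smul_right, real_inner_self_eq_norm_sq]
    nlinarith
  refine (uniqueDiffWithinAt_convex hconv hint (subset_closure ?_)).mono hsub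
  exact (real_inner_self_eq_norm_sq x).ge

theorem fderiv_eq_of_eqOn_exteriorDomain {F : Type*} [NormedAddCommGroup F] [NormedSpace ℝ F]
    {f h : Eucl n → F} {x : Eucl n} (hx : x ∈ exteriorDomain n) (hf : DifferentiableAt ℝ f x)
    (hh : DifferentiableAt ℝ h x) (heq : Set.EqOn f h (exteriorDomain n)) :
    fderiv ℝ f x = fderiv ℝ h x := by
  have hu := uniqueDiffWithinAt_exteriorDomain hx
  rw [← hf.fderivWithin hu, ← hh.fderivWithin hu]
  exact fderivWithin_congr heq (heq hx)

/-! ### Differentiability of matrix operations -/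

theorem differentiableAt_det {M : Eucl n → Matrix (Fin n) (Fin n) ℝ} {x : Eucl n}
    (h : ∀ i j, DifferentiableAt ℝ (fun z => M z i j) x) :
    DifferentiableAt ℝ (fun z => (M z).det) x := by
  simp only [Matrix.det_apply]
  refine DifferentiableAt.fun_sum fun σ _ => DifferentiableAt.const_smul ?_ _
  exact (HasFDerivAt.finsetProd fun i _ => (h (σ i) i).hasFDerivAt).differentiableAt

theorem differentiableAt_inv_apply {M : Eucl n → Matrix (Fin n) (Fin n) ℝ} {x : Eucl n}
    (h : ∀ i j, DifferentiableAt ℝ (fun z => M z i j) x) (h0 : (M x).det ≠ 0) (i j : Fin n) :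
    DifferentiableAt ℝ (fun z => (M z)⁻¹ i j) x := by
  simp only [Matrix.inv_def, Matrix.smul_apply, Ring.inverse_eq_inv', smul_eq_mul]
  refine ((differentiableAt_det h).inv h0).mul ?_
  simp only [Matrix.adjugate_apply]
  refine differentiableAt_det fun p q => ?_
  simp only [Matrix.updateRow_apply]
  split_ifs
  · exact differentiableAt_const _
  · exact h p q

theorem SmoothNear.contDiffAt {E F : Type*} [NormedAddCommGroup E] [NormedSpace ℝ E]
    [NormedAddCommGroup F] [NormedSpace ℝ F] {M : Set E} {f : E → F} (h : SmoothNear M f) {x : E}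
    (hx : x ∈ M) : ContDiffAt ℝ ∞ f x := by
  obtain ⟨U, hU, hMU, hf⟩ := h
  exact hf.contDiffAt (hU.mem_nhds (hMU hx))

theorem SmoothNear.differentiableAt_comp {g : Eucl n → Form n}
    (h : SmoothNear (exteriorDomain n) g) {x : Eucl n} (hx : x ∈ exteriorDomain n) (i j : Fin n) :
    DifferentiableAt ℝ (comp g i j) x :=
  (((h.contDiffAt hx).differentiableAt (by simp)).clm_apply (differentiableAt_const _)).clm_apply
    (differentiableAt_const _)

/-! ### The geometry of the centred spheres -/

/-- The density `ds / dz` of arclength with respect to `z = ‖x‖²`. -/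
def arcDensity (β η : ℝ → ℝ) (z : ℝ) : ℝ := √((β z + η z * z) / (4 * z))

/-- The area radius of the sphere `‖x‖² = z`. -/
def radius (β : ℝ → ℝ) (z : ℝ) : ℝ := √(z * β z)

/-- The derivative of the area radius with respect to arclength. -/
def slope (β η : ℝ → ℝ) (z : ℝ) : ℝ := deriv (radius β) z / arcDensity β η z

/-- The tangential eigenvalue of `k`. -/
def tangEig (β γ : ℝ → ℝ) (z : ℝ) : ℝ := γ z / β z

/-- The radial eigenvalue of `k`. -/
def radEig (β η γ ζ : ℝ → ℝ) (z : ℝ) : ℝ := (γ z + ζ z * z) / (β z + η z * z)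

section Spheres

variable {g k : Eucl n → Form n} {a : ℝ} {β η γ ζ : ℝ → ℝ} {x : Eucl n}

theorem PosProfile.arcDensity_pos (hp : PosProfile a β η) {z : ℝ} (hz : a < z) :
    0 < arcDensity β η z :=
  Real.sqrt_pos.2 (div_pos (hp.snd_pos z hz) (by linarith [hp.nonneg]))

theorem PosProfile.arcDensity_sq (hp : PosProfile a β η) {z : ℝ} (hz : a < z) :
    β z + η z * z = 4 * z * arcDensity β η z ^ 2 := by
  have hz0 : 0 < z := hp.nonneg.trans hz
  rw [arcDensity, Real.sq_sqrt (div_pos (hp.snd_pos z hz) (by linarith)).le]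
  field_simp

theorem PosProfile.radius_pos (hp : PosProfile a β η) {z : ℝ} (hz : a < z) :
    0 < radius β z :=
  Real.sqrt_pos.2 (mul_pos (hp.nonneg.trans hz) (hp.fst_pos z hz))

theorem PosProfile.radius_sq (hp : PosProfile a β η) {z : ℝ} (hz : a < z) :
    radius β z ^ 2 = z * β z :=
  Real.sq_sqrt (mul_pos (hp.nonneg.trans hz) (hp.fst_pos z hz)).le

theorem contDiffOn_radius (hg : HasProfile g a β η) (hp : PosProfile a β η) :
    ContDiffOn ℝ ∞ (radius β) (Set.Ioi a) :=
  (contDiffOn_id.mul hg.smooth_fst).sqrt fun z hz =>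
    (mul_pos (hp.nonneg.trans hz) (hp.fst_pos z hz)).ne'

theorem contDiffOn_arcDensity (hg : HasProfile g a β η) (hp : PosProfile a β η) :
    ContDiffOn ℝ ∞ (arcDensity β η) (Set.Ioi a) := by
  have h4 : ∀ z ∈ Set.Ioi a, 4 * z ≠ 0 := fun z hz => by
    have := hp.nonneg.trans hz
    positivity
  exact ((contDiffOn_radial hg).div (contDiffOn_const.mul contDiffOn_id) h4).sqrt fun z hz =>
    div_ne_zero (hp.snd_pos z hz).ne' (h4 z hz)

theorem contDiffOn_slope (hg : HasProfile g a β η) (hp : PosProfile a β η) :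
    ContDiffOn ℝ ∞ (slope β η) (Set.Ioi a) :=
  (contDiffOn_deriv (contDiffOn_radius hg hp)).div (contDiffOn_arcDensity hg hp) fun _ hz =>
    (hp.arcDensity_pos hz).ne'

theorem contDiffOn_tangEig (hg : HasProfile g a β η) (hp : PosProfile a β η)
    (hk : HasProfile k a γ ζ) : ContDiffOn ℝ ∞ (tangEig β γ) (Set.Ioi a) :=
  hk.smooth_fst.div hg.smooth_fst fun z hz => (hp.fst_pos z hz).ne'

theorem contDiffOn_radEig (hg : HasProfile g a β η) (hp : PosProfile a β η)
    (hk : HasProfile k a γ ζ) : ContDiffOn ℝ ∞ (radEig β η γ ζ) (Set.Ioi a) :=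
  (contDiffOn_radial hk).div (contDiffOn_radial hg) fun z hz => (hp.snd_pos z hz).ne'

theorem deriv_radius (hg : HasProfile g a β η) (hp : PosProfile a β η) {z : ℝ} (hz : a < z) :
    deriv (radius β) z = (β z + z * deriv β z) / (2 * radius β z) := by
  have h := (((hasDerivAt_id z).mul (hg.hasDerivAt_fst hz)).sqrt
    (mul_pos (hp.nonneg.trans hz) (hp.fst_pos z hz)).ne').deriv
  simp only [id, one_mul] at h
  exact h

theorem slope_div_radius (hg : HasProfile g a β η) (hp : PosProfile a β η) {z : ℝ} (hz : a < z) :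
    slope β η z / radius β z = (β z + z * deriv β z) / (2 * (z * β z) * arcDensity β η z) := by
  have h1 := (hp.radius_pos hz).ne'
  have h2 := (hp.arcDensity_pos hz).ne'
  rw [slope, deriv_radius hg hp hz, ← hp.radius_sq hz]
  field_simp

theorem covectorNorm_eq (hg : HasProfile g a β η) (hp : PosProfile a β η)
    (hx : x ∈ exteriorDomain n) {ξ : Fin n → ℝ} {d : ℝ} (hξ : ∀ j, ξ j = d * x j) :
    covectorNorm g x ξ = |d| / (2 * arcDensity β η (‖x‖ ^ 2)) := by
  have h1 : a < ‖x‖ ^ 2 := hp.lt_one.trans_le (one_le_norm_sq hx)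
  have hα := hp.arcDensity_pos h1
  have hsum : ∑ i, ∑ j, gInv g x i j * ξ i * ξ j =
      (d / (2 * arcDensity β η (‖x‖ ^ 2))) ^ 2 := by
    have h2 := sum_gInv_mul hg hp hx 0 (d ^ 2)
    have h3 := hp.arcDensity_sq h1
    have hz0 : ‖x‖ ^ 2 ≠ 0 := (hp.nonneg.trans h1).ne'
    rw [h3] at h2
    refine Eq.trans (Finset.sum_congr rfl fun i _ => Finset.sum_congr rfl fun j _ => ?_)
      (h2.trans ?_)
    · rw [hξ, hξ]; ring
    · generalize ‖x‖ ^ 2 = w at *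
      field_simp
      ring
  rw [covectorNorm, hsum, Real.sqrt_sq_eq_abs, abs_div,
    abs_of_pos (by positivity : 0 < 2 * arcDensity β η (‖x‖ ^ 2))]

theorem unitNormal_eq (hg : HasProfile g a β η) (hp : PosProfile a β η)
    (hx : x ∈ exteriorDomain n) (i : Fin n) :
    unitNormal g x i = x i / (2 * ‖x‖ ^ 2 * arcDensity β η (‖x‖ ^ 2)) := by
  have h1 : a < ‖x‖ ^ 2 := hp.lt_one.trans_le (one_le_norm_sq hx)
  have hα := (hp.arcDensity_pos h1).ne'
  have hz0 : ‖x‖ ^ 2 ≠ 0 := (hp.nonneg.trans h1).ne'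
  rw [unitNormal, sum_gInv_coord hg hp hx, covectorNorm_eq hg hp hx (d := 1) (by simp),
    hp.arcDensity_sq h1, abs_one]
  field_simp
  ring

/-- The matrix determinant lemma for identity plus rank one, scaled by β. -/
theorem det_gram_eq (hn : 1 ≤ n) (hg : HasProfile g a β η) (hp : PosProfile a β η)
    (hx : x ∈ exteriorDomain n) :
    (gram g x).det = β (‖x‖ ^ 2) ^ (n - 1) * (β (‖x‖ ^ 2) + η (‖x‖ ^ 2) * ‖x‖ ^ 2) := by
  have h1 : a < ‖x‖ ^ 2 := hp.lt_one.trans_le (one_le_norm_sq hx)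
  have hb := (hp.fst_pos _ h1).ne'
  have hM : gram g x = β (‖x‖ ^ 2) • (1 + Matrix.replicateCol Unit (fun i => η (‖x‖ ^ 2) /
      β (‖x‖ ^ 2) * x i) * Matrix.replicateRow Unit (fun i => x i)) := by
    ext i j
    simp only [gram, Matrix.of_apply, hg.comp_eq hx, Matrix.smul_apply, Matrix.add_apply,
      Matrix.mul_apply, Matrix.replicateCol_apply, Matrix.replicateRow_apply, Matrix.one_apply,
      smul_eq_mul, kd]
    simp only [Finset.univ_unique, Finset.sum_const, Finset.card_singleton, one_smul]
    field_simp
  rw [hM, Matrix.det_smul, Matrix.det_one_add_replicateCol_mul_replicateRow, Fintype.card_fin]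
  have : (fun i => x i) ⬝ᵥ (fun i => η (‖x‖ ^ 2) / β (‖x‖ ^ 2) * x i) =
      η (‖x‖ ^ 2) / β (‖x‖ ^ 2) * ‖x‖ ^ 2 := by
    rw [norm_sq_eq_sum, Finset.mul_sum]
    exact Finset.sum_congr rfl fun i _ => by ring
  rw [this]
  obtain ⟨m, rfl⟩ : ∃ m, n = m + 1 := ⟨n - 1, by omega⟩
  rw [Nat.add_sub_cancel, pow_succ]
  field_simp

theorem volDensity_eq (hn : 1 ≤ n) (hg : HasProfile g a β η) (hp : PosProfile a β η)
    (hx : x ∈ exteriorDomain n) :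
    volDensity g x = 2 * ‖x‖ * arcDensity β η (‖x‖ ^ 2) * √(β (‖x‖ ^ 2) ^ (n - 1)) := by
  have h1 : a < ‖x‖ ^ 2 := hp.lt_one.trans_le (one_le_norm_sq hx)
  have hα := hp.arcDensity_pos h1
  rw [volDensity, det_gram_eq hn hg hp hx, hp.arcDensity_sq h1,
    Real.sqrt_mul (pow_nonneg (hp.fst_pos _ h1).le _), mul_comm,
    show 4 * ‖x‖ ^ 2 * arcDensity β η (‖x‖ ^ 2) ^ 2 = (2 * ‖x‖ * arcDensity β η (‖x‖ ^ 2)) ^ 2 by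
      ring, Real.sqrt_sq (by positivity)]

theorem sphereTrace_eq (hg : HasProfile g a β η) (hp : PosProfile a β η)
    (hk : HasProfile k a γ ζ) (hx : x ∈ exteriorDomain n) :
    sphereTrace g k x = (n - 1) * tangEig β γ (‖x‖ ^ 2) := by
  have h1 : a < ‖x‖ ^ 2 := hp.lt_one.trans_le (one_le_norm_sq hx)
  have hα := (hp.arcDensity_pos h1).ne'
  have hz0 : ‖x‖ ^ 2 ≠ 0 := (hp.nonneg.trans h1).ne'
  have hsum : ∑ i, ∑ j, comp k i j x * unitNormal g x i * unitNormal g x j =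
      (γ (‖x‖ ^ 2) + ζ (‖x‖ ^ 2) * ‖x‖ ^ 2) / (β (‖x‖ ^ 2) + η (‖x‖ ^ 2) * ‖x‖ ^ 2) := by
    simp only [hk.comp_eq hx, unitNormal_eq hg hp hx]
    rw [hp.arcDensity_sq h1]
    generalize γ (‖x‖ ^ 2) = c
    generalize ζ (‖x‖ ^ 2) = d
    generalize arcDensity β η (‖x‖ ^ 2) = α at *
    have inner : ∀ i, ∑ j, (c * kd i j + d * (x i * x j)) * (x i / (2 * ‖x‖ ^ 2 * α)) *
        (x j / (2 * ‖x‖ ^ 2 * α)) =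
        (c + d * ‖x‖ ^ 2) / (2 * ‖x‖ ^ 2 * α) ^ 2 * (x i * x i) := fun i => by
      refine (Finset.sum_congr rfl fun m _ => ?_).trans ((sum_contract x i i i 0
        (d * (x i * x i) / (2 * ‖x‖ ^ 2 * α) ^ 2) (c * x i / (2 * ‖x‖ ^ 2 * α) ^ 2)
        0 0 0 0 0 0).trans ?_)
      · rw [kd_comm i m]
        ring
      · ring
    rw [Finset.sum_congr rfl fun i _ => inner i, ← Finset.mul_sum, ← norm_sq_eq_sum]
    field_simp
    ring
  rw [sphereTrace, hsum, trace_eq hg hp hk hx, tangEig]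
  ring

/-- In the product of volume density and unit normal the arclength density cancels. What remains is
the radial field √(β^(n-1)/z) x, whose divergence is elementary. The boundary is included because
the horizon condition is imposed there. -/
theorem meanCurvature_eq (hn : 2 ≤ n) (hs : SmoothNear (exteriorDomain n) g)
    (hg : HasProfile g a β η) (hp : PosProfile a β η) (hx : x ∈ exteriorDomain n) :
    meanCurvature g x = (n - 1) * (slope β η (‖x‖ ^ 2) / radius β (‖x‖ ^ 2)) := by
  have h1 : a < ‖x‖ ^ 2 := hp.lt_one.trans_le (one_le_norm_sq hx)
  have hα := hp.arcDensity_pos h1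
  have hz0 : 0 < ‖x‖ ^ 2 := hp.nonneg.trans h1
  have hx0 : 0 < ‖x‖ := by have : 1 ≤ ‖x‖ := hx; linarith
  have hb := hp.fst_pos _ h1
  have hdet : 0 < (gram g x).det := by
    rw [det_gram_eq (by omega) hg hp hx]
    exact mul_pos (pow_pos hb _) (hp.snd_pos _ h1)
  have hent : ∀ i j, DifferentiableAt ℝ (fun z => gram g z i j) x :=
    fun i j => hs.differentiableAt_comp hx i j
  have hinv : ∀ i j, DifferentiableAt ℝ (fun z => gInv g z i j) x :=
    fun i j => differentiableAt_inv_apply hent hdet.ne' i j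
  have hcoord : ∀ i, DifferentiableAt ℝ (fun z : Eucl n => z i) x :=
    fun i => (HasPd.coord (l := i) i).1
  have hcn : covectorNorm g x (fun j => x j) = 1 / (2 * arcDensity β η (‖x‖ ^ 2)) := by
    rw [covectorNorm_eq hg hp hx (d := 1) (by simp), abs_one]
  have hcn0 : covectorNorm g x (fun j => x j) ≠ 0 := by
    rw [hcn]
    positivity
  have hd1 : DifferentiableAt ℝ (fun z => covectorNorm g z (fun j => z j)) x := by
    refine DifferentiableAt.sqrt (DifferentiableAt.fun_sum fun i _ =>
      DifferentiableAt.fun_sum fun j _ => ((hinv i j).mul (hcoord i)).mul (hcoord j)) ?_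
    intro h
    exact hcn0 (by rw [covectorNorm, h, Real.sqrt_zero])
  have hd2 : ∀ i, DifferentiableAt ℝ (fun z => volDensity g z * unitNormal g z i) x := fun i =>
    ((differentiableAt_det hent).sqrt hdet.ne').mul
      ((DifferentiableAt.fun_sum fun j _ => (hinv i j).mul (hcoord j)).mul (hd1.inv hcn0))
  have hG : HasDerivAt (fun z => √(β z ^ (n - 1) / z))
      ((((n - 1 : ℕ) * β (‖x‖ ^ 2) ^ (n - 2) * deriv β (‖x‖ ^ 2)) * ‖x‖ ^ 2 -
        β (‖x‖ ^ 2) ^ (n - 1)) / (‖x‖ ^ 2) ^ 2 / (2 * √(β (‖x‖ ^ 2) ^ (n - 1) / ‖x‖ ^ 2)))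
      (‖x‖ ^ 2) := by
    have h2 := (((hg.hasDerivAt_fst h1).pow (n - 1)).div (hasDerivAt_id (‖x‖ ^ 2)) hz0.ne').sqrt
      (div_pos (pow_pos hb (n - 1)) hz0).ne'
    refine HasDerivAt.congr_deriv (f := fun z => √(β z ^ (n - 1) / z)) h2 ?_
    simp only [Pi.pow_apply, id, mul_one, Pi.div_apply, show n - 1 - 1 = n - 2 by omega]
  have hpd : ∀ i, HasPd i (fun z : Eucl n => √(β (‖z‖ ^ 2) ^ (n - 1) / ‖z‖ ^ 2) * z i) _ x :=
    fun i => (HasPd.radial (l := i) hG).mul (HasPd.coord i)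
  -- The radial expression agrees with the original one only on M. At boundary points the equality
  -- of derivatives comes from unique differentiability.
  have hval : ∀ i, pd i (fun z => volDensity g z * unitNormal g z i) x =
      pd i (fun z : Eucl n => √(β (‖z‖ ^ 2) ^ (n - 1) / ‖z‖ ^ 2) * z i) x := fun i => by
    refine congrArg (fun L : Eucl n →L[ℝ] ℝ => L (stdVec i)) ?_
    refine fderiv_eq_of_eqOn_exteriorDomain hx (hd2 i) (hpd i).1 fun z hz => ?_
    have h1 : a < ‖z‖ ^ 2 := hp.lt_one.trans_le (one_le_norm_sq hz)
    have hz1 : 0 < ‖z‖ := by have : 1 ≤ ‖z‖ := hz; linarith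
    have hα := (hp.arcDensity_pos h1).ne'
    simp only
    rw [volDensity_eq (by omega) hg hp hz, unitNormal_eq hg hp hz, Real.sqrt_div (pow_nonneg
      (hp.fst_pos _ h1).le _), Real.sqrt_sq hz1.le]
    field_simp
  rw [meanCurvature, Finset.sum_congr rfl fun i _ => (hval i).trans (hpd i).2, slope_div_radius hg hp h1,
    volDensity_eq (by omega) hg hp hx]
  simp only [kd_self, mul_one, Finset.sum_add_distrib, mul_assoc, ← Finset.mul_sum,
    ← norm_sq_eq_sum, Finset.sum_const, Finset.card_univ, Fintype.card_fin, nsmul_eq_mul]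
  rw [Real.sqrt_div (pow_nonneg hb.le _), Real.sqrt_sq hx0.le]
  have hsq : √(β (‖x‖ ^ 2) ^ (n - 1)) ^ 2 = β (‖x‖ ^ 2) ^ (n - 1) :=
    Real.sq_sqrt (pow_nonneg hb.le _)
  have hsq0 : 0 < √(β (‖x‖ ^ 2) ^ (n - 1)) := Real.sqrt_pos.2 (pow_pos hb _)
  have hcast : ((n - 1 : ℕ) : ℝ) = n - 1 := by rw [Nat.cast_sub (by omega)]; simp
  have hpow : β (‖x‖ ^ 2) ^ (n - 1) = β (‖x‖ ^ 2) ^ (n - 2) * β (‖x‖ ^ 2) := by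
    rw [← pow_succ]
    congr 1
    omega
  have hpow0 : 0 < β (‖x‖ ^ 2) ^ (n - 2) := pow_pos hb _
  rw [hcast]
  generalize √(β (‖x‖ ^ 2) ^ (n - 1)) = s at *
  rw [hpow] at hsq ⊢
  generalize β (‖x‖ ^ 2) ^ (n - 2) = t at *
  generalize β (‖x‖ ^ 2) = b at *
  generalize arcDensity β η (‖x‖ ^ 2) = α at *
  generalize deriv β (‖x‖ ^ 2) = b1 at *
  field_simp
  rw [hsq]
  ring

end Spheres

end Penrose

namespace Penrose

variable {n : ℕ}

/-! ### Constraint quantities in terms of area radius and arclength -/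

section Constraints

variable {g k : Eucl n → Form n} {a : ℝ} {β η γ ζ : ℝ → ℝ} {x : Eucl n}

/-- The scalar curvature in terms of the area radius and arclength derivatives. -/
theorem scalarCurvature_eq_radius (hg : HasProfile g a β η) (hp : PosProfile a β η)
    (hx : 1 < ‖x‖) {z : ℝ} (hz : z = ‖x‖ ^ 2) :
    scalarCurvature g x =
      (n - 1) * (n - 2) * (1 - slope β η z ^ 2) / radius β z ^ 2 -
        2 * (n - 1) * (deriv (slope β η) z / (arcDensity β η z * radius β z)) := by
  have h1 : a < z := hz ▸ hp.lt_one.trans_le (one_le_norm_sq hx.le)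
  have hz0 : 0 < z := hp.nonneg.trans h1
  have hα := hp.arcDensity_pos h1
  have hρ := hp.radius_pos h1
  rw [scalarCurvature_eq hg hp hx hz rfl rfl rfl rfl rfl rfl rfl]
  have dβ := hg.hasDerivAt_fst h1
  have dβ1 := hasDerivAt_of_contDiffOn (contDiffOn_deriv hg.smooth_fst) h1
  have dη := hg.hasDerivAt_snd h1
  have dα := hasDerivAt_of_contDiffOn (contDiffOn_arcDensity hg hp) h1
  have dρ := hasDerivAt_of_contDiffOn (contDiffOn_radius hg hp) h1
  have eA := hp.arcDensity_sq h1
  -- The derivative of β + ηz, found by differentiating the relation β + ηz = 4zα².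
  have eA1 : deriv β z + η z + z * deriv η z =
      4 * arcDensity β η z ^ 2 + 8 * z * arcDensity β η z * deriv (arcDensity β η) z := by
    have h2 := dβ.add (dη.mul (hasDerivAt_id z))
    have h3 := ((hasDerivAt_id z).const_mul 4).mul (dα.pow 2)
    have h4 : (fun y => β y + η y * y) =ᶠ[nhds z] fun y => 4 * y * arcDensity β η y ^ 2 := by
      filter_upwards [Ioi_mem_nhds h1] with y hy using hp.arcDensity_sq hy
    have h5 := h2.unique (h3.congr_of_eventuallyEq h4)
    simp only [id, Pi.pow_apply, Nat.cast_ofNat, mul_one] at h5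
    linear_combination h5
  have hslope : slope β η =ᶠ[nhds z]
      fun y => (β y + y * deriv β y) / (2 * radius β y) / arcDensity β η y := by
    filter_upwards [Ioi_mem_nhds h1] with y hy
    rw [slope, deriv_radius hg hp hy]
  have dv := (((dβ.add ((hasDerivAt_id z).mul dβ1)).div (dρ.const_mul 2)
    (by positivity)).div dα hα.ne').congr_of_eventuallyEq hslope
  rw [dv.deriv, hslope.eq_of_nhds]
  simp only [Pi.add_apply, Pi.mul_apply, Pi.div_apply, id, one_mul]
  rw [deriv_radius hg hp h1, eA1, eA]
  have eb : β z = radius β z ^ 2 / z := by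
    rw [hp.radius_sq h1]
    field_simp
  have ee : η z = (4 * z * arcDensity β η z ^ 2 - β z) / z := by
    rw [← eA]
    field_simp
    ring
  rw [ee, eb]
  generalize radius β z = ρ at *
  generalize arcDensity β η z = α at *
  generalize deriv (arcDensity β η) z = α1 at *
  generalize deriv β z = b1 at *
  generalize deriv (deriv β) z = b2 at *
  field_simp
  ring

/-- The tensor k - (tr k)g again has radial profiles, so `tensorDiv_eq` applies to it. Its radial
eigenvalue is -(n-1)q, which is why no derivative of p survives. -/
theorem momentum_eq (hg : HasProfile g a β η) (hp : PosProfile a β η) (hk : HasProfile k a γ ζ)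
    (hx : 1 < ‖x‖) {z : ℝ} (hz : z = ‖x‖ ^ 2) (j : Fin n) :
    tensorDiv g (fun y => k y - trace g k y • g y) j x =
      2 * (n - 1) * (arcDensity β η z * (slope β η z / radius β z) *
        (radEig β η γ ζ z - tangEig β γ z) - deriv (tangEig β γ) z) * x j := by
  have h1 : a < z := hz ▸ hp.lt_one.trans_le (one_le_norm_sq hx.le)
  have hz0 : 0 < z := hp.nonneg.trans h1
  have hb := (hp.fst_pos _ h1).ne'
  have hA := (hp.snd_pos _ h1).ne'
  set τ : ℝ → ℝ := fun y => (n - 1) * tangEig β γ y + radEig β η γ ζ y with hτ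
  have hτs : ContDiffOn ℝ ∞ τ (Set.Ioi a) :=
    (contDiffOn_const.mul (contDiffOn_tangEig hg hp hk)).add (contDiffOn_radEig hg hp hk)
  have hprof : HasProfile (fun y => k y - trace g k y • g y) a (fun y => γ y - τ y * β y)
      (fun y => ζ y - τ y * η y) := by
    refine ⟨fun y hy u v => ?_, hk.smooth_fst.sub (hτs.mul hg.smooth_fst),
      hk.smooth_snd.sub (hτs.mul hg.smooth_snd)⟩
    have htr : trace g k y = τ (‖y‖ ^ 2) := trace_eq hg hp hk hy
    simp only [sub_apply, smul_apply, smul_eq_mul,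
      hk.apply_eq y hy, hg.apply_eq y hy, htr]
    ring
  have dγ := hk.hasDerivAt_fst h1
  have dζ := hk.hasDerivAt_snd h1
  have dβ := hg.hasDerivAt_fst h1
  have dη := hg.hasDerivAt_snd h1
  have dq := hasDerivAt_of_contDiffOn (contDiffOn_tangEig hg hp hk) h1
  have dp : HasDerivAt (radEig β η γ ζ) _ z :=
    (dγ.add (dζ.mul (hasDerivAt_id z))).div (dβ.add (dη.mul (hasDerivAt_id z))) hA
  have dτ : HasDerivAt τ _ z := (dq.const_mul ((n : ℝ) - 1)).add dp
  rw [tensorDiv_eq hg hp hprof hx j hz rfl rfl rfl rfl rfl (dγ.sub (dτ.mul dβ)).deriv.symm rfl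
    (dζ.sub (dτ.mul dη)).deriv.symm rfl rfl, slope_div_radius hg hp h1]
  have hα := hp.arcDensity_pos h1
  simp only [Pi.add_apply, Pi.mul_apply, id, hτ, tangEig, radEig]
  generalize arcDensity β η z = α at *
  generalize deriv (tangEig β γ) z = q1 at *
  generalize β z = b at *
  generalize γ z = c at *
  generalize ζ z = d at *
  generalize deriv β z = b1 at *
  generalize deriv η z = e1 at *
  generalize deriv γ z = c1 at *
  generalize deriv ζ z = d1 at *
  generalize hAA : b + η z * z = A at *
  have ee : η z = (A - b) / z := by
    rw [← hAA]
    field_simp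
    ring
  rw [ee]
  generalize hdd : c + d * z = P at *
  have ed : d = (P - c) / z := by
    rw [← hdd]
    field_simp
    ring
  rw [ed]
  field_simp
  ring

/-- The momentum covector is a multiple of x, so its norm is an absolute value. The condition is
evaluated at one point of each sphere and multiplied by 16π. -/
theorem InitialData.DominantEnergyCondition.profile {D : InitialData n}
    (hD : D.DominantEnergyCondition) (hn : 3 ≤ n) (hg : HasProfile D.g a β η)
    (hp : PosProfile a β η) (hk : HasProfile D.k a γ ζ) {z : ℝ} (hz : 1 < z) :
    |2 * (n - 1) * (slope β η z / radius β z * (radEig β η γ ζ z - tangEig β γ z) -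
        deriv (tangEig β γ) z / arcDensity β η z)| ≤
      (n - 1) * (n - 2) * (1 - slope β η z ^ 2) / radius β z ^ 2 -
        2 * (n - 1) * (deriv (slope β η) z / (arcDensity β η z * radius β z)) +
        2 * (n - 1) * (radEig β η γ ζ z * tangEig β γ z) +
        (n - 1) * (n - 2) * tangEig β γ z ^ 2 := by
  have hz0 : 0 ≤ z := by linarith
  set x : Eucl n := √z • stdVec ⟨0, by omega⟩ with hxdef
  have hxn : ‖x‖ = √z := by
    rw [hxdef, norm_smul, Real.norm_of_nonneg (Real.sqrt_nonneg z)]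
    simp [stdVec]
  have hx : 1 < ‖x‖ := by rw [hxn]; exact Real.lt_sqrt_of_sq_lt (by simpa using hz)
  have hxz : z = ‖x‖ ^ 2 := by rw [hxn, Real.sq_sqrt hz0]
  have h1 : a < z := hp.lt_one.trans hz
  have hα := hp.arcDensity_pos h1
  have h := hD x hx.le
  rw [covectorNorm_eq hg hp hx.le (d := 2 * (n - 1) * (arcDensity β η z *
      (slope β η z / radius β z) * (radEig β η γ ζ z - tangEig β γ z) -
      deriv (tangEig β γ) z) / (8 * Real.pi)) (fun j => by
        rw [InitialData.momentumDensity, momentum_eq hg hp hk hx hxz]; ring),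
    InitialData.energyDensity, scalarCurvature_eq_radius hg hp hx hxz, trace_eq hg hp hk hx.le,
    tensorNormSq_eq hg hp hk hx.le, ← hxz] at h
  change _ ≤ (_ + ((n - 1) * tangEig β γ z + radEig β η γ ζ z) ^ 2 -
    ((n - 1) * tangEig β γ z ^ 2 + radEig β η γ ζ z ^ 2)) / _ at h
  have hπ := Real.pi_pos
  rw [abs_div, abs_of_pos (by positivity : 0 < 8 * Real.pi), div_div,
    div_le_div_iff₀ (by positivity) (by positivity)] at h
  have e1 : 2 * (n - 1) * (slope β η z / radius β z * (radEig β η γ ζ z - tangEig β γ z) -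
        deriv (tangEig β γ) z / arcDensity β η z) = (2 * (n - 1) * (arcDensity β η z *
      (slope β η z / radius β z) * (radEig β η γ ζ z - tangEig β γ z) -
      deriv (tangEig β γ) z)) / arcDensity β η z := by
    field_simp
  rw [e1, abs_div, abs_of_pos hα, div_le_iff₀ hα]
  have h16 : 0 < 16 * Real.pi := by positivity
  refine le_of_mul_le_mul_right (h.trans (le_of_eq ?_)) h16
  ring

/-! ### Areas and Hawking masses -/

theorem unitSphereArea_pos (hn : 1 ≤ n) : 0 < unitSphereArea n := by
  rw [unitSphereArea, MeasureTheory.Measure.toSphere_real_apply_univ, finrank_euclideanSpace,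
    Fintype.card_fin]
  have : 0 < (MeasureTheory.volume : MeasureTheory.Measure (Eucl n)).real (Metric.ball 0 1) :=
    ENNReal.toReal_pos (Metric.measure_ball_pos _ _ one_pos).ne' MeasureTheory.measure_ball_lt_top.ne
  have hn' : (0 : ℝ) < n := by exact_mod_cast hn
  positivity

/-- The area element relative to the unit sphere is the constant ρ^(n-1): the arclength density in
the volume density cancels against the norm of the conormal. -/
theorem sphereIntegral_eq (hn : 1 ≤ n) (hg : HasProfile g a β η) (hp : PosProfile a β η) {r : ℝ}
    (hr : 1 ≤ r) {F : Eucl n → ℝ} {c : ℝ} (hF : ∀ x, ‖x‖ = r → F x = c) :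
    sphereIntegral g r F = c * radius β (r ^ 2) ^ (n - 1) * unitSphereArea n := by
  have hr0 : 0 < r := by linarith
  have hpow : ∀ b : ℝ, 0 ≤ b → √(b ^ (n - 1)) = √b ^ (n - 1) := fun b hb => by
    rw [← Real.sqrt_sq (pow_nonneg (Real.sqrt_nonneg b) (n - 1)), ← pow_mul, mul_comm, pow_mul,
      Real.sq_sqrt hb]
  have hint : ∀ θ : Metric.sphere (0 : Eucl n) 1, F (r • (θ : Eucl n)) *
      (r ^ (n - 1) * (volDensity g (r • (θ : Eucl n)) *
        covectorNorm g (r • (θ : Eucl n)) (fun j => (θ : Eucl n) j))) =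
      c * radius β (r ^ 2) ^ (n - 1) := by
    intro θ
    have hθ : ‖r • (θ : Eucl n)‖ = r := by
      rw [norm_smul, Real.norm_of_nonneg hr0.le, norm_eq_of_mem_sphere, mul_one]
    have hx : r • (θ : Eucl n) ∈ exteriorDomain n := by
      change 1 ≤ ‖r • (θ : Eucl n)‖
      rwa [hθ]
    have h1 : a < r ^ 2 := by
      have := one_le_norm_sq hx
      rw [hθ] at this
      exact hp.lt_one.trans_le this
    have hα := (hp.arcDensity_pos h1).ne'
    have hb := hp.fst_pos _ h1
    rw [hF _ hθ, volDensity_eq hn hg hp hx, covectorNorm_eq hg hp hx (d := r⁻¹) (fun j => by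
      rw [PiLp.smul_apply, smul_eq_mul, inv_mul_cancel_left₀ hr0.ne']), hθ,
      abs_of_pos (inv_pos.2 hr0), radius, Real.sqrt_mul (sq_nonneg r), Real.sqrt_sq hr0.le, mul_pow,
      hpow _ hb.le]
    field_simp
  rw [sphereIntegral]
  simp only [hint]
  rw [MeasureTheory.integral_const, smul_eq_mul, unitSphereArea]
  ring

theorem sphereArea_eq (hn : 1 ≤ n) (hg : HasProfile g a β η) (hp : PosProfile a β η) {r : ℝ}
    (hr : 1 ≤ r) : sphereArea g r = radius β (r ^ 2) ^ (n - 1) * unitSphereArea n := by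
  rw [sphereArea, sphereIntegral_eq hn hg hp hr (c := 1) (fun _ _ => rfl), one_mul]

theorem areaRatio_rpow (hn : 3 ≤ n) (hg : HasProfile g a β η) (hp : PosProfile a β η) {r : ℝ}
    (hr : 1 ≤ r) : (sphereArea g r / unitSphereArea n) ^ (((n : ℝ) - 2) / ((n : ℝ) - 1)) =
      radius β (r ^ 2) ^ (n - 2) := by
  have h1 : a < r ^ 2 := hp.lt_one.trans_le (one_le_pow₀ hr)
  have hρ := hp.radius_pos h1
  have hω := unitSphereArea_pos (n := n) (by omega)
  have hn' : (3 : ℝ) ≤ n := by exact_mod_cast hn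
  rw [sphereArea_eq (by omega) hg hp hr, mul_div_cancel_right₀ _ hω.ne']
  generalize radius β (r ^ 2) = ρ at *
  rw [← Real.rpow_natCast,
    ← Real.rpow_natCast, ← Real.rpow_mul hρ.le, Nat.cast_sub (by omega), Nat.cast_sub (by omega)]
  congr 1
  push_cast
  have : (n : ℝ) - 1 ≠ 0 := by linarith
  field_simp

theorem halfAreaRadius_eq {D : InitialData n} (hn : 3 ≤ n) (hg : HasProfile D.g a β η)
    (hp : PosProfile a β η) : D.halfAreaRadius = 1 / 2 * radius β 1 ^ (n - 2) := by
  rw [InitialData.halfAreaRadius, areaRatio_rpow hn hg hp le_rfl, one_pow]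

theorem hawkingMass_eq (hn : 3 ≤ n) (hs : SmoothNear (exteriorDomain n) g)
    (hg : HasProfile g a β η) (hp : PosProfile a β η) {r : ℝ} (hr : 1 ≤ r) :
    hawkingMass g r = 1 / 2 * radius β (r ^ 2) ^ (n - 2) * (1 - slope β η (r ^ 2) ^ 2) := by
  have h1 : a < r ^ 2 := hp.lt_one.trans_le (one_le_pow₀ hr)
  have hρ := hp.radius_pos h1
  have hω := unitSphereArea_pos (n := n) (by omega)
  have hn' : (3 : ℝ) ≤ n := by exact_mod_cast hn
  have hn1 : (n : ℝ) - 1 ≠ 0 := by linarith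
  have hint := sphereIntegral_eq (by omega) hg hp hr (F := fun x => meanCurvature g x ^ 2)
    (c := ((n - 1) * (slope β η (r ^ 2) / radius β (r ^ 2))) ^ 2) (fun x hx => by
      have hx' : x ∈ exteriorDomain n := by
        change 1 ≤ ‖x‖
        rwa [hx]
      rw [meanCurvature_eq (by omega) hs hg hp hx', hx])
  have hroot : (unitSphereArea n ^ 2 * sphereArea g r ^ (n - 3)) ^ (1 / ((n : ℝ) - 1)) =
      unitSphereArea n * radius β (r ^ 2) ^ (n - 3) := by
    rw [sphereArea_eq (by omega) hg hp hr]
    -- The powers of ω add up to 2 + (n-3) = n-1, so the base is a perfect (n-1)-st power. With H =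
    -- (n-1)v/ρ the bracket in the Hawking mass becomes 1 - v².
    have : unitSphereArea n ^ 2 * (radius β (r ^ 2) ^ (n - 1) * unitSphereArea n) ^ (n - 3) =
        (unitSphereArea n * radius β (r ^ 2) ^ (n - 3)) ^ (n - 1) := by
      obtain ⟨m, rfl⟩ : ∃ m, n = m + 3 := ⟨n - 3, by omega⟩
      simp only [show m + 3 - 3 = m by omega, show m + 3 - 1 = m + 2 by omega]
      ring
    rw [this, ← Real.rpow_natCast, ← Real.rpow_mul (by positivity), Nat.cast_sub (by omega),
      Nat.cast_one, mul_one_div_cancel hn1, Real.rpow_one]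
  rw [hawkingMass, areaRatio_rpow hn hg hp hr, hroot, hint]
  have hpow : radius β (r ^ 2) ^ (n - 1) = radius β (r ^ 2) ^ (n - 3) * radius β (r ^ 2) ^ 2 := by
    rw [← pow_add]
    congr 1
    omega
  rw [hpow]
  congr 2
  field_simp

end Constraints

end Penrose

namespace Penrose

/-! ### The reduced system

With `n = m + 3`, the functions `α`, `ρ`, `v`, `p`, `q` of one variable are the density of
arclength, the area radius, its arclength derivative, and the radial and tangential eigenvalues
of `k`. -/

/-- `16 π` times the radial component of the momentum density. -/
def radMomentum (m : ℕ) (α ρ v p q : ℝ → ℝ) (z : ℝ) : ℝ :=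
  2 * (m + 2) * (v z / ρ z * (p z - q z) - deriv q z / α z)

/-- The scalar curvature. -/
def radScalar (m : ℕ) (α ρ v : ℝ → ℝ) (z : ℝ) : ℝ :=
  (m + 2) * (m + 1) * (1 - v z ^ 2) / ρ z ^ 2 - 2 * (m + 2) * (deriv v z / (α z * ρ z))

/-- `16 π` times the energy density. -/
def radEnergy (m : ℕ) (α ρ v p q : ℝ → ℝ) (z : ℝ) : ℝ :=
  radScalar m α ρ v z + 2 * (m + 2) * (p z * q z) + (m + 2) * (m + 1) * q z ^ 2

/-- The Hawking mass. -/
def radHawking (m : ℕ) (ρ v : ℝ → ℝ) (z : ℝ) : ℝ := 1 / 2 * ρ z ^ (m + 1) * (1 - v z ^ 2)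

/-- The Misner–Sharp mass. -/
def misnerSharp (m : ℕ) (ρ v q : ℝ → ℝ) (z : ℝ) : ℝ :=
  1 / 2 * ρ z ^ (m + 1) * (1 - v z ^ 2 + ρ z ^ 2 * q z ^ 2)

/-- Spherically symmetric data satisfying the dominant energy condition, whose boundary is an
outermost apparent horizon. -/
structure RadialData (m : ℕ) (a : ℝ) (α ρ v p q : ℝ → ℝ) : Prop where
  lt_one : a < 1
  smooth_α : ContDiffOn ℝ ∞ α (Set.Ioi a)
  smooth_ρ : ContDiffOn ℝ ∞ ρ (Set.Ioi a)
  smooth_v : ContDiffOn ℝ ∞ v (Set.Ioi a)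
  smooth_p : ContDiffOn ℝ ∞ p (Set.Ioi a)
  smooth_q : ContDiffOn ℝ ∞ q (Set.Ioi a)
  α_pos : ∀ z, a < z → 0 < α z
  ρ_pos : ∀ z, a < z → 0 < ρ z
  deriv_ρ : ∀ z, a < z → deriv ρ z = α z * v z
  untrapped : ∀ z, 1 < z → ρ z * |q z| < v z
  energy : ∀ z, 1 < z → |radMomentum m α ρ v p q z| ≤ radEnergy m α ρ v p q z
  horizon : v 1 ^ 2 = (ρ 1 * q 1) ^ 2

theorem exists_tendsto_of_monotoneOn {f : ℝ → ℝ} {b B : ℝ} (hf : MonotoneOn f (Set.Ici b))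
    (hB : ∀ z, b ≤ z → f z ≤ B) : ∃ l, Filter.Tendsto f Filter.atTop (nhds l) := by
  have hmono : Monotone fun z => f (max z b) := fun x y hxy =>
    hf (Set.mem_Ici.2 (le_max_right _ _)) (Set.mem_Ici.2 (le_max_right _ _))
      (max_le_max_right b hxy)
  refine ⟨_, (tendsto_atTop_ciSup hmono ⟨B, ?_⟩).congr' ?_⟩
  · rintro _ ⟨z, rfl⟩
    exact hB _ (le_max_right _ _)
  · filter_upwards [Filter.eventually_ge_atTop b] with z hz
    rw [max_eq_left hz]

theorem monotoneOn_Ici_of_hasDerivAt {f f' : ℝ → ℝ} {b : ℝ} (hc : ContinuousOn f (Set.Ici b))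
    (hd : ∀ z, b < z → HasDerivAt f (f' z) z) (h0 : ∀ z, b < z → 0 ≤ f' z) :
    MonotoneOn f (Set.Ici b) := by
  refine monotoneOn_of_deriv_nonneg (convex_Ici b) hc ?_ ?_
  · rw [interior_Ici]
    exact fun z hz => (hd z hz).differentiableAt.differentiableWithinAt
  · rw [interior_Ici]
    intro z hz
    rw [(hd z hz).deriv]
    exact h0 z hz

/-! ### Monotonicity of the Misner–Sharp mass -/

namespace RadialData

variable {m : ℕ} {a : ℝ} {α ρ v p q : ℝ → ℝ}

section

variable (h : RadialData m a α ρ v p q)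
include h

theorem hasDerivAt_ρ {z : ℝ} (hz : a < z) : HasDerivAt ρ (α z * v z) z :=
  h.deriv_ρ z hz ▸ hasDerivAt_of_contDiffOn h.smooth_ρ hz

/-- Only the scalar curvature enters, so the assumed decay of R controls convergence even though the
Hawking mass need not be monotone. -/
theorem hasDerivAt_radHawking {z : ℝ} (hz : a < z) :
    HasDerivAt (radHawking m ρ v)
      (α z * ρ z ^ (m + 2) * (v z * radScalar m α ρ v z) / (2 * (m + 2))) z := by
  have hα := (h.α_pos z hz).ne'
  have hρ := (h.ρ_pos z hz).ne'
  have dv := hasDerivAt_of_contDiffOn h.smooth_v hz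
  refine ((((h.hasDerivAt_ρ hz).pow (m + 1)).const_mul (1 / 2)).mul
    ((dv.pow 2).const_sub 1)).congr_deriv ?_
  have hm : (m : ℝ) + 2 ≠ 0 := by positivity
  simp only [Pi.pow_apply, radScalar, add_tsub_cancel_right]
  push_cast
  field_simp
  ring

/-- The central identity. The extra term ρ²q² turns the scalar curvature into the energy density
minus the momentum flux: the terms containing p cancel, and dq/ds enters only through the momentum
constraint. -/
theorem hasDerivAt_misnerSharp {z : ℝ} (hz : a < z) :
    HasDerivAt (misnerSharp m ρ v q)
      (α z * ρ z ^ (m + 2) * (v z * radEnergy m α ρ v p q z -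
        ρ z * q z * radMomentum m α ρ v p q z) / (2 * (m + 2))) z := by
  have hα := (h.α_pos z hz).ne'
  have hρ := (h.ρ_pos z hz).ne'
  have dv := hasDerivAt_of_contDiffOn h.smooth_v hz
  have dq := hasDerivAt_of_contDiffOn h.smooth_q hz
  refine ((((h.hasDerivAt_ρ hz).pow (m + 1)).const_mul (1 / 2)).mul
    (((dv.pow 2).const_sub 1).add (((h.hasDerivAt_ρ hz).pow 2).mul (dq.pow 2)))).congr_deriv ?_
  have hm : (m : ℝ) + 2 ≠ 0 := by positivity
  simp only [Pi.pow_apply, Pi.add_apply, Pi.mul_apply, radScalar, radEnergy, radMomentum,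
    add_tsub_cancel_right]
  push_cast
  field_simp
  ring

/-- Multiply ρ|q| < v by |J| ≤ μ: being untrapped is exactly what lets the dominant energy condition
absorb the momentum term. -/
theorem energy_flux_nonneg {z : ℝ} (hz : 1 < z) :
    0 ≤ v z * radEnergy m α ρ v p q z - ρ z * q z * radMomentum m α ρ v p q z := by
  have h1 := h.untrapped z hz
  have h2 := h.energy z hz
  have h3 : ρ z * q z * radMomentum m α ρ v p q z ≤
      ρ z * |q z| * |radMomentum m α ρ v p q z| := by
    have hρ := h.ρ_pos z (h.lt_one.trans hz)
    rw [← abs_of_pos hρ, ← abs_mul, ← abs_mul, abs_of_pos hρ]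
    exact le_abs_self _
  have h4 := abs_nonneg (radMomentum m α ρ v p q z)
  have h5 := h.ρ_pos z (h.lt_one.trans hz)
  nlinarith [abs_nonneg (q z), mul_le_mul h1.le h2 h4 (h1.le.trans' (by positivity))]

theorem continuousOn_misnerSharp : ContinuousOn (misnerSharp m ρ v q) (Set.Ici 1) :=
  fun _ hz => (h.hasDerivAt_misnerSharp (h.lt_one.trans_le hz)).continuousAt.continuousWithinAt

theorem monotoneOn_misnerSharp : MonotoneOn (misnerSharp m ρ v q) (Set.Ici 1) := by
  refine monotoneOn_Ici_of_hasDerivAt h.continuousOn_misnerSharp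
    (fun z hz => h.hasDerivAt_misnerSharp (h.lt_one.trans hz)) fun z hz => ?_
  have h1 := h.energy_flux_nonneg hz
  have h2 := h.α_pos z (h.lt_one.trans hz)
  have h3 := h.ρ_pos z (h.lt_one.trans hz)
  positivity

theorem misnerSharp_one : misnerSharp m ρ v q 1 = 1 / 2 * ρ 1 ^ (m + 1) := by
  rw [misnerSharp, h.horizon]
  ring

theorem v_pos {z : ℝ} (hz : 1 < z) : 0 < v z :=
  lt_of_le_of_lt (mul_nonneg (h.ρ_pos z (h.lt_one.trans hz)).le (abs_nonneg _)) (h.untrapped z hz)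

/-- The mass starts positive on the horizon and does not decrease, hence v² < 1 + ρ²q². This a
priori bound replaces any use of the asymptotics of dρ/ds. -/
theorem v_le {z : ℝ} (hz : 1 < z) : v z ≤ 1 + ρ z * |q z| := by
  have h0 := h.ρ_pos z (h.lt_one.trans hz)
  have h1 := h.monotoneOn_misnerSharp (Set.mem_Ici.2 le_rfl) hz.le hz.le
  rw [h.misnerSharp_one] at h1
  have h2 : 0 < 1 / 2 * ρ 1 ^ (m + 1) := by
    have := h.ρ_pos 1 h.lt_one
    positivity
  have h3 : 0 < 1 - v z ^ 2 + ρ z ^ 2 * q z ^ 2 :=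
    pos_of_mul_pos_right (h2.trans_le h1) (by positivity)
  have h4 : v z ^ 2 ≤ (1 + ρ z * |q z|) ^ 2 := by
    have : (ρ z * |q z|) ^ 2 = ρ z ^ 2 * q z ^ 2 := by rw [mul_pow, sq_abs]
    have h5 : 0 ≤ ρ z * |q z| := by positivity
    nlinarith
  exact le_of_sq_le_sq h4 (by positivity)

end

/-- The fall-off of the data: `T` is a large radius in asymptotically flat coordinates and `τ` is
arclength. -/
structure FallOff (m : ℕ) (α ρ v q τ T : ℝ → ℝ) (b C L : ℝ) : Prop where
  one_le : 1 ≤ b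
  C_nonneg : 0 ≤ C
  L_pos : 0 < L
  tendsto : Filter.Tendsto T Filter.atTop Filter.atTop
  hasDerivAt : ∀ z, 1 < z → HasDerivAt τ (α z) z
  one_le_τ : ∀ z, 1 < z → 1 ≤ τ z
  τ_le : ∀ z, b < z → τ z ≤ L * T z
  q_le : ∀ z, b < z → |q z| ≤ C / T z ^ (m + 2)
  scalar_le : ∀ z, b < z → |radScalar m α ρ v z| ≤ C / T z ^ (m + 4)

/-! ### Convergence of the masses at infinity -/

theorem div_pow_le_of_le_mul {C L τ T : ℝ} (hC : 0 ≤ C) (hL : 0 < L) (hτ : 0 < τ)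
    (h : τ ≤ L * T) (k : ℕ) : C / T ^ k ≤ C * L ^ k / τ ^ k := by
  have hT : 0 < T := pos_of_mul_pos_right (hτ.trans_le h) hL.le
  rw [div_le_div_iff₀ (by positivity) (by positivity), mul_assoc, ← mul_pow]
  gcongr

/-- The area radius grows at most linearly in arclength. -/
theorem exists_ρ_le {τ T : ℝ → ℝ} {b C L : ℝ} (h : RadialData m a α ρ v p q)
    (hf : FallOff m α ρ v q τ T b C L) :
    ∃ K, 0 < K ∧ ∀ z, b + 1 ≤ z → ρ z ≤ K * τ z := by
  have hb := hf.one_le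
  set B := C * L ^ (m + 2) with hB
  have hB0 : 0 ≤ B := mul_nonneg hf.C_nonneg (pow_nonneg hf.L_pos.le _)
  have hq : ∀ z, b < z → |q z| ≤ B / τ z ^ 2 := fun z hz => by
    have h1 := hf.one_le_τ z (hb.trans_lt hz)
    have h2 := (hf.q_le z hz).trans
      (div_pow_le_of_le_mul hf.C_nonneg hf.L_pos (by linarith) (hf.τ_le z hz) (m + 2))
    refine h2.trans ?_
    gcongr
    omega
  -- Grönwall argument: dρ/dτ ≤ 1 + Bρ/τ² has integrating factor exp(B/τ), which lies between 1 and
  -- exp B because τ ≥ 1. Hence G is increasing.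
  set G : ℝ → ℝ := fun z => Real.exp B * τ z - ρ z * Real.exp (B / τ z) with hG
  have hd : ∀ z, b < z → HasDerivAt G (Real.exp B * α z - (α z * v z * Real.exp (B / τ z) +
      ρ z * (Real.exp (B / τ z) * (-(B * α z) / τ z ^ 2)))) z := fun z hz => by
    have hz1 := hb.trans_lt hz
    have h1 := hf.one_le_τ z hz1
    have dτ := hf.hasDerivAt z hz1
    have d1 := ((hasDerivAt_const z B).div dτ (by linarith)).exp
    have d2 := (dτ.const_mul (Real.exp B)).sub ((h.hasDerivAt_ρ (h.lt_one.trans hz1)).mul d1)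
    refine d2.congr_deriv ?_
    simp
  have hmono : MonotoneOn G (Set.Ici (b + 1)) := by
    refine monotoneOn_Ici_of_hasDerivAt (fun z hz => (hd z (by
      have : b + 1 ≤ z := hz
      linarith)).continuousAt.continuousWithinAt)
      (fun z hz => hd z (by linarith)) fun z hz => ?_
    have hbz : b < z := by linarith
    have hz1 := hb.trans_lt hbz
    have h1 := hf.one_le_τ z hz1
    have hα := h.α_pos z (h.lt_one.trans hz1)
    have hρ := h.ρ_pos z (h.lt_one.trans hz1)
    have h2 : v z ≤ 1 + ρ z * (B / τ z ^ 2) :=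
      (h.v_le hz1).trans (by gcongr; exact hq z hbz)
    have h3 : Real.exp (B / τ z) ≤ Real.exp B := Real.exp_le_exp.2 (div_le_self hB0 h1)
    have h4 := Real.exp_pos (B / τ z)
    have h5 : Real.exp B * α z - (α z * v z * Real.exp (B / τ z) +
      ρ z * (Real.exp (B / τ z) * (-(B * α z) / τ z ^ 2))) =
      α z * ((Real.exp B - Real.exp (B / τ z)) +
        Real.exp (B / τ z) * (1 + ρ z * (B / τ z ^ 2) - v z)) := by ring
    rw [h5]
    have h6 : 0 ≤ 1 + ρ z * (B / τ z ^ 2) - v z := by linarith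
    have h7 : 0 ≤ Real.exp B - Real.exp (B / τ z) := by linarith
    positivity
  refine ⟨Real.exp B + |G (b + 1)|, by positivity, fun z hz => ?_⟩
  have h1 := hmono (Set.mem_Ici.2 le_rfl) hz hz
  have hz1 : 1 < z := by linarith
  have h2 := hf.one_le_τ z hz1
  have h3 : 1 ≤ Real.exp (B / τ z) := Real.one_le_exp (div_nonneg hB0 (by linarith))
  have hρ := h.ρ_pos z (h.lt_one.trans hz1)
  have h4 := neg_abs_le (G (b + 1))
  have h5 : ρ z ≤ ρ z * Real.exp (B / τ z) := le_mul_of_one_le_right hρ.le h3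
  have h6 : |G (b + 1)| ≤ |G (b + 1)| * τ z := le_mul_of_one_le_right (abs_nonneg _) h2
  have h7 : G z = Real.exp B * τ z - ρ z * Real.exp (B / τ z) := rfl
  rw [add_mul]
  linarith

/-- With ρ at most linear in τ, v bounded and R = O(τ^-(m+4)), the derivative of the Hawking mass is
at most Eα/τ² in absolute value. This is minus the derivative of E/τ, so the total variation is
finite. -/
theorem exists_tendsto_radHawking {τ T : ℝ → ℝ} {b C L : ℝ} (h : RadialData m a α ρ v p q)
    (hf : FallOff m α ρ v q τ T b C L) :
    ∃ l, Filter.Tendsto (radHawking m ρ v) Filter.atTop (nhds l) := by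
  have hb := hf.one_le
  obtain ⟨K, hK, hρK⟩ := h.exists_ρ_le hf
  have hC := hf.C_nonneg
  have hL := hf.L_pos
  set V := 1 + K * (C * L ^ (m + 2)) with hV
  have hV0 : 0 ≤ V := by positivity
  have hvV : ∀ z, b + 1 ≤ z → v z ≤ V := fun z hz => by
    have hz1 : 1 < z := by linarith
    have h1 := hf.one_le_τ z hz1
    have hρ := h.ρ_pos z (h.lt_one.trans hz1)
    have h2 : |q z| ≤ C * L ^ (m + 2) / τ z := by
      refine ((hf.q_le z (by linarith)).trans (div_pow_le_of_le_mul hC hL (by linarith)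
        (hf.τ_le z (by linarith)) (m + 2))).trans ?_
      gcongr
      exact le_self_pow₀ h1 (by omega)
    refine (h.v_le hz1).trans ?_
    rw [hV]
    refine add_le_add_right ?_ 1
    have hτ : τ z ≠ 0 := by linarith
    calc ρ z * |q z| ≤ (K * τ z) * (C * L ^ (m + 2) / τ z) := by
          gcongr
          exact hρK z hz
      _ = _ := by field_simp
  set E := V * K ^ (m + 2) * (C * L ^ (m + 4)) with hE
  have hE0 : 0 ≤ E := by positivity
  have hbound : ∀ z, b + 1 < z →
      |α z * ρ z ^ (m + 2) * (v z * radScalar m α ρ v z) / (2 * (m + 2))| ≤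
        E * α z / τ z ^ 2 := fun z hz => by
    have hz1 : 1 < z := by linarith
    have h1 := hf.one_le_τ z hz1
    have hρ := h.ρ_pos z (h.lt_one.trans hz1)
    have hα := h.α_pos z (h.lt_one.trans hz1)
    have hv := h.v_pos hz1
    have h2 : |radScalar m α ρ v z| ≤ C * L ^ (m + 4) / τ z ^ (m + 4) :=
      (hf.scalar_le z (by linarith)).trans (div_pow_le_of_le_mul hC hL (by linarith)
        (hf.τ_le z (by linarith)) (m + 4))
    have hm : (1 : ℝ) ≤ 2 * (m + 2) := by
      have : (0 : ℝ) ≤ m := m.cast_nonneg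
      linarith
    rw [abs_div, abs_mul, abs_mul, abs_mul, abs_of_pos hα, abs_of_pos (pow_pos hρ _),
      abs_of_pos hv, abs_of_nonneg (by positivity : (0 : ℝ) ≤ 2 * (m + 2))]
    calc α z * ρ z ^ (m + 2) * (v z * |radScalar m α ρ v z|) / (2 * (m + 2))
        ≤ α z * ρ z ^ (m + 2) * (v z * |radScalar m α ρ v z|) := div_le_self (by positivity) hm
      _ ≤ α z * (K * τ z) ^ (m + 2) * (V * (C * L ^ (m + 4) / τ z ^ (m + 4))) := by
          gcongr
          · exact hρK z hz.le
          · exact hvV z hz.le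
      _ = E * α z / τ z ^ 2 := by
          have : τ z ≠ 0 := by linarith
          rw [hE, mul_pow]
          field_simp
          ring
  have dτ : ∀ z, b < z → HasDerivAt (fun z => E / τ z) (-(E * α z / τ z ^ 2)) z := fun z hz => by
    have hz1 : 1 < z := by linarith
    have h1 := hf.one_le_τ z hz1
    refine ((hasDerivAt_const z E).div (hf.hasDerivAt z hz1) (by linarith)).congr_deriv ?_
    ring
  have dh : ∀ z, b < z → HasDerivAt (radHawking m ρ v) _ z := fun z hz =>
    h.hasDerivAt_radHawking (h.lt_one.trans (by linarith : 1 < z))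
  -- Correcting by E/τ makes both the Hawking mass and its negative increasing. The second fact
  -- bounds the first function from above.
  have mono1 : MonotoneOn (fun z => radHawking m ρ v z - E / τ z) (Set.Ici (b + 1)) := by
    refine monotoneOn_Ici_of_hasDerivAt (fun z hz => ((dh z ?_).sub
      (dτ z ?_)).continuousAt.continuousWithinAt)
      (fun z hz => (dh z (by linarith)).sub (dτ z (by linarith))) fun z hz => ?_
    · exact (lt_add_one b).trans_le hz
    · exact (lt_add_one b).trans_le hz
    · have := (abs_le.1 (hbound z hz)).1
      linarith
  have mono2 : MonotoneOn (fun z => -radHawking m ρ v z - E / τ z) (Set.Ici (b + 1)) := by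
    refine monotoneOn_Ici_of_hasDerivAt (fun z hz => ((dh z ?_).neg.sub
      (dτ z ?_)).continuousAt.continuousWithinAt)
      (fun z hz => (dh z (by linarith)).neg.sub (dτ z (by linarith))) fun z hz => ?_
    · exact (lt_add_one b).trans_le hz
    · exact (lt_add_one b).trans_le hz
    · have := (abs_le.1 (hbound z hz)).2
      linarith
  -- The correction converges because it is monotone and bounded; it is not necessary to know that τ
  -- is unbounded.
  have mono3 : MonotoneOn (fun z => -(E / τ z)) (Set.Ici (b + 1)) := by
    refine monotoneOn_Ici_of_hasDerivAt (fun z hz => (dτ z ?_).neg.continuousAt.continuousWithinAt)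
      (fun z hz => (dτ z (by linarith)).neg) fun z hz => ?_
    · exact (lt_add_one b).trans_le hz
    · have := h.α_pos z (h.lt_one.trans (by linarith : 1 < z))
      rw [neg_neg]
      positivity
  have hτ0 : ∀ z, b + 1 ≤ z → 0 ≤ E / τ z := fun z hz =>
    div_nonneg hE0 (zero_le_one.trans (hf.one_le_τ z (by linarith)))
  obtain ⟨l₁, h₁⟩ := exists_tendsto_of_monotoneOn mono3 (B := 0) fun z hz => by
    linarith [hτ0 z hz]
  obtain ⟨l₂, h₂⟩ := exists_tendsto_of_monotoneOn mono1
    (B := radHawking m ρ v (b + 1) + E / τ (b + 1)) fun z hz => by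
    have h1 := mono2 (Set.mem_Ici.2 le_rfl) hz hz
    simp only at h1
    linarith [hτ0 z hz]
  exact ⟨l₂ - l₁, (h₂.sub h₁).congr fun z => by ring⟩

/-- The Misner–Sharp mass and the Hawking mass have the same limit. -/
theorem exists_tendsto_misnerSharp {τ T : ℝ → ℝ} {b C L : ℝ} (h : RadialData m a α ρ v p q)
    (hf : FallOff m α ρ v q τ T b C L) :
    ∃ l, Filter.Tendsto (radHawking m ρ v) Filter.atTop (nhds l) ∧
      Filter.Tendsto (misnerSharp m ρ v q) Filter.atTop (nhds l) := by
  obtain ⟨l, hl⟩ := h.exists_tendsto_radHawking hf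
  refine ⟨l, hl, ?_⟩
  have hb := hf.one_le
  obtain ⟨K, hK, hρK⟩ := h.exists_ρ_le hf
  have hC := hf.C_nonneg
  have hL := hf.L_pos
  set E := 1 / 2 * (K * L) ^ (m + 3) * C ^ 2 with hE
  -- The difference of the two masses is of order T^(m+3) · T^(-2(m+2)) = T^-(m+1).
  have hzero : Filter.Tendsto (fun z => 1 / 2 * ρ z ^ (m + 3) * q z ^ 2) Filter.atTop (nhds 0) := by
    have h1 : Filter.Tendsto (fun z => E / T z) Filter.atTop (nhds 0) :=
      hf.tendsto.const_div_atTop E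
    refine tendsto_of_tendsto_of_tendsto_of_le_of_le' tendsto_const_nhds h1 ?_ ?_
    · filter_upwards [Filter.eventually_gt_atTop 1] with z hz
      have := h.ρ_pos z (h.lt_one.trans hz)
      positivity
    · filter_upwards [Filter.eventually_ge_atTop (b + 1), hf.tendsto.eventually_ge_atTop 1]
        with z hz hT
      have hz1 : 1 < z := by linarith
      have hρ := h.ρ_pos z (h.lt_one.trans hz1)
      have hT0 : 0 < T z := by linarith
      have h2 : ρ z ≤ K * L * T z := by
        rw [mul_assoc]
        exact (hρK z hz).trans (by gcongr; exact hf.τ_le z (by linarith))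
      have h3 : q z ^ 2 ≤ (C / T z ^ (m + 2)) ^ 2 := by
        rw [← sq_abs]
        gcongr
        exact hf.q_le z (by linarith)
      calc 1 / 2 * ρ z ^ (m + 3) * q z ^ 2
          ≤ 1 / 2 * (K * L * T z) ^ (m + 3) * (C / T z ^ (m + 2)) ^ 2 := by gcongr
        _ = E / T z ^ (m + 1) := by
          rw [hE, mul_pow (K * L)]
          field_simp
          ring
        _ ≤ E / T z := by
          gcongr
          exact le_self_pow₀ hT (by omega)
  have h4 := hl.add hzero
  rw [add_zero] at h4
  refine h4.congr fun z => ?_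
  rw [radHawking, misnerSharp]
  ring

theorem misnerSharp_le_of_tendsto (h : RadialData m a α ρ v p q) {l : ℝ}
    (hl : Filter.Tendsto (misnerSharp m ρ v q) Filter.atTop (nhds l)) {z : ℝ} (hz : 1 ≤ z) :
    misnerSharp m ρ v q z ≤ l := by
  refine ge_of_tendsto hl ?_
  filter_upwards [Filter.eventually_ge_atTop z] with y hy
  exact h.monotoneOn_misnerSharp hz (hz.trans hy) hy

/-- If the mass is constant then the data are vacuum. -/
theorem vacuum (h : RadialData m a α ρ v p q) {M : ℝ}
    (hM : ∀ z, 1 ≤ z → misnerSharp m ρ v q z = M) {z : ℝ} (hz : 1 < z) :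
    radEnergy m α ρ v p q z = 0 ∧ radMomentum m α ρ v p q z = 0 := by
  have hd := h.hasDerivAt_misnerSharp (h.lt_one.trans hz)
  have h0 : HasDerivAt (misnerSharp m ρ v q) 0 z :=
    (hasDerivAt_const z M).congr_of_eventuallyEq (by
      filter_upwards [Ioi_mem_nhds hz] with y hy using hM y (Set.mem_Ioi.1 hy).le)
  have h1 := hd.unique h0
  have hα := h.α_pos z (h.lt_one.trans hz)
  have hρ := h.ρ_pos z (h.lt_one.trans hz)
  have h2 : v z * radEnergy m α ρ v p q z = ρ z * q z * radMomentum m α ρ v p q z := by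
    have hm : (0 : ℝ) < 2 * (m + 2) := by positivity
    have h3 : 0 < α z * ρ z ^ (m + 2) := by positivity
    rw [div_eq_zero_iff, mul_eq_zero] at h1
    rcases h1 with (h1 | h1) | h1
    · exact absurd h1 h3.ne'
    · linarith
    · exact absurd h1 hm.ne'
  have h4 := h.untrapped z hz
  have h5 := h.energy z hz
  have h6 : ρ z * q z * radMomentum m α ρ v p q z ≤
      ρ z * |q z| * |radMomentum m α ρ v p q z| := by
    rw [← abs_of_pos hρ, ← abs_mul, ← abs_mul, abs_of_pos hρ]
    exact le_abs_self _
  have h7 := abs_nonneg (radMomentum m α ρ v p q z)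
  have h8 : ρ z * |q z| * |radMomentum m α ρ v p q z| ≤ ρ z * |q z| * radEnergy m α ρ v p q z := by
    gcongr
  -- Constancy gives v·E = ρqJ ≤ ρ|q|·E with E the energy term. Since ρ|q| < v strictly, E cannot be
  -- positive.
  have h9 : radEnergy m α ρ v p q z = 0 := by
    have hE : 0 ≤ radEnergy m α ρ v p q z := h7.trans h5
    by_contra hne
    have hE' := lt_of_le_of_ne hE (Ne.symm hne)
    nlinarith
  refine ⟨h9, abs_eq_zero.1 (le_antisymm (h9 ▸ h5) h7)⟩

end RadialData

end Penrose

namespace Penrose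

/-! ### From initial data to the reduced system -/

/-- A smooth function on `(a, ∞)` has a smooth primitive. -/
theorem exists_primitive {f : ℝ → ℝ} {a : ℝ} (ha : a < 1) (hf : ContDiffOn ℝ ∞ f (Set.Ioi a)) :
    ∃ F : ℝ → ℝ, F 1 = 0 ∧ ContDiffOn ℝ ∞ F (Set.Ioi a) ∧
      ∀ z, a < z → HasDerivAt F (f z) z := by
  have hd : ∀ z, a < z → HasDerivAt (fun y => ∫ s in (1 : ℝ)..y, f s) (f z) z := fun z hz => by
    have hsub : Set.uIcc 1 z ⊆ Set.Ioi a := fun s hs =>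
      lt_of_lt_of_le (lt_min ha hz) hs.1
    exact intervalIntegral.integral_hasDerivAt_right
      ((hf.continuousOn.mono hsub).intervalIntegrable)
      (hf.continuousOn.stronglyMeasurableAtFilter isOpen_Ioi z hz)
      (hf.continuousOn.continuousAt (Ioi_mem_nhds hz))
  refine ⟨_, by simp, ?_, hd⟩
  -- The derivative of the primitive is the smooth function f, so the primitive is smooth.
  rw [contDiffOn_infty_iff_deriv_of_isOpen isOpen_Ioi]
  exact ⟨fun z hz => (hd z hz).differentiableAt.differentiableWithinAt,
    hf.congr fun z hz => (hd z hz).deriv⟩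

section Reduction

variable {n m : ℕ}

theorem exists_norm_eq_sqrt (hn : 1 ≤ n) (z : ℝ) : ∃ x : Eucl n, ‖x‖ = √z :=
  ⟨√z • stdVec ⟨0, by omega⟩, by
    rw [norm_smul, Real.norm_of_nonneg (Real.sqrt_nonneg z)]
    simp [stdVec]⟩

/-- The profiles of spherically symmetric initial data. -/
theorem InitialData.exists_profiles (hn : 3 ≤ n) (D : InitialData n)
    (hsym : D.IsSphericallySymmetric) :
    ∃ a β η γ ζ, HasProfile D.g a β η ∧ PosProfile a β η ∧ HasProfile D.k a γ ζ := by
  obtain ⟨a₁, β, η, h01, h11, hg⟩ := exists_hasProfile hn D.g_smooth D.g_symm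
    fun A hA x hx u v => (hsym A hA x hx u v).1
  obtain ⟨a₂, γ, ζ, h02, h12, hk⟩ := exists_hasProfile hn D.k_smooth D.k_symm
    fun A hA x hx u v => (hsym A hA x hx u v).2
  -- Positivity of g is tested on a vector tangent to the sphere and on x itself. Continuity then
  -- carries both inequalities to some z < 1.
  have hpos : ∀ z, 1 ≤ z → 0 < β z ∧ 0 < β z + η z * z := by
    intro z hz
    have hz0 : 0 ≤ z := by linarith
    obtain ⟨x, hxn⟩ := exists_norm_eq_sqrt (n := n) (by omega) z
    have hx : x ∈ exteriorDomain n := by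
      change 1 ≤ ‖x‖
      rw [hxn]
      exact Real.one_le_sqrt.2 hz
    have hxz : ‖x‖ ^ 2 = z := by rw [hxn, Real.sq_sqrt hz0]
    obtain ⟨w, hw, hwx, -⟩ := exists_ne_zero_orthogonal_pair hn x x
    have h1 := D.g_pos x hx w hw
    have hx0 : x ≠ 0 := by
      rintro rfl
      rw [norm_zero] at hxz
      norm_num at hxz
      linarith
    have h2 := D.g_pos x hx x hx0
    rw [hg.apply_eq x hx, real_inner_comm, hxz, real_inner_self_eq_norm_sq] at h1 h2
    rw [real_inner_comm, hwx] at h1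
    rw [hxz] at h2
    have hw2 : 0 < ‖w‖ ^ 2 := by positivity
    constructor
    · by_contra! h
      nlinarith
    · have : β z * z + η z * (z * z) = z * (β z + η z * z) := by ring
      rw [this] at h2
      exact pos_of_mul_pos_right h2 hz0
  set a₀ := max a₁ a₂ with ha₀
  have h0 : 0 < a₀ := lt_max_of_lt_left h01
  have h1 : a₀ < 1 := max_lt h11 h12
  have cont1 : ContinuousOn β (Set.Ioi a₀) :=
    hg.smooth_fst.continuousOn.mono (Set.Ioi_subset_Ioi (le_max_left _ _))
  have cont2 : ContinuousOn (fun z => β z + η z * z) (Set.Ioi a₀) :=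
    (contDiffOn_radial hg).continuousOn.mono (Set.Ioi_subset_Ioi (le_max_left _ _))
  have hopen := (cont1.isOpen_inter_preimage isOpen_Ioi isOpen_Ioi (t := Set.Ioi (0 : ℝ))).inter
    (cont2.isOpen_inter_preimage isOpen_Ioi isOpen_Ioi (t := Set.Ioi (0 : ℝ)))
  obtain ⟨a, ha0, ha1, hsub⟩ := exists_Ioi_subset_of_isOpen hopen fun z (hz : 1 ≤ z) =>
    ⟨⟨h1.trans_le hz, (hpos z hz).1⟩, ⟨h1.trans_le hz, (hpos z hz).2⟩⟩
  have hIoi : Set.Ioi a ⊆ Set.Ioi a₀ := fun z hz => (hsub hz).1.1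
  refine ⟨a, β, η, γ, ζ, ⟨hg.apply_eq, hg.smooth_fst.mono ?_, hg.smooth_snd.mono ?_⟩,
    ⟨ha0, ha1, fun z hz => (hsub hz).1.2, fun z hz => (hsub hz).2.2⟩,
    ⟨hk.apply_eq, hk.smooth_fst.mono ?_, hk.smooth_snd.mono ?_⟩⟩
  · exact hIoi.trans (Set.Ioi_subset_Ioi (le_max_left _ _))
  · exact hIoi.trans (Set.Ioi_subset_Ioi (le_max_left _ _))
  · exact hIoi.trans (Set.Ioi_subset_Ioi (le_max_right _ _))
  · exact hIoi.trans (Set.Ioi_subset_Ioi (le_max_right _ _))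

variable {a : ℝ} {β η γ ζ : ℝ → ℝ}

theorem scalarCurvature_eq_radScalar {g : Eucl (m + 3) → Form (m + 3)}
    (hg : HasProfile g a β η) (hp : PosProfile a β η) {x : Eucl (m + 3)} (hx : 1 < ‖x‖) :
    scalarCurvature g x = radScalar m (arcDensity β η) (radius β) (slope β η) (‖x‖ ^ 2) := by
  rw [scalarCurvature_eq_radius hg hp hx rfl, radScalar]
  push_cast
  ring

/-- Since Θ± = (n-1)(v/ρ ± q), positivity of both expansions is ρ|q| < v. The vanishing of either
one on the boundary gives the same squared relation, so the two kinds of horizon are treated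
together from here on. -/
theorem InitialData.radialData (D : InitialData (m + 3)) (hg : HasProfile D.g a β η)
    (hp : PosProfile a β η) (hk : HasProfile D.k a γ ζ) (hhor : D.ApparentHorizonCondition)
    (hdec : D.DominantEnergyCondition) :
    RadialData m a (arcDensity β η) (radius β) (slope β η) (radEig β η γ ζ) (tangEig β γ) := by
  have hm : (0 : ℝ) < m + 2 := by positivity
  have hplus : ∀ x ∈ exteriorDomain (m + 3), expansionPlus D.g D.k x = (m + 2) *
      (slope β η (‖x‖ ^ 2) / radius β (‖x‖ ^ 2) + tangEig β γ (‖x‖ ^ 2)) := fun x hx => by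
    rw [expansionPlus, meanCurvature_eq (by omega) D.g_smooth hg hp hx, sphereTrace_eq hg hp hk hx]
    push_cast
    ring
  have hminus : ∀ x ∈ exteriorDomain (m + 3), expansionMinus D.g D.k x = (m + 2) *
      (slope β η (‖x‖ ^ 2) / radius β (‖x‖ ^ 2) - tangEig β γ (‖x‖ ^ 2)) := fun x hx => by
    rw [expansionMinus, meanCurvature_eq (by omega) D.g_smooth hg hp hx, sphereTrace_eq hg hp hk hx]
    push_cast
    ring
  refine ⟨hp.lt_one, contDiffOn_arcDensity hg hp, contDiffOn_radius hg hp, contDiffOn_slope hg hp,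
    contDiffOn_radEig hg hp hk, contDiffOn_tangEig hg hp hk, fun z hz => hp.arcDensity_pos hz,
    fun z hz => hp.radius_pos hz, fun z hz => ?_, fun z hz => ?_, fun z hz => ?_, ?_⟩
  · rw [slope, mul_div_cancel₀ _ (hp.arcDensity_pos hz).ne']
  · have hz0 : 0 ≤ z := by linarith
    obtain ⟨x, hxn⟩ := exists_norm_eq_sqrt (n := m + 3) (by omega) z
    have hx : 1 < ‖x‖ := by rw [hxn]; exact Real.lt_sqrt_of_sq_lt (by simpa using hz)
    have hxz : ‖x‖ ^ 2 = z := by rw [hxn, Real.sq_sqrt hz0]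
    obtain ⟨h1, h2⟩ := hhor.1 x hx
    rw [hplus x hx.le, hxz] at h1
    rw [hminus x hx.le, hxz] at h2
    have h3 := pos_of_mul_pos_right h1 hm.le
    have h4 := pos_of_mul_pos_right h2 hm.le
    have hρ := hp.radius_pos (hp.lt_one.trans hz)
    rw [mul_comm, ← lt_div_iff₀ hρ, abs_lt]
    constructor <;> linarith
  · have h1 := hdec.profile (by omega) hg hp hk hz
    rw [radMomentum, radEnergy, radScalar]
    push_cast at h1
    convert h1 using 2 <;> ring
  · obtain ⟨x, hxn⟩ := exists_norm_eq_sqrt (n := m + 3) (by omega) 1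
    rw [Real.sqrt_one] at hxn
    have hx : x ∈ exteriorDomain (m + 3) := hxn.ge
    have hρ := hp.radius_pos hp.lt_one
    rcases hhor.2 with h | h
    · have h1 := h x hxn
      rw [hplus x hx, hxn, one_pow] at h1
      have h2 := (mul_eq_zero.1 h1).resolve_left hm.ne'
      field_simp at h2
      rw [show slope β η 1 = -(radius β 1 * tangEig β γ 1) by linarith]
      ring
    · have h1 := h x hxn
      rw [hminus x hx, hxn, one_pow] at h1
      have h2 := (mul_eq_zero.1 h1).resolve_left hm.ne'
      field_simp at h2
      rw [show slope β η 1 = radius β 1 * tangEig β γ 1 by linarith]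

/-! ### Asymptotic flatness -/

theorem form_apply_eq_sum (b : Form n) (u v : Eucl n) :
    b u v = ∑ i, ∑ j, u i * v j * b (stdVec i) (stdVec j) := by
  have hu : ∀ u : Eucl n, u = ∑ i, u i • (stdVec i : Eucl n) := fun u => by
    have := (EuclideanSpace.basisFun (Fin n) ℝ).sum_repr u
    simpa [stdVec, EuclideanSpace.basisFun_apply] using this.symm
  conv_lhs => rw [hu u, hu v]
  simp only [map_sum, map_smul, sum_apply, smul_apply, smul_eq_mul,
    Finset.mul_sum]
  rw [Finset.sum_comm]
  exact Finset.sum_congr rfl fun i _ => Finset.sum_congr rfl fun j _ => by ring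

/-- Entrywise errors are summed and (∑|uᵢ|)² ≤ n‖u‖² is applied. -/
theorem abs_form_sub_le {b : Form n} {c ε : ℝ}
    (h : ∀ i j, |b (stdVec i) (stdVec j) - c * kd i j| ≤ ε) (u : Eucl n) :
    |b u u - c * ‖u‖ ^ 2| ≤ n * ε * ‖u‖ ^ 2 := by
  have h1 : b u u - c * ‖u‖ ^ 2 =
      ∑ i, ∑ j, u i * u j * (b (stdVec i) (stdVec j) - c * kd i j) := by
    rw [form_apply_eq_sum, norm_sq_eq_sum, Finset.mul_sum, ← Finset.sum_sub_distrib]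
    refine Finset.sum_congr rfl fun i _ => ?_
    simp only [mul_sub, Finset.sum_sub_distrib]
    congr 1
    simp [kd, mul_comm]
  have h2 : |b u u - c * ‖u‖ ^ 2| ≤ ∑ i, ∑ j, |u i| * |u j| * ε := by
    rw [h1]
    refine (Finset.abs_sum_le_sum_abs _ _).trans (Finset.sum_le_sum fun i _ =>
      (Finset.abs_sum_le_sum_abs _ _).trans (Finset.sum_le_sum fun j _ => ?_))
    rw [abs_mul, abs_mul]
    gcongr
    exact h i j
  have h3 : ∑ i, ∑ j, |u i| * |u j| * ε = (∑ i, |u i|) ^ 2 * ε := by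
    rw [sq, Finset.sum_mul_sum, Finset.sum_mul]
    exact Finset.sum_congr rfl fun i _ => by rw [Finset.sum_mul]
  have h4 : (∑ i, |u i|) ^ 2 ≤ n * ‖u‖ ^ 2 := by
    have := sq_sum_le_card_mul_sum_sq (s := Finset.univ) (f := fun i => |u i|)
    rw [Finset.card_univ, Fintype.card_fin] at this
    refine this.trans (le_of_eq ?_)
    rw [norm_sq_eq_sum]
    congr 1
    exact Finset.sum_congr rfl fun i _ => by rw [sq_abs, sq]
  -- With no entries the hypothesis does not give 0 ≤ ε, so dimension zero is separate.
  by_cases hn : n = 0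
  · subst hn
    rw [h3] at h2
    simpa using h2
  have hε : 0 ≤ ε := (abs_nonneg _).trans (h ⟨0, by omega⟩ ⟨0, by omega⟩)
  calc _ ≤ _ := h2
    _ = _ := h3
    _ ≤ n * ‖u‖ ^ 2 * ε := by gcongr
    _ = _ := by ring

end Reduction

end Penrose

namespace Penrose

/-! ### Fall-off of the reduced data along a coordinate ray -/

section AsymptoticFlatness

variable {m : ℕ} {a : ℝ} {β η γ ζ : ℝ → ℝ}

/-- The differential of radial arclength has g-norm one. The defect is β times ‖w‖² - ⟨x, w⟩²/‖x‖²,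
nonnegative by Cauchy–Schwarz. -/
theorem arcDensity_mul_inner_le {n : ℕ} {g : Eucl n → Form n} (hg : HasProfile g a β η)
    (hp : PosProfile a β η) {x : Eucl n} (hx : x ∈ exteriorDomain n) (w : Eucl n) :
    (arcDensity β η (‖x‖ ^ 2) * (2 * inner ℝ x w)) ^ 2 ≤ g x w w := by
  have h1 : a < ‖x‖ ^ 2 := hp.lt_one.trans_le (one_le_norm_sq hx)
  have hz0 : 0 < ‖x‖ ^ 2 := hp.nonneg.trans h1
  have hb := hp.fst_pos _ h1
  have hA := hp.arcDensity_sq h1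
  rw [hg.apply_eq x hx, real_inner_self_eq_norm_sq]
  have h2 : inner ℝ x w ^ 2 ≤ ‖x‖ ^ 2 * ‖w‖ ^ 2 := by
    rw [← mul_pow, ← sq_abs]
    gcongr
    exact abs_real_inner_le_norm x w
  have h3 : η (‖x‖ ^ 2) =
      (4 * ‖x‖ ^ 2 * arcDensity β η (‖x‖ ^ 2) ^ 2 - β (‖x‖ ^ 2)) / ‖x‖ ^ 2 := by
    rw [← hA, add_sub_cancel_left, mul_div_cancel_right₀ _ hz0.ne']
  rw [h3]
  have h4 : β (‖x‖ ^ 2) * (inner ℝ x w ^ 2 / ‖x‖ ^ 2) ≤ β (‖x‖ ^ 2) * ‖w‖ ^ 2 := by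
    gcongr
    rw [div_le_iff₀ hz0]
    linarith
  have h5 : β (‖x‖ ^ 2) * ‖w‖ ^ 2 + (4 * ‖x‖ ^ 2 * arcDensity β η (‖x‖ ^ 2) ^ 2 -
      β (‖x‖ ^ 2)) / ‖x‖ ^ 2 * (inner ℝ x w * inner ℝ x w) =
      (arcDensity β η (‖x‖ ^ 2) * (2 * inner ℝ x w)) ^ 2 +
        (β (‖x‖ ^ 2) * ‖w‖ ^ 2 - β (‖x‖ ^ 2) * (inner ℝ x w ^ 2 / ‖x‖ ^ 2)) := by
    generalize ‖x‖ ^ 2 = z at *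
    field_simp
    ring
  rw [h5]
  linarith

/-- Asymptotic flatness implies the fall-off of the reduced data. -/
theorem InitialData.IsAsymptoticallyFlat.exists_fallOff {D : InitialData (m + 3)}
    (hflat : D.IsAsymptoticallyFlat) (hg : HasProfile D.g a β η) (hp : PosProfile a β η)
    (hk : HasProfile D.k a γ ζ) :
    ∃ τ T b C L, RadialData.FallOff m (arcDensity β η) (radius β) (slope β η) (tangEig β γ)
      τ T b C L := by
  obtain ⟨R, C, K, Φ, hR, -, hΦs, hΦi, hΦb, hΦt, hfall⟩ := hflat
  obtain ⟨S, hS1, hSs, hSd⟩ := exists_primitive hp.lt_one (contDiffOn_arcDensity hg hp)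
  set e : Eucl (m + 3) := stdVec ⟨0, by omega⟩ with he
  have hen : ‖e‖ = 1 := by simp [he, stdVec]
  have hray : ∀ t : ℝ, 0 ≤ t → ‖t • e‖ = t := fun t ht => by
    rw [norm_smul, hen, mul_one, Real.norm_of_nonneg ht]
  have hC : 0 ≤ C := by
    have h1 : R < ‖(R + 1) • e‖ := by rw [hray _ (by linarith)]; linarith
    have h2 := (abs_nonneg _).trans (hfall _ h1).2.2.1
    rw [hray _ (by linarith)] at h2
    by_contra! h
    have : C / (R + 1) ^ (m + 3 + 1) < 0 := div_neg_of_neg_of_pos h (by positivity)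
    linarith
  set N : ℝ := ((m + 3 : ℕ) : ℝ) with hN
  have hN3 : (3 : ℝ) ≤ N := by rw [hN]; push_cast; linarith [(m.cast_nonneg : (0 : ℝ) ≤ m)]
  -- Beyond this radius each metric entry is within 1/(2N) of the Euclidean one, so the quadratic
  -- forms differ by at most ½‖u‖².
  set R₁ : ℝ := R + 1 + 2 * N * C with hR₁
  have hNC : 0 ≤ 2 * N * C := by positivity
  have hRlt : ∀ t, R₁ ≤ t → R < ‖t • e‖ := fun t ht => by rw [hray t (by linarith)]; linarith
  have hM : ∀ t, R₁ ≤ t → Φ (t • e) ∈ exteriorDomain (m + 3) := fun t ht =>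
    (hΦb.mapsTo (hRlt t ht)).1
  have hΦd : ∀ t, R₁ ≤ t → DifferentiableAt ℝ Φ (t • e) := fun t ht =>
    (hΦs.contDiffAt ((isOpen_lt continuous_const continuous_norm).mem_nhds
      (hRlt t ht))).differentiableAt (by simp)
  have hgb : ∀ t, R₁ ≤ t → ∀ u, |D.g (Φ (t • e)) (fderiv ℝ Φ (t • e) u) (fderiv ℝ Φ (t • e) u) -
      1 * ‖u‖ ^ 2| ≤ 1 / 2 * ‖u‖ ^ 2 := by
    intro t ht u
    have ht1 : 1 ≤ t := by linarith
    have h1 : ∀ i j, |pullback Φ D.g (t • e) (stdVec i) (stdVec j) - 1 * kd i j| ≤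
        1 / (2 * N) := by
      intro i j
      have h2 := (hfall _ (hRlt t ht)).1 i j 0 (by norm_num)
      rw [norm_iteratedFDeriv_zero, hray t (by linarith), Real.norm_eq_abs] at h2
      rw [one_mul]
      refine (show _ ≤ C / t ^ (m + 3 - 2 + 0) from h2).trans ?_
      rw [div_le_div_iff₀ (by positivity) (by positivity), one_mul]
      have h3 : t ≤ t ^ (m + 3 - 2 + 0) := le_self_pow₀ ht1 (by omega)
      linarith
    refine (abs_form_sub_le h1 u).trans (le_of_eq ?_)
    rw [← hN]
    field_simp
  have hkb : ∀ t, R₁ ≤ t → ∀ u, |D.k (Φ (t • e)) (fderiv ℝ Φ (t • e) u) (fderiv ℝ Φ (t • e) u)| ≤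
      N * (C / t ^ (m + 2)) * ‖u‖ ^ 2 := by
    intro t ht u
    have h1 : ∀ i j, |pullback Φ D.k (t • e) (stdVec i) (stdVec j) - 0 * kd i j| ≤
        C / t ^ (m + 2) := by
      intro i j
      have h2 := (hfall _ (hRlt t ht)).2.1 i j 0 (by norm_num)
      rw [norm_iteratedFDeriv_zero, hray t (by linarith), Real.norm_eq_abs] at h2
      rw [zero_mul, sub_zero]
      exact h2
    have h2 := abs_form_sub_le h1 u
    rw [zero_mul, sub_zero] at h2
    exact h2
  have hq : ∀ t, R₁ ≤ t → |tangEig β γ (‖Φ (t • e)‖ ^ 2)| ≤ 2 * N * C / t ^ (m + 2) := by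
    intro t ht
    have hx := hM t ht
    have hb := hp.fst_pos _ (hp.lt_one.trans_le (one_le_norm_sq hx))
    -- On a vector w tangent to the orbit sphere q = k(w, w)/g(w, w). Its preimage u under the
    -- invertible differential of Φ brings the chart bounds to bear.
    obtain ⟨w, hw, hwx, -⟩ := exists_ne_zero_orthogonal_pair (by omega) (Φ (t • e)) (Φ (t • e))
    obtain ⟨u, hu⟩ := LinearMap.injective_iff_surjective.1 (hΦi _ (hRlt t ht)) w
    have hu' : fderiv ℝ Φ (t • e) u = w := hu
    have h1 := (abs_le.1 (hgb t ht u)).1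
    have h2 := hkb t ht u
    rw [real_inner_comm] at hwx
    rw [hu', hg.apply_eq _ hx, hwx, real_inner_self_eq_norm_sq] at h1
    rw [hu', hk.apply_eq _ hx, hwx, real_inner_self_eq_norm_sq] at h2
    simp only [mul_zero, add_zero] at h1 h2
    have hw2 : 0 < ‖w‖ ^ 2 := by positivity
    rw [abs_mul, abs_of_pos hw2] at h2
    rw [tangEig, abs_div, abs_of_pos hb, div_le_iff₀ hb]
    have ht0 : 0 < t := by linarith
    have h3 : 0 ≤ N * (C / t ^ (m + 2)) := by positivity
    refine le_of_mul_le_mul_right ?_ hw2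
    calc |γ (‖Φ (t • e)‖ ^ 2)| * ‖w‖ ^ 2 ≤ N * (C / t ^ (m + 2)) * ‖u‖ ^ 2 := h2
      _ ≤ N * (C / t ^ (m + 2)) * (2 * (β (‖Φ (t • e)‖ ^ 2) * ‖w‖ ^ 2)) := by
        gcongr
        linarith
      _ = _ := by ring
  have hcont : ContinuousOn (fun t : ℝ => ‖Φ (t • e)‖) (Set.Ici R₁) := fun t ht =>
    ((hΦd t ht).continuousAt.comp (f := fun t : ℝ => t • e)
      (by fun_prop)).norm.continuousWithinAt
  have htend : Filter.Tendsto (fun t : ℝ => ‖Φ (t • e)‖) Filter.atTop Filter.atTop := by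
    refine tendsto_norm_cobounded_atTop.comp (hΦt.comp ?_)
    rw [← tendsto_norm_atTop_iff_cobounded]
    refine Filter.tendsto_id.congr' ?_
    filter_upwards [Filter.eventually_ge_atTop 0] with t ht using (hray t ht).symm
  set r₁ : ℝ := ‖Φ (R₁ • e)‖ with hr₁
  -- The image of the ray is continuous and escapes to infinity, so it meets every large orbit
  -- sphere. T z will be the parameter of one such meeting, arbitrary for small z; neither
  -- continuity nor monotonicity of T is needed.
  have hivt : ∀ z, ∃ t, r₁ ^ 2 < z → R₁ ≤ t ∧ ‖Φ (t • e)‖ ^ 2 = z := by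
    intro z
    by_cases hz : r₁ ^ 2 < z
    swap
    · exact ⟨0, fun h => absurd h hz⟩
    have hz0 : 0 ≤ z := (sq_nonneg r₁).trans hz.le
    have hrz : r₁ ≤ √z := Real.le_sqrt_of_sq_le hz.le
    obtain ⟨t', ht', ht''⟩ := ((htend.eventually_ge_atTop (√z)).and
      (Filter.eventually_ge_atTop R₁)).exists
    obtain ⟨t, ht, hteq⟩ := intermediate_value_Icc ht''
      (hcont.mono Set.Icc_subset_Ici_self) ⟨hrz, ht'⟩
    refine ⟨t, fun _ => ⟨ht.1, ?_⟩⟩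
    simp only at hteq
    rw [hteq, Real.sq_sqrt hz0]
  choose T hT using hivt
  -- The ray has squared g-speed at most 3/2, hence speed below 2, and radial arclength grows no
  -- faster than length along the ray.
  have hSR : ∀ t, R₁ ≤ t → S (‖Φ (t • e)‖ ^ 2) ≤ S (r₁ ^ 2) + 2 * (t - R₁) := by
    have hd : ∀ t, R₁ ≤ t → HasDerivAt (fun t : ℝ => 2 * t - S (‖Φ (t • e)‖ ^ 2))
        (2 - arcDensity β η (‖Φ (t • e)‖ ^ 2) *
          (2 * inner ℝ (Φ (t • e)) (fderiv ℝ Φ (t • e) e))) t := by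
      intro t ht
      have d1 : HasDerivAt (fun t : ℝ => t • e) e t := by
        simpa using (hasDerivAt_id t).smul_const e
      have d2 := (hΦd t ht).hasFDerivAt.comp_hasDerivAt t d1
      have d3 := d2.norm_sq
      have d4 := (hSd (‖Φ (t • e)‖ ^ 2)
        (hp.lt_one.trans_le (one_le_norm_sq (hM t ht)))).comp t d3
      have d5 := ((hasDerivAt_id t).const_mul 2).sub d4
      refine d5.congr_deriv ?_
      simp
    have hmono : MonotoneOn (fun t : ℝ => 2 * t - S (‖Φ (t • e)‖ ^ 2)) (Set.Ici R₁) := by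
      refine monotoneOn_Ici_of_hasDerivAt
        (fun t ht => (hd t ht).continuousAt.continuousWithinAt) (fun t ht => hd t ht.le)
        fun t ht => ?_
      have h1 := arcDensity_mul_inner_le hg hp (hM t ht.le) (fderiv ℝ Φ (t • e) e)
      have h2 := (abs_le.1 (hgb t ht.le e)).2
      rw [hen] at h2
      have h3 := h1.trans (by linarith : _ ≤ (2 : ℝ) ^ 2)
      have h4 := le_of_sq_le_sq h3 (by norm_num)
      linarith
    intro t ht
    have := hmono (Set.mem_Ici.2 le_rfl) ht ht
    simp only at this
    rw [← hr₁] at this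
    linarith
  have hSmono : MonotoneOn S (Set.Ici 1) := monotoneOn_Ici_of_hasDerivAt
    (fun z hz => (hSd z (hp.lt_one.trans_le hz)).continuousAt.continuousWithinAt)
    (fun z hz => hSd z (hp.lt_one.trans hz))
    fun z hz => (hp.arcDensity_pos (hp.lt_one.trans hz)).le
  have hlt : ∀ z, max 1 (r₁ ^ 2) < z → r₁ ^ 2 < z := fun z hz => (le_max_right _ _).trans_lt hz
  -- Arclength is shifted by 1 so that τ ≥ 1. The constant L absorbs 1 + S(r₁²) + 2T, using T ≥ 1.
  refine ⟨fun z => 1 + S z, T, max 1 (r₁ ^ 2), 2 * N * C, 3 + |S (r₁ ^ 2)|, le_max_left _ _,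
    hNC, by positivity, ?_, fun z hz => (hSd z (hp.lt_one.trans hz)).const_add 1, fun z hz => ?_,
    fun z hz => ?_, fun z hz => ?_, fun z hz => ?_⟩
  · rw [Filter.tendsto_atTop]
    intro B
    -- Bounded parameters reach only bounded spheres, so large z forces large T z.
    obtain ⟨c, hc⟩ := (isCompact_Icc (a := R₁) (b := B)).exists_bound_of_continuousOn
      (hcont.mono Set.Icc_subset_Ici_self)
    filter_upwards [Filter.eventually_gt_atTop (max (c ^ 2) (r₁ ^ 2))] with z hz
    obtain ⟨h1, h2⟩ := hT z ((le_max_right _ _).trans_lt hz)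
    by_contra! h
    have h3 := hc (T z) ⟨h1, h.le⟩
    rw [norm_norm] at h3
    have h4 : z ≤ c ^ 2 := by rw [← h2]; gcongr
    exact absurd ((le_max_left _ _).trans_lt hz) (not_lt.2 h4)
  · have := hSmono (Set.mem_Ici.2 le_rfl) (Set.mem_Ici.2 hz.le) hz.le
    rw [hS1] at this
    linarith
  · obtain ⟨h1, h2⟩ := hT z (hlt z hz)
    have h3 := hSR _ h1
    rw [h2] at h3
    have h4 := le_abs_self (S (r₁ ^ 2))
    have h5 : 1 ≤ T z := by linarith
    have h6 : |S (r₁ ^ 2)| ≤ |S (r₁ ^ 2)| * T z := le_mul_of_one_le_right (abs_nonneg _) h5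
    rw [add_mul]
    linarith
  · obtain ⟨h1, h2⟩ := hT z (hlt z hz)
    have h3 := hq _ h1
    rwa [h2] at h3
  · obtain ⟨h1, h2⟩ := hT z (hlt z hz)
    have h3 := (hfall _ (hRlt _ h1)).2.2.1
    have hz1 : 1 < z := (le_max_left _ _).trans_lt hz
    have hx : 1 < ‖Φ (T z • e)‖ := by
      by_contra! h
      have : ‖Φ (T z • e)‖ ^ 2 ≤ 1 := pow_le_one₀ (norm_nonneg _) h
      linarith
    have hT0 : 0 < T z := by linarith
    rw [scalarCurvature_eq_radScalar hg hp hx, h2, hray _ hT0.le] at h3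
    refine h3.trans ?_
    have : C ≤ 2 * N * C := by nlinarith
    gcongr

end AsymptoticFlatness

end Penrose

namespace Penrose

/-! ### The embedding of vacuum data -/

/-- Brings to the horizon identities whose derivation divides by X or uses the vacuum equations,
available only for z > 1. -/
theorem eq_of_eq_Ioi_one {F G : ℝ → ℝ} {a : ℝ} (ha : a < 1) (hF : ContinuousOn F (Set.Ioi a))
    (hG : ContinuousOn G (Set.Ioi a)) (h : ∀ z, 1 < z → F z = G z) {z : ℝ} (hz : 1 ≤ z) :
    F z = G z := by
  rcases hz.lt_or_eq with h1 | rfl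
  · exact h z h1
  have hF1 := (hF.continuousAt (Ioi_mem_nhds ha)).tendsto.mono_left
    (nhdsWithin_le_nhds (s := Set.Ioi 1))
  have hG1 := (hG.continuousAt (Ioi_mem_nhds ha)).tendsto.mono_left
    (nhdsWithin_le_nhds (s := Set.Ioi 1))
  refine tendsto_nhds_unique (hF1.congr' ?_) hG1
  filter_upwards [self_mem_nhdsWithin] with z hz using h z hz

theorem horizonRadius_half_pow {m : ℕ} {r : ℝ} (hr : 0 < r) :
    horizonRadius (m + 3) (1 / 2 * r ^ (m + 1)) = r := by
  rw [horizonRadius, ← mul_assoc, mul_one_div_cancel two_ne_zero, one_mul, ← Real.rpow_natCast,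
    ← Real.rpow_mul hr.le]
  push_cast
  rw [show ((m : ℝ) + 1) * (1 / (m + 3 - 2)) = 1 by
    have : (m : ℝ) + 1 ≠ 0 := by positivity
    rw [show (m : ℝ) + 3 - 2 = m + 1 by ring]
    field_simp, Real.rpow_one]

theorem contDiffOn_regularFactor (n : ℕ) {r : ℝ} (hr : 0 < r) :
    ContDiffOn ℝ ∞ (regularFactor n r) (Set.Ioi 0) := by
  have h0 : ∀ y ∈ Set.Ioi (0 : ℝ), y ≠ 0 := fun y hy => (Set.mem_Ioi.1 hy).ne'
  refine ((contDiffOn_const.mul contDiffOn_id).inv fun y hy => mul_ne_zero hr.ne' (h0 y hy)).mul ?_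
  exact ContDiffOn.sum fun j _ => ContDiffOn.sum fun i _ =>
    (contDiffOn_const.div contDiffOn_id h0).pow i

/-- `1 + x + ⋯ + x^(k-1)`. -/
def geomSum (k : ℕ) (x : ℝ) : ℝ := ∑ i ∈ Finset.range k, x ^ i

theorem geomSum_mul (k : ℕ) (x : ℝ) : geomSum k x * (1 - x) = 1 - x ^ k := geom_sum_mul_neg x k

theorem geomSum_pos (k : ℕ) {x : ℝ} (hx : 0 < x) : 0 < geomSum (k + 1) x :=
  Finset.sum_pos (fun i _ => pow_pos hx i) ⟨0, by simp⟩

theorem contDiff_geomSum (k : ℕ) : ContDiff ℝ ∞ (geomSum k) :=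
  ContDiff.sum fun i _ => contDiff_id.pow i

/-- `b + ½ (ρ - ρ₀) b' = (κ - κ (ρ₀/ρ)^(n-1)) / (ρ - ρ₀)` for `b` the function `regularFactor`. -/
theorem regularFactor_add_deriv {m : ℕ} {r y : ℝ} (hr : 0 < r) (hy : r < y) :
    regularFactor (m + 3) r y + 1 / 2 * (y - r) * deriv (regularFactor (m + 3) r) y =
      (m + 1) / (2 * r) * geomSum (m + 2) (r / y) / y := by
  have hy0 : 0 < y := hr.trans hy
  have hyr : y - r ≠ 0 := (sub_pos.2 hy).ne'
  have hM : 0 < 1 / 2 * r ^ (m + 1) := by positivity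
  have key : ∀ w, r < w → regularFactor (m + 3) r w * (w - r) ^ 2 =
      (m + 1) * (w - r) / r - (1 - (r / w) ^ (m + 1)) := fun w hw => by
    have h1 := regularFactor_eq (n := m + 3) (by omega) hM (ρ := w)
      (by rwa [horizonRadius_half_pow hr])
    rw [horizonRadius_half_pow hr, potentialSq] at h1
    rw [h1]
    push_cast
    rw [div_pow]
    ring
  have hb := hasDerivAt_of_contDiffOn (contDiffOn_regularFactor (m + 3) hr) hy0
  have d1 := hb.mul (((hasDerivAt_id y).sub_const r).pow 2)
  have d2 := ((((hasDerivAt_id y).sub_const r).const_mul ((m : ℝ) + 1)).div_const r).sub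
    ((((hasDerivAt_const y r).div (hasDerivAt_id y) hy0.ne').pow (m + 1)).const_sub 1)
  -- Both sides of the identity defining b away from the horizon are differentiated.
  have d3 := d1.unique (d2.congr_of_eventuallyEq (by
    filter_upwards [Ioi_mem_nhds hy] with w hw using key w hw))
  simp only [Pi.pow_apply, Pi.div_apply, id, add_tsub_cancel_right] at d3
  push_cast at d3
  have hg := geomSum_mul (m + 2) (r / y)
  have hx : 1 - r / y = (y - r) / y := by field_simp
  rw [hx] at hg
  have hg' : geomSum (m + 2) (r / y) = (1 - (r / y) ^ (m + 2)) * y / (y - r) := by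
    rw [← hg]
    field_simp
  rw [hg']
  have hpow : (r / y) ^ (m + 2) = (r / y) ^ m * (r / y) ^ 2 := pow_add _ _ _
  rw [hpow]
  generalize (r / y) ^ m = t at *
  refine mul_left_cancel₀ (mul_ne_zero two_ne_zero hyr) ?_
  field_simp at d3 ⊢
  linear_combination d3

/-! ### The profile curve in the (X, Y)-plane -/

namespace RadialData

variable {m : ℕ} {a : ℝ} {α ρ v p q : ℝ → ℝ}

/-- A curve `(X, Y)` in the `(X, Y)`-plane of Schwarzschild spacetime with the geometry of the
data; `W` is the arclength derivative of `X`, and `r` the radius of the horizon. -/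
structure IsEmbedding (m : ℕ) (a r : ℝ) (α ρ v p q X Y W : ℝ → ℝ) : Prop where
  smooth_X : ContDiffOn ℝ ∞ X (Set.Ioi a)
  smooth_Y : ContDiffOn ℝ ∞ Y (Set.Ioi a)
  W_pos : ∀ z, 0 < W z
  X_pos : ∀ z, 1 < z → 0 < X z
  Y_pos : ∀ z, 1 < z → 0 < Y z
  mul_eq : ∀ z, 1 ≤ z → X z * Y z = ρ z - r
  deriv_X : ∀ z, 1 ≤ z → deriv X z = α z * W z
  isometric : ∀ z, 1 ≤ z → 2 * (2 * r / (m + 1)) * (deriv X z * deriv Y z) +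
    (2 * r / (m + 1)) ^ 2 * regularFactor (m + 3) r (ρ z) * Y z ^ 2 * deriv X z ^ 2 = α z ^ 2
  normal : ∀ z, 1 ≤ z →
    W z * Y z + X z * (deriv Y z / α z - (m + 1) / (2 * r) / W z) = ρ z * q z
  sff : ∀ z, 1 ≤ z →
    2 * r / (m + 1) * (W z * deriv (deriv Y) z +
      (deriv Y z / α z - (m + 1) / (2 * r) / W z) * deriv (deriv X) z) +
    (2 * r / (m + 1)) ^ 2 * regularFactor (m + 3) r (ρ z) * Y z ^ 2 *
      (W z * deriv (deriv X) z) +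
    deriv X z * W z * ((2 * r / (m + 1)) ^ 2 *
      (deriv (regularFactor (m + 3) r) (ρ z) * (deriv X z * Y z + X z * deriv Y z) * Y z ^ 2 +
        2 * regularFactor (m + 3) r (ρ z) * Y z * deriv Y z)) -
    1 / 2 * deriv X z ^ 2 * ((2 * r / (m + 1)) ^ 2 *
      (deriv (regularFactor (m + 3) r) (ρ z) * (W z * Y z + X z *
        (deriv Y z / α z - (m + 1) / (2 * r) / W z)) * Y z ^ 2 +
        2 * regularFactor (m + 3) r (ρ z) * Y z *
          (deriv Y z / α z - (m + 1) / (2 * r) / W z))) = -(α z ^ 2 * p z)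

/-- Put κ = (m+1)/(2r). The field ∂_Y is null, so unit tangent and unit normal can be taken with the
same X-component W, and they then differ by κ/W in Y. They must differentiate ρ = r + XY to v and ρq
respectively; subtracting gives X = (v - ρq)W/κ. Requiring dX/ds = W is then a linear equation for
log W. The relation XY = ρ - r gives Y. -/
theorem exists_isEmbedding (h : RadialData m a α ρ v p q)
    (hM : ∀ z, 1 ≤ z → misnerSharp m ρ v q z = 1 / 2 * ρ 1 ^ (m + 1)) :
    ∃ X Y W, IsEmbedding m a (ρ 1) α ρ v p q X Y W := by
  obtain ⟨r, hr⟩ : ∃ r, r = ρ 1 := ⟨_, rfl⟩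
  rw [← hr] at hM ⊢
  have hr0 : 0 < r := hr ▸ h.ρ_pos 1 h.lt_one
  have hm : (0 : ℝ) < m + 1 := by positivity
  obtain ⟨κ, hκ⟩ : ∃ κ : ℝ, κ = (m + 1) / (2 * r) := ⟨_, rfl⟩
  have hκ0 : 0 < κ := by rw [hκ]; positivity
  have hκi : 2 * r / (m + 1) = κ⁻¹ := by rw [hκ, inv_div]
  have hρ : ∀ z, a < z → 0 < ρ z := h.ρ_pos
  have hx : ContDiffOn ℝ ∞ (fun z => r / ρ z) (Set.Ioi a) :=
    contDiffOn_const.div h.smooth_ρ fun z hz => (hρ z hz).ne'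
  have hG : ∀ k, ContDiffOn ℝ ∞ (fun z => geomSum k (r / ρ z)) (Set.Ioi a) := fun k =>
    (contDiff_geomSum k).comp_contDiffOn hx
  have hG0 : ∀ k, ∀ z ∈ Set.Ioi a, geomSum (k + 1) (r / ρ z) ≠ 0 := fun k z hz =>
    (geomSum_pos k (div_pos hr0 (hρ z hz))).ne'
  have hmass : ∀ z, 1 ≤ z → 1 - v z ^ 2 + ρ z ^ 2 * q z ^ 2 = (r / ρ z) ^ (m + 1) := by
    intro z hz
    have h1 := hM z hz
    have h2 := hρ z (h.lt_one.trans_le hz)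
    rw [misnerSharp] at h1
    rw [div_pow, eq_div_iff (by positivity)]
    linarith
  -- f and F are the expansions Θ₋ and Θ₊ times ρ/(n-1). Constancy of the mass makes their product
  -- the Schwarzschild potential φ².
  set f : ℝ → ℝ := fun z => v z - ρ z * q z with hf
  set F : ℝ → ℝ := fun z => v z + ρ z * q z with hF
  have hfs : ContDiffOn ℝ ∞ f (Set.Ioi a) := h.smooth_v.sub (h.smooth_ρ.mul h.smooth_q)
  have hFs : ContDiffOn ℝ ∞ F (Set.Ioi a) := h.smooth_v.add (h.smooth_ρ.mul h.smooth_q)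
  have hfF : ∀ z, 1 ≤ z → f z * F z = 1 - (r / ρ z) ^ (m + 1) := fun z hz => by
    rw [← hmass z hz]
    simp only [hf, hF]
    ring
  have hf0 : ∀ z, 1 < z → 0 < f z := fun z hz => by
    have h1 := h.untrapped z hz
    have h2 := mul_le_mul_of_nonneg_left (le_abs_self (q z)) (hρ z (h.lt_one.trans hz)).le
    simp only [hf]
    linarith
  have hF0 : ∀ z, 1 < z → 0 < F z := fun z hz => by
    have h1 := h.untrapped z hz
    have h2 := mul_le_mul_of_nonneg_left (neg_abs_le (q z)) (hρ z (h.lt_one.trans hz)).le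
    simp only [hF]
    linarith
  have hfd : ∀ z, 1 < z → HasDerivAt f (α z * (κ * (r / ρ z) ^ (m + 2) - p z * f z)) z := by
    intro z hz
    have hza := h.lt_one.trans hz
    obtain ⟨hE, hJ⟩ := h.vacuum hM hz
    have hα := h.α_pos z hza
    have hρz := hρ z hza
    have dv := hasDerivAt_of_contDiffOn h.smooth_v hza
    have dq := hasDerivAt_of_contDiffOn h.smooth_q hza
    refine (dv.sub ((h.hasDerivAt_ρ hza).mul dq)).congr_deriv ?_
    have hm2 : (m : ℝ) + 2 ≠ 0 := by positivity
    have e1 : ρ z * deriv q z = α z * v z * (p z - q z) := by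
      rw [radMomentum] at hJ
      field_simp at hJ
      refine mul_left_cancel₀ hm2 ?_
      linear_combination -hJ / 2
    have e2 : deriv v z = α z * ((m + 1) * (1 - v z ^ 2 + ρ z ^ 2 * q z ^ 2) / (2 * ρ z) +
        ρ z * p z * q z) := by
      rw [radEnergy, radScalar] at hE
      field_simp at hE ⊢
      refine mul_left_cancel₀ hm2 ?_
      linear_combination -hE
    rw [hmass z hz.le] at e2
    rw [e2, pow_succ (r / ρ z) (m + 1), hκ]
    simp only [hf]
    generalize (r / ρ z) ^ (m + 1) = t
    field_simp
    linear_combination -2 * ρ z * e1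
  -- The condition dX/ds = W reads d(log W)/ds = p + κ(1 - (r/ρ)^(m+2))/f. Factoring 1 - r/ρ out of
  -- fF = 1 - (r/ρ)^(m+1) rewrites the quotient without f in the denominator, so log W is smooth
  -- across the horizon. The constant of integration is a time translation.
  obtain ⟨P, -, hPs, hPd⟩ := exists_primitive h.lt_one
    (f := fun z => α z * (p z + F z * (κ * geomSum (m + 2) (r / ρ z) / geomSum (m + 1) (r / ρ z))))
    (h.smooth_α.mul (h.smooth_p.add (hFs.mul
      ((contDiffOn_const.mul (hG (m + 2))).div (hG (m + 1)) (hG0 m)))))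
  set W : ℝ → ℝ := fun z => Real.exp (P z) with hW
  have hW0 : ∀ z, 0 < W z := fun z => Real.exp_pos _
  have hWs : ContDiffOn ℝ ∞ W (Set.Ioi a) := Real.contDiff_exp.comp_contDiffOn hPs
  have hWd : ∀ z, a < z → HasDerivAt W (α z * W z * (p z + F z *
      (κ * geomSum (m + 2) (r / ρ z) / geomSum (m + 1) (r / ρ z)))) z := fun z hz =>
    ((hPd z hz).exp).congr_deriv (by simp only [hW]; ring)
  set X : ℝ → ℝ := fun z => f z * W z / κ with hX
  -- This is (ρ - r)/X with the factor f cancelled, hence regular where f = 0.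
  set Y : ℝ → ℝ := fun z => κ * F z * ρ z / (geomSum (m + 1) (r / ρ z) * W z) with hY
  have hXs : ContDiffOn ℝ ∞ X (Set.Ioi a) := (hfs.mul hWs).div_const κ
  have hYs : ContDiffOn ℝ ∞ Y (Set.Ioi a) :=
    ((contDiffOn_const.mul hFs).mul h.smooth_ρ).div ((hG (m + 1)).mul hWs)
      fun z hz => mul_ne_zero (hG0 m z hz) (hW0 z).ne'
  have hXp : ∀ z, 1 < z → 0 < X z := fun z hz => div_pos (mul_pos (hf0 z hz) (hW0 z)) hκ0
  have hXY : ∀ z, 1 ≤ z → X z * Y z = ρ z - r := by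
    intro z hz
    have hza := h.lt_one.trans_le hz
    have hρz := (hρ z hza).ne'
    have h1 := geomSum_mul (m + 1) (r / ρ z)
    rw [← hfF z hz] at h1
    have hWz := (hW0 z).ne'
    have hGz := hG0 m z hza
    simp only [hX, hY]
    have h2 : f z * W z / κ * (κ * F z * ρ z / (geomSum (m + 1) (r / ρ z) * W z)) =
        f z * F z * ρ z / geomSum (m + 1) (r / ρ z) := by
      field_simp
    rw [h2, ← h1]
    field_simp
  have hXd : ∀ z, 1 ≤ z → deriv X z = α z * W z := by
    intro z hz
    refine eq_of_eq_Ioi_one h.lt_one (contDiffOn_deriv hXs).continuousOn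
      (h.smooth_α.mul hWs).continuousOn (fun z hz => ?_) hz
    have hza := h.lt_one.trans hz
    have hρz := (hρ z hza).ne'
    have hGz := hG0 m z hza
    have d := (((hfd z hz).mul (hWd z hza)).div_const κ).deriv
    refine Eq.trans d ?_
    have h1 := geomSum_mul (m + 1) (r / ρ z)
    have h2 := geomSum_mul (m + 2) (r / ρ z)
    rw [← hfF z hz.le] at h1
    have h3 : f z * F z * (geomSum (m + 2) (r / ρ z) / geomSum (m + 1) (r / ρ z)) =
        1 - (r / ρ z) ^ (m + 2) := by
      rw [← h1, ← h2]
      field_simp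
    rw [div_eq_iff hκ0.ne']
    linear_combination α z * W z * κ * h3
  have hXYd : ∀ z, 1 ≤ z → deriv X z * Y z + X z * deriv Y z = α z * v z := by
    intro z hz
    refine eq_of_eq_Ioi_one h.lt_one (((contDiffOn_deriv hXs).mul hYs).add
      (hXs.mul (contDiffOn_deriv hYs))).continuousOn
      (h.smooth_α.mul h.smooth_v).continuousOn (fun z hz => ?_) hz
    have hza := h.lt_one.trans hz
    refine ((hasDerivAt_of_contDiffOn hXs hza).mul (hasDerivAt_of_contDiffOn hYs hza)).unique
      (((h.hasDerivAt_ρ hza).sub_const r).congr_of_eventuallyEq ?_)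
    filter_upwards [Ioi_mem_nhds hz] with y hy using hXY y (Set.mem_Ioi.1 hy).le
  have hbs : ContDiffOn ℝ ∞ (fun z => regularFactor (m + 3) r (ρ z)) (Set.Ioi a) :=
    (contDiffOn_regularFactor (m + 3) hr0).comp h.smooth_ρ hρ
  have hbs' : ContDiffOn ℝ ∞ (fun z => deriv (regularFactor (m + 3) r) (ρ z)) (Set.Ioi a) :=
    (contDiffOn_deriv (contDiffOn_regularFactor (m + 3) hr0)).comp h.smooth_ρ hρ
  have hYd : ∀ z, 1 < z → Y z = (ρ z - r) / X z ∧ deriv Y z = (α z * v z - α z * W z * Y z) / X z := by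
    intro z hz
    have hXz := (hXp z hz).ne'
    constructor
    · rw [← hXY z hz.le]
      field_simp
    · rw [← hXYd z hz.le, hXd z hz.le]
      field_simp
      ring
  have hiso : ∀ z, 1 ≤ z → 2 * κ⁻¹ * (deriv X z * deriv Y z) +
      κ⁻¹ ^ 2 * regularFactor (m + 3) r (ρ z) * Y z ^ 2 * deriv X z ^ 2 = α z ^ 2 := by
    intro z hz
    refine eq_of_eq_Ioi_one h.lt_one ((contDiffOn_const.mul ((contDiffOn_deriv hXs).mul
      (contDiffOn_deriv hYs))).add (((contDiffOn_const.mul hbs).mul (hYs.pow 2)).mul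
      ((contDiffOn_deriv hXs).pow 2))).continuousOn (h.smooth_α.pow 2).continuousOn
      (fun z hz => ?_) hz
    obtain ⟨hY1, hY2⟩ := hYd z hz
    have hρr : r < ρ z := by
      have h1 := hXY z hz.le
      have h2 : 0 < Y z := by
        have := hF0 z hz
        have := hρ z (h.lt_one.trans hz)
        have := geomSum_pos m (div_pos hr0 this)
        have := hW0 z
        simp only [hY]
        positivity
      nlinarith [mul_pos (hXp z hz) h2]
    have hreg := regularFactor_eq (n := m + 3) (by omega) (m := 1 / 2 * r ^ (m + 1))
      (by positivity) (ρ := ρ z) (by rwa [horizonRadius_half_pow hr0])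
    rw [horizonRadius_half_pow hr0, potentialSq, show m + 3 - 2 = m + 1 by omega] at hreg
    have hpot : 1 - 2 * (1 / 2 * r ^ (m + 1)) / ρ z ^ (m + 1) = f z * F z := by
      rw [hfF z hz.le, div_pow]
      ring
    rw [hpot] at hreg
    push_cast at hreg
    have hreg' : regularFactor (m + 3) r (ρ z) * (ρ z - r) ^ 2 =
        2 * κ * (ρ z - r) - f z * F z := by
      rw [hreg, hκ]
      field_simp
      ring
    rw [hY2, hY1, hXd z hz.le]
    simp only [hX]
    have hfz := (hf0 z hz).ne'
    have hWz := (hW0 z).ne'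
    have hvf : v z = (f z + F z) / 2 := by simp only [hf, hF]; ring
    rw [hvf]
    generalize regularFactor (m + 3) r (ρ z) = b at *
    generalize f z = f' at *
    generalize F z = F' at *
    field_simp
    linear_combination α z ^ 2 * hreg'
  refine ⟨X, Y, W, hXs, hYs, hW0, hXp, fun z hz => ?_, hXY, hXd, ?_, fun z hz => ?_,
    fun z hz => ?_⟩
  · have := hF0 z hz
    have hρz := hρ z (h.lt_one.trans hz)
    have := geomSum_pos m (div_pos hr0 hρz)
    have := hW0 z
    simp only [hY]
    positivity
  · rw [hκi]
    exact hiso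
  · have h1 := hXYd z hz
    have hα := (h.α_pos z (h.lt_one.trans_le hz)).ne'
    rw [hXd z hz] at h1
    rw [← hκ]
    -- The normal derivative of ρ is the tangential derivative v minus Xκ/W = f, that is ρq.
    have h2 : X z * (κ / W z) = f z := by
      have := (hW0 z).ne'
      simp only [hX]
      field_simp
    have h3 : W z * Y z + X z * (deriv Y z / α z) = v z := by
      field_simp
      linear_combination h1
    rw [mul_sub, ← add_sub_assoc, h3, h2]
    simp only [hf]
    ring
  · rw [hκi, ← hκ]
    have hX1 := contDiffOn_deriv hXs
    have hY1 := contDiffOn_deriv hYs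
    have hX2 := contDiffOn_deriv hX1
    have hY2 := contDiffOn_deriv hY1
    have hyν : ContDiffOn ℝ ∞ (fun z => deriv Y z / α z - κ / W z) (Set.Ioi a) :=
      (hY1.div h.smooth_α fun z hz => (h.α_pos z hz).ne').sub
        (contDiffOn_const.div hWs fun z _ => (hW0 z).ne')
    refine eq_of_eq_Ioi_one h.lt_one (((((contDiffOn_const.mul ((hWs.mul hY2).add
      (hyν.mul hX2))).add (((contDiffOn_const.mul hbs).mul (hYs.pow 2)).mul (hWs.mul hX2))).add
      ((hX1.mul hWs).mul (contDiffOn_const.mul (((hbs'.mul ((hX1.mul hYs).add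
        (hXs.mul hY1))).mul (hYs.pow 2)).add (((contDiffOn_const.mul hbs).mul hYs).mul hY1))))).sub
      ((contDiffOn_const.mul (hX1.pow 2)).mul (contDiffOn_const.mul (((hbs'.mul ((hWs.mul hYs).add
        (hXs.mul hyν))).mul (hYs.pow 2)).add
          (((contDiffOn_const.mul hbs).mul hYs).mul hyν)))))).continuousOn
      ((h.smooth_α.pow 2).mul h.smooth_p).neg.continuousOn (fun z hz => ?_) hz
    have hza := h.lt_one.trans hz
    have hα := (h.α_pos z hza).ne'
    have hWz := (hW0 z).ne'
    have dα := hasDerivAt_of_contDiffOn h.smooth_α hza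
    have eX2 : deriv (deriv X) z = _ :=
      ((dα.mul (hWd z hza)).congr_of_eventuallyEq (by
        filter_upwards [Ioi_mem_nhds hz] with y hy using hXd y (Set.mem_Ioi.1 hy).le)).deriv
    have hρr : r < ρ z := by
      have h1 := hXY z hz.le
      have h2 : 0 < Y z := by
        have := hF0 z hz
        have := hρ z hza
        have := geomSum_pos m (div_pos hr0 this)
        have := hW0 z
        simp only [hY]
        positivity
      nlinarith [mul_pos (hXp z hz) h2]
    have db : HasDerivAt (fun z => regularFactor (m + 3) r (ρ z))
        (deriv (regularFactor (m + 3) r) (ρ z) * (α z * v z)) z :=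
      (hasDerivAt_of_contDiffOn (contDiffOn_regularFactor (m + 3) hr0) (hρ z hza)).comp z
        (h.hasDerivAt_ρ hza)
    have dX1 := hasDerivAt_of_contDiffOn hX1 hza
    have dY1 := hasDerivAt_of_contDiffOn hY1 hza
    have dY := hasDerivAt_of_contDiffOn hYs hza
    -- The derivative of the unit-speed relation eliminates the second derivative of Y. What is left
    -- is the equation for W.
    have diso := (((dX1.mul dY1).const_mul (2 * κ⁻¹)).add
      (((db.const_mul (κ⁻¹ ^ 2)).mul (dY.pow 2)).mul (dX1.pow 2))).unique
      ((dα.pow 2).congr_of_eventuallyEq (by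
        filter_upwards [Ioi_mem_nhds hz] with y hy using hiso y (Set.mem_Ioi.1 hy).le))
    simp only [Pi.pow_apply, Pi.mul_apply, Nat.cast_ofNat, Nat.add_one_sub_one, pow_one] at diso
    have hreg := regularFactor_add_deriv (m := m) hr0 hρr
    rw [← hκ] at hreg
    have hGz := hG0 m z hza
    have hρz := (hρ z hza).ne'
    -- The non-p term in d(log W)/ds is the connection coefficient of the (X, Y)-plane along the
    -- curve, by `regularFactor_add_deriv`.
    have hWY : W z * Y z * (regularFactor (m + 3) r (ρ z) + 1 / 2 * (ρ z - r) *
        deriv (regularFactor (m + 3) r) (ρ z)) =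
        κ * (F z * (κ * geomSum (m + 2) (r / ρ z) / geomSum (m + 1) (r / ρ z))) := by
      rw [hreg]
      simp only [hY]
      field_simp
    rw [← hXY z hz.le] at hWY
    have hXYz := hXYd z hz.le
    rw [hXd z hz.le] at diso hXYz ⊢
    rw [eX2] at diso ⊢
    generalize F z * (κ * geomSum (m + 2) (r / ρ z) / geomSum (m + 1) (r / ρ z)) = FQ at *
    generalize regularFactor (m + 3) r (ρ z) = b at *
    generalize deriv (regularFactor (m + 3) r) (ρ z) = b1 at *
    generalize deriv (deriv Y) z = Y2 at *
    generalize hy : deriv Y z = Y1 at *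
    generalize deriv α z = α1 at *
    rw [← hXYz] at diso
    generalize W z = w at *
    generalize X z = x at *
    generalize Y z = y at *
    generalize α z = A at *
    generalize p z = pz at *
    -- Passing to arclength derivatives and naming κ/W and κ⁻¹ makes the remaining identity
    -- polynomial.
    obtain ⟨y1, rfl⟩ : ∃ y1, Y1 = A * y1 := ⟨Y1 / A, by field_simp⟩
    obtain ⟨s, hs⟩ : ∃ s, s = κ / w := ⟨_, rfl⟩
    have hsw : s * w = κ := by rw [hs]; field_simp
    obtain ⟨c, hc⟩ : ∃ c, c = κ⁻¹ := ⟨_, rfl⟩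
    have hcκ : c * κ = 1 := by rw [hc]; field_simp
    rw [mul_div_cancel_left₀ _ hα, ← hs, ← hc]
    rw [← hc] at diso
    have diso' : c * ((α1 * w + A * (A * w * (pz + FQ))) * y1 + w * Y2) +
        1 / 2 * A * w ^ 2 * c ^ 2 * (b1 * (A * w * y + x * (A * y1)) * y ^ 2 +
          2 * b * y * (A * y1)) +
        c ^ 2 * b * y ^ 2 * w * (α1 * w + A * (A * w * (pz + FQ))) = α1 := by
      refine mul_left_cancel₀ (mul_ne_zero two_ne_zero hα) ?_
      linear_combination diso
    linear_combination diso' + A ^ 2 * c * hWY +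
      (-c * (α1 + A ^ 2 * (pz + FQ)) +
        1 / 2 * A ^ 2 * w * c ^ 2 * (b1 * x * y ^ 2 + 2 * b * y)) * hsw +
      (-(α1 + A ^ 2 * (pz + FQ)) + 1 / 2 * A ^ 2 * w * c * (b1 * x * y ^ 2 + 2 * b * y) +
        A ^ 2 * FQ) * hcκ

end RadialData

end Penrose

namespace Penrose

/-! ### The Schwarzschild metric in the coordinates `(X, Y, θ)` -/

section Metric

variable {m : ℕ} {M r : ℝ}

theorem schwarzschildMetric_eq (hr : horizonRadius (m + 3) M = r) (q u v : Ambient (m + 3)) :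
    schwarzschildMetric M q u v = 2 * r / (m + 1) * (u.1 * v.2.1 + u.2.1 * v.1) +
      (2 * r / (m + 1)) ^ 2 * regularFactor (m + 3) r (r + q.1 * q.2.1) * q.2.1 ^ 2 *
        (u.1 * v.1) + (r + q.1 * q.2.1) ^ 2 * inner ℝ u.2.2 v.2.2 := by
  have h : ((m + 3 : ℕ) : ℝ) - 2 = m + 1 := by push_cast; ring
  rw [schwarzschildMetric, areaRadius, hr, h]

theorem fderiv_schwarzschildMetric (hr : horizonRadius (m + 3) M = r) (hr0 : 0 < r)
    {q : Ambient (m + 3)} (hq : 0 < r + q.1 * q.2.1) (A B C : Ambient (m + 3)) :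
    fderiv ℝ (fun p => schwarzschildMetric M p B C) q A =
      (2 * r / (m + 1)) ^ 2 *
        (deriv (regularFactor (m + 3) r) (r + q.1 * q.2.1) *
          (A.1 * q.2.1 + q.1 * A.2.1) * q.2.1 ^ 2 +
          2 * regularFactor (m + 3) r (r + q.1 * q.2.1) * q.2.1 * A.2.1) * (B.1 * C.1) +
      2 * (r + q.1 * q.2.1) * (A.1 * q.2.1 + q.1 * A.2.1) * inner ℝ B.2.2 C.2.2 := by
  have d1 : HasFDerivAt (fun q : Ambient (m + 3) => q.1)
      (ContinuousLinearMap.fst ℝ ℝ (ℝ × Eucl (m + 3))) q := hasFDerivAt_fst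
  have d2 : HasFDerivAt (fun q : Ambient (m + 3) => q.2.1)
      ((ContinuousLinearMap.fst ℝ ℝ (Eucl (m + 3))).comp
        (ContinuousLinearMap.snd ℝ ℝ (ℝ × Eucl (m + 3)))) q :=
    ((ContinuousLinearMap.fst ℝ ℝ (Eucl (m + 3))).comp
        (ContinuousLinearMap.snd ℝ ℝ (ℝ × Eucl (m + 3)))).hasFDerivAt
  have dρ := (d1.mul d2).const_add r
  have db := (hasDerivAt_of_contDiffOn (contDiffOn_regularFactor (m + 3) hr0)
    (z := r + q.1 * q.2.1) hq).comp_hasFDerivAt q dρ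
  have d := (((db.const_mul ((2 * r / (m + 1)) ^ 2)).mul (d2.pow 2)).mul_const (B.1 * C.1)).add
    ((dρ.pow 2).mul_const (inner ℝ B.2.2 C.2.2))
  have d' := (d.const_add (2 * r / (m + 1) * (B.1 * C.2.1 + B.2.1 * C.1))).congr_of_eventuallyEq
    (f₁ := fun p => schwarzschildMetric M p B C) (Filter.Eventually.of_forall fun p => by
      simp only [schwarzschildMetric_eq hr, Function.comp_apply, Pi.add_apply, Pi.mul_apply]
      ring)
  rw [d'.fderiv]
  simp only [add_apply, smul_apply, ContinuousLinearMap.comp_apply,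
    ContinuousLinearMap.coe_fst', ContinuousLinearMap.coe_snd', smul_eq_mul, Function.comp_apply]
  simp
  ring

end Metric

/-! ### The embedding -/

section Map

variable {n : ℕ} {a : ℝ} {X Y : ℝ → ℝ} {x : Eucl n}

/-- The rotationally symmetric map into Schwarzschild spacetime with profile curve `(X, Y)`. -/
def profileMap (X Y : ℝ → ℝ) (x : Eucl n) : Ambient n :=
  (X (‖x‖ ^ 2), Y (‖x‖ ^ 2), (√(‖x‖ ^ 2))⁻¹ • x)

theorem contDiffOn_profileMap (ha : 0 < a) (hX : ContDiffOn ℝ ∞ X (Set.Ioi a))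
    (hY : ContDiffOn ℝ ∞ Y (Set.Ioi a)) :
    ContDiffOn ℝ ∞ (profileMap (n := n) X Y) {x | a < ‖x‖ ^ 2} := by
  have hw : ContDiffOn ℝ ∞ (fun x : Eucl n => ‖x‖ ^ 2) {x | a < ‖x‖ ^ 2} :=
    (contDiff_norm_sq ℝ).contDiffOn
  have hE : ContDiffOn ℝ ∞ (fun z : ℝ => (√z)⁻¹) (Set.Ioi a) :=
    (contDiffOn_id.sqrt fun z hz => (ha.trans hz).ne').inv fun z hz =>
      (Real.sqrt_pos.2 (ha.trans hz)).ne'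
  exact (hX.comp hw fun x hx => hx).prodMk ((hY.comp hw fun x hx => hx).prodMk
    ((hE.comp hw fun x hx => hx).smul contDiffOn_id))

theorem isOpen_normSq_gt : IsOpen {x : Eucl n | a < ‖x‖ ^ 2} :=
  isOpen_lt continuous_const (by fun_prop)

theorem fderiv_profileMap (ha : 0 < a) (hX : ContDiffOn ℝ ∞ X (Set.Ioi a))
    (hY : ContDiffOn ℝ ∞ Y (Set.Ioi a)) (hx : a < ‖x‖ ^ 2) (u : Eucl n) :
    fderiv ℝ (profileMap X Y) x u =
      (2 * deriv X (‖x‖ ^ 2) * inner ℝ x u, 2 * deriv Y (‖x‖ ^ 2) * inner ℝ x u,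
        ‖x‖⁻¹ • u - (‖x‖⁻¹ / ‖x‖ ^ 2 * inner ℝ x u) • x) := by
  have dw := (hasStrictFDerivAt_norm_sq x).hasFDerivAt
  have hz0 : 0 < ‖x‖ ^ 2 := ha.trans hx
  have hsq : √(‖x‖ ^ 2) = ‖x‖ := Real.sqrt_sq (norm_nonneg x)
  have hx0 : ‖x‖ ≠ 0 := fun h => by rw [h] at hz0; norm_num at hz0
  have dX := (hasDerivAt_of_contDiffOn hX hx).comp_hasFDerivAt x dw
  have dY := (hasDerivAt_of_contDiffOn hY hx).comp_hasFDerivAt x dw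
  have dE := (((hasDerivAt_id (‖x‖ ^ 2)).sqrt hz0.ne').inv
    (Real.sqrt_pos.2 hz0).ne').comp_hasFDerivAt x dw
  have d := dX.prodMk (dY.prodMk (dE.smul (hasFDerivAt_id x)))
  have d' := d.congr_of_eventuallyEq (f₁ := profileMap X Y)
    (Filter.Eventually.of_forall fun y => rfl)
  rw [d'.fderiv]
  ext i
  · simp
    ring
  · simp
    ring
  · simp [hsq]
    field_simp
    ring

theorem hasFDerivAt_radial_inner {F : ℝ → ℝ} (hF : ContDiffOn ℝ ∞ F (Set.Ioi a))
    (hx : a < ‖x‖ ^ 2) (v u : Eucl n) :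
    ∃ L : Eucl n →L[ℝ] ℝ, HasFDerivAt (fun y : Eucl n => 2 * F (‖y‖ ^ 2) * inner ℝ y v) L x ∧
      L u = 4 * deriv F (‖x‖ ^ 2) * inner ℝ x u * inner ℝ x v +
        2 * F (‖x‖ ^ 2) * inner ℝ u v := by
  have dw := (hasStrictFDerivAt_norm_sq x).hasFDerivAt
  have dF := ((hasDerivAt_of_contDiffOn hF hx).comp_hasFDerivAt x dw).const_mul 2
  have di : HasFDerivAt (fun y : Eucl n => inner ℝ y v) (innerSL ℝ v) x := by
    refine (innerSL ℝ v).hasFDerivAt.congr_of_eventuallyEq (Filter.Eventually.of_forall fun y => ?_)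
    simp [real_inner_comm]
  refine ⟨_, dF.mul di, ?_⟩
  simp [real_inner_comm]
  ring

/-- The normal has no angular component, so the second fundamental form needs only the X and Y
components of the second derivative. -/
theorem fderiv_fderiv_profileMap (ha : 0 < a) (hX : ContDiffOn ℝ ∞ X (Set.Ioi a))
    (hY : ContDiffOn ℝ ∞ Y (Set.Ioi a)) (hx : a < ‖x‖ ^ 2) (u v : Eucl n) :
    (fderiv ℝ (fun y => fderiv ℝ (profileMap X Y) y v) x u).1 =
      4 * deriv (deriv X) (‖x‖ ^ 2) * inner ℝ x u * inner ℝ x v +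
        2 * deriv X (‖x‖ ^ 2) * inner ℝ u v ∧
    (fderiv ℝ (fun y => fderiv ℝ (profileMap X Y) y v) x u).2.1 =
      4 * deriv (deriv Y) (‖x‖ ^ 2) * inner ℝ x u * inner ℝ x v +
        2 * deriv Y (‖x‖ ^ 2) * inner ℝ u v := by
  have hmem := isOpen_normSq_gt.mem_nhds hx
  have hs : ContDiffAt ℝ ∞ (profileMap X Y) x :=
    (contDiffOn_profileMap ha hX hY).contDiffAt hmem
  have hd : DifferentiableAt ℝ (fun y => fderiv ℝ (profileMap X Y) y v) x :=
    ((hs.fderiv_right (m := 1) (by norm_cast)).differentiableAt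
      one_ne_zero).clm_apply (differentiableAt_const v)
  constructor
  · obtain ⟨L, hL, hLu⟩ := hasFDerivAt_radial_inner (contDiffOn_deriv hX) hx v u
    rw [← hLu]
    have h1 := hd.hasFDerivAt.fst
    have h2 := h1.unique (hL.congr_of_eventuallyEq (by
      filter_upwards [hmem] with y hy
      rw [fderiv_profileMap ha hX hY hy]))
    rw [← h2]
    rfl
  · obtain ⟨L, hL, hLu⟩ := hasFDerivAt_radial_inner (contDiffOn_deriv hY) hx v u
    rw [← hLu]
    have h1 := hd.hasFDerivAt.snd.fst
    have h2 := h1.unique (hL.congr_of_eventuallyEq (by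
      filter_upwards [hmem] with y hy
      rw [fderiv_profileMap ha hX hY hy]))
    rw [← h2]
    rfl

/-- The pair (X, θ) already embeds: polar coordinates are an embedding, and a strictly increasing
continuous function on an interval is one. The Y-component can be forgotten. -/
theorem isEmbedding_profileMap (hXc : ContinuousOn X (Set.Ici 1)) (hYc : ContinuousOn Y (Set.Ici 1))
    (hX : StrictMonoOn X (Set.Ici 1)) :
    Topology.IsEmbedding ((exteriorDomain n).domRestrict (profileMap X Y)) := by
  have hX' : StrictMono ((Set.Ici (1 : ℝ)).domRestrict X) := fun y z h => hX y.2 z.2 h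
  have hXc' : Continuous ((Set.Ici (1 : ℝ)).domRestrict X) := hXc.domRestrict
  have hXe : Topology.IsEmbedding ((Set.Ici (1 : ℝ)).domRestrict X) := by
    have : PreconnectedSpace (Set.Ici (1 : ℝ)) := Subtype.preconnectedSpace isPreconnected_Ici
    exact hX'.isEmbedding_of_ordConnected (isPreconnected_range hXc').ordConnected
  have hne : ∀ x : exteriorDomain n, √(‖(x : Eucl n)‖ ^ 2) ≠ 0 := fun x => by
    have : (1 : ℝ) ≤ ‖(x : Eucl n)‖ := x.2
    rw [Real.sqrt_sq (norm_nonneg _)]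
    linarith
  have hθ : Continuous fun x : exteriorDomain n => (√(‖(x : Eucl n)‖ ^ 2))⁻¹ • (x : Eucl n) :=
    (Continuous.inv₀ (by fun_prop) hne).smul continuous_subtype_val
  have hw : Continuous fun x : exteriorDomain n =>
      (⟨‖(x : Eucl n)‖ ^ 2, one_le_norm_sq x.2⟩ : Set.Ici (1 : ℝ)) :=
    Continuous.subtype_mk (by fun_prop) _
  set i : exteriorDomain n → Set.Ici (1 : ℝ) × Eucl n := fun x =>
    (⟨‖(x : Eucl n)‖ ^ 2, one_le_norm_sq x.2⟩, (√(‖(x : Eucl n)‖ ^ 2))⁻¹ • (x : Eucl n)) with hi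
  have hic : Continuous i := hw.prodMk hθ
  have hie : Topology.IsEmbedding i := by
    refine Topology.IsEmbedding.of_comp (g := fun y : Set.Ici (1 : ℝ) × Eucl n =>
      √(y.1 : ℝ) • y.2) hic (by fun_prop) ?_
    have : (fun y : Set.Ici (1 : ℝ) × Eucl n => √(y.1 : ℝ) • y.2) ∘ i = Subtype.val := by
      funext x
      simp only [hi, Function.comp_apply, smul_smul]
      rw [mul_inv_cancel₀ (hne x), one_smul]
    rw [this]
    exact Topology.IsEmbedding.subtypeVal
  refine Topology.IsEmbedding.of_comp (g := fun q : Ambient n => (q.1, q.2.2)) ?_ (by fun_prop)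
    ((hXe.prodMap Topology.IsEmbedding.id).comp hie)
  have hY' : Continuous ((Set.Ici (1 : ℝ)).domRestrict Y) := hYc.domRestrict
  exact (hXc'.comp hw).prodMk ((hY'.comp hw).prodMk hθ)

end Map

/-! ### The tensor equations of the embedding -/

section Embedding

variable {m : ℕ} {a r M : ℝ} {β η γ ζ X Y W : ℝ → ℝ}

theorem inner_angular {n : ℕ} {x : Eucl n} (hx : ‖x‖ ≠ 0) (u v : Eucl n) :
    inner ℝ (‖x‖⁻¹ • u - (‖x‖⁻¹ / ‖x‖ ^ 2 * inner ℝ x u) • x)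
      (‖x‖⁻¹ • v - (‖x‖⁻¹ / ‖x‖ ^ 2 * inner ℝ x v) • x) =
      (inner ℝ u v - inner ℝ x u * inner ℝ x v / ‖x‖ ^ 2) / ‖x‖ ^ 2 := by
  simp only [inner_sub_left, inner_sub_right, real_inner_smul_left, real_inner_smul_right,
    real_inner_self_eq_norm_sq, real_inner_comm x u]
  rw [real_inner_comm u x]
  field_simp
  ring

/-- Metric and second fundamental form split into radial and angular parts. The radial parts are the
curve equations in `RadialData.IsEmbedding`. The angular parts are ρ² and ρν(ρ) times the round
metric, the latter being ρ²q by the field `normal`. -/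
theorem isSchwarzschildEmbedding_profileMap {D : InitialData (m + 3)} (hg : HasProfile D.g a β η)
    (hp : PosProfile a β η) (hk : HasProfile D.k a γ ζ) (hr : horizonRadius (m + 3) M = r)
    (hr0 : 0 < r) (hr1 : radius β 1 = r)
    (h : RadialData.IsEmbedding m a r (arcDensity β η) (radius β) (slope β η) (radEig β η γ ζ)
      (tangEig β γ) X Y W) :
    IsSchwarzschildEmbedding M D (profileMap X Y) := by
  have ha : ∀ x ∈ exteriorDomain (m + 3), a < ‖x‖ ^ 2 := fun x hx =>
    hp.lt_one.trans_le (one_le_norm_sq hx)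
  have hrad : ∀ x ∈ exteriorDomain (m + 3),
      r + X (‖x‖ ^ 2) * Y (‖x‖ ^ 2) = radius β (‖x‖ ^ 2) := fun x hx => by
    rw [h.mul_eq _ (one_le_norm_sq hx)]
    ring
  have hnorm : ∀ x ∈ exteriorDomain (m + 3), ‖(√(‖x‖ ^ 2))⁻¹ • x‖ = 1 := fun x hx => by
    have : 1 ≤ ‖x‖ := hx
    rw [Real.sqrt_sq (norm_nonneg x), norm_smul, norm_inv, norm_norm, inv_mul_cancel₀ (by linarith)]
  have hsub : Set.Ici 1 ⊆ Set.Ioi a := fun z hz => hp.lt_one.trans_le hz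
  have hm : (m : ℝ) + 1 ≠ 0 := by positivity
  have hcoef : 2 * r / ((m : ℝ) + 1) * ((m + 1) / (2 * r)) = 1 := by field_simp
  refine ⟨⟨_, isOpen_normSq_gt, fun x hx => ha x hx,
    contDiffOn_profileMap hp.nonneg h.smooth_X h.smooth_Y⟩, fun x hx => ⟨?_, hnorm x hx⟩, ?_,
    fun x hx u v => ?_, fun x hx => ?_, fun x hx => ?_, fun x hx => ?_⟩
  · change 0 < horizonRadius (m + 3) M + X (‖x‖ ^ 2) * Y (‖x‖ ^ 2)
    rw [hr, hrad x hx]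
    exact hp.radius_pos (ha x hx)
  · refine isEmbedding_profileMap (h.smooth_X.continuousOn.mono hsub)
      (h.smooth_Y.continuousOn.mono hsub) ?_
    refine strictMonoOn_of_deriv_pos (convex_Ici 1) (h.smooth_X.continuousOn.mono hsub) ?_
    rw [interior_Ici]
    intro z hz
    rw [h.deriv_X z (Set.mem_Ioi.1 hz).le]
    exact mul_pos (hp.arcDensity_pos (hp.lt_one.trans hz)) (h.W_pos z)
  · have hz := ha x hx
    have hx0 : ‖x‖ ≠ 0 := by
      have : 1 ≤ ‖x‖ := hx
      linarith
    have hz0 : ‖x‖ ^ 2 ≠ 0 := pow_ne_zero 2 hx0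
    rw [schwarzschildMetric_eq hr, fderiv_profileMap hp.nonneg h.smooth_X h.smooth_Y hz,
      fderiv_profileMap hp.nonneg h.smooth_X h.smooth_Y hz]
    simp only [profileMap]
    rw [inner_angular hx0, hrad x hx, hg.apply_eq x hx]
    have h1 := h.isometric _ (one_le_norm_sq hx)
    have h2 := hp.arcDensity_sq hz
    have h3 := hp.radius_sq hz
    rw [h3]
    have h4 : η (‖x‖ ^ 2) = 4 * arcDensity β η (‖x‖ ^ 2) ^ 2 - β (‖x‖ ^ 2) / ‖x‖ ^ 2 := by
      rw [eq_sub_iff_add_eq]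
      refine mul_right_cancel₀ hz0 ?_
      rw [add_mul, div_mul_cancel₀ _ hz0]
      linear_combination h2
    rw [h4, ← h1]
    generalize ‖x‖ ^ 2 = z at *
    field_simp
    ring
  · have hz := ha x hx
    have hz1 := one_le_norm_sq hx
    have hx0 : ‖x‖ ≠ 0 := by
      have : 1 ≤ ‖x‖ := hx
      linarith
    have hα := hp.arcDensity_pos hz
    have hW := h.W_pos (‖x‖ ^ 2)
    obtain ⟨y, hy⟩ : ∃ y, y = deriv Y (‖x‖ ^ 2) / arcDensity β η (‖x‖ ^ 2) -
      (m + 1) / (2 * r) / W (‖x‖ ^ 2) := ⟨_, rfl⟩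
    have hnrm := h.normal _ hz1
    have hsff := h.sff _ hz1
    have hiso := h.isometric _ hz1
    have hX1 := h.deriv_X _ hz1
    rw [← hy] at hnrm hsff
    have hY1 : deriv Y (‖x‖ ^ 2) = arcDensity β η (‖x‖ ^ 2) *
        (y + (m + 1) / (2 * r) / W (‖x‖ ^ 2)) := by
      rw [hy]
      field_simp
      ring
    -- Lowering the Y-component of the unit tangent by κ/W changes its squared length from 1 to -1;
    -- orthogonality to the tangent follows from the same relation.
    have hyW : 2 * r / (m + 1) * (2 * (W (‖x‖ ^ 2) * y)) +
        (2 * r / (m + 1)) ^ 2 * regularFactor (m + 3) r (radius β (‖x‖ ^ 2)) * Y (‖x‖ ^ 2) ^ 2 *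
          W (‖x‖ ^ 2) ^ 2 = -1 := by
      rw [hX1, hY1] at hiso
      have hc : 2 * r / ((m : ℝ) + 1) * ((m + 1) / (2 * r) / W (‖x‖ ^ 2)) * W (‖x‖ ^ 2) = 1 := by
        field_simp
      refine mul_left_cancel₀ (pow_ne_zero 2 hα.ne') ?_
      linear_combination hiso - 2 * arcDensity β η (‖x‖ ^ 2) ^ 2 * hc
    refine ⟨(W (‖x‖ ^ 2), y, 0), ⟨by simp, fun u => ?_, ?_, hW⟩, fun u v => ?_⟩
    · rw [schwarzschildMetric_eq hr, fderiv_profileMap hp.nonneg h.smooth_X h.smooth_Y hz]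
      simp only [profileMap, inner_zero_left, mul_zero, add_zero]
      rw [hrad x hx, hX1, hY1]
      have hc : 2 * r / ((m : ℝ) + 1) * ((m + 1) / (2 * r) / W (‖x‖ ^ 2)) * W (‖x‖ ^ 2) = 1 := by
        field_simp
      linear_combination 2 * arcDensity β η (‖x‖ ^ 2) * inner ℝ x u * (hyW + hc)
    · rw [schwarzschildMetric_eq hr]
      simp only [profileMap, inner_zero_left, mul_zero, add_zero]
      rw [hrad x hx]
      linear_combination hyW
    · obtain ⟨hs1, hs2⟩ := fderiv_fderiv_profileMap hp.nonneg h.smooth_X h.smooth_Y hz u v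
      have hpos : 0 < r + (profileMap X Y x).1 * (profileMap X Y x).2.1 := by
        simp only [profileMap]
        rw [hrad x hx]
        exact hp.radius_pos hz
      have hz0 : ‖x‖ ^ 2 ≠ 0 := pow_ne_zero 2 hx0
      rw [secondFundamentalForm, koszul, fderiv_schwarzschildMetric hr hr0 hpos,
        fderiv_schwarzschildMetric hr hr0 hpos, fderiv_schwarzschildMetric hr hr0 hpos,
        schwarzschildMetric_eq hr, hs1, hs2,
        fderiv_profileMap hp.nonneg h.smooth_X h.smooth_Y hz,
        fderiv_profileMap hp.nonneg h.smooth_X h.smooth_Y hz, inner_angular hx0]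
      simp only [profileMap, inner_zero_left, inner_zero_right, mul_zero, add_zero]
      rw [hrad x hx, hk.apply_eq x hx]
      have hb := (hp.fst_pos _ hz).ne'
      have hq : γ (‖x‖ ^ 2) = radius β (‖x‖ ^ 2) / ‖x‖ ^ 2 *
          (W (‖x‖ ^ 2) * Y (‖x‖ ^ 2) + X (‖x‖ ^ 2) * y) := by
        rw [hnrm, ← mul_assoc, div_mul_eq_mul_div, ← sq, hp.radius_sq hz, tangEig]
        field_simp
      have hpz : ζ (‖x‖ ^ 2) = 4 * (arcDensity β η (‖x‖ ^ 2) ^ 2 * radEig β η γ ζ (‖x‖ ^ 2)) -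
          γ (‖x‖ ^ 2) / ‖x‖ ^ 2 := by
        have h1 : radEig β η γ ζ (‖x‖ ^ 2) * (4 * ‖x‖ ^ 2 * arcDensity β η (‖x‖ ^ 2) ^ 2) =
            γ (‖x‖ ^ 2) + ζ (‖x‖ ^ 2) * ‖x‖ ^ 2 := by
          rw [← hp.arcDensity_sq hz, radEig, div_mul_cancel₀ _ (hp.snd_pos _ hz).ne']
        rw [eq_sub_iff_add_eq]
        refine mul_right_cancel₀ hz0 ?_
        rw [add_mul, div_mul_cancel₀ _ hz0]
        linear_combination -h1
      rw [hpz, hq]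
      -- The second derivative of the map contains ⟨u, v⟩ times the tangent of the curve; this
      -- contribution vanishes because the normal is orthogonal to it.
      have hnull : 2 * r / (m + 1) * (W (‖x‖ ^ 2) * deriv Y (‖x‖ ^ 2) +
          y * deriv X (‖x‖ ^ 2)) + (2 * r / (m + 1)) ^ 2 *
          regularFactor (m + 3) r (radius β (‖x‖ ^ 2)) * Y (‖x‖ ^ 2) ^ 2 *
          (W (‖x‖ ^ 2) * deriv X (‖x‖ ^ 2)) = 0 := by
        rw [hX1, hY1]
        have hc : 2 * r / ((m : ℝ) + 1) * ((m + 1) / (2 * r) / W (‖x‖ ^ 2)) * W (‖x‖ ^ 2) = 1 := by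
          field_simp
        linear_combination arcDensity β η (‖x‖ ^ 2) * (hyW + hc)
      linear_combination (-4 * inner ℝ x u * inner ℝ x v) * hsff - 2 * inner ℝ u v * hnull
  · have hz : 1 < ‖x‖ ^ 2 := one_lt_pow₀ hx two_ne_zero
    exact ⟨h.X_pos _ hz, h.Y_pos _ hz, hnorm x hx.le⟩
  · change horizonRadius (m + 3) M + X (‖x‖ ^ 2) * Y (‖x‖ ^ 2) = horizonRadius (m + 3) M
    rw [hx, one_pow, h.mul_eq 1 le_rfl, hr1]
    ring

end Embedding

end Penrose

end

/-! ### Mass inequality and rigidity -/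

open Penrose in
theorem mainTheorem2 (n : ℕ) (hn : 3 ≤ n) (D : Penrose.InitialData n)
    (hsym : D.IsSphericallySymmetric) (hflat : D.IsAsymptoticallyFlat)
    (hhor : D.ApparentHorizonCondition) (hdec : D.DominantEnergyCondition) :
    ∃ mADM : ℝ, D.HasADMMass mADM ∧ D.halfAreaRadius ≤ mADM ∧
      (mADM = D.halfAreaRadius →
        ∃ Ψ : Penrose.Eucl n → Penrose.Ambient n,
          Penrose.IsSchwarzschildEmbedding D.halfAreaRadius D Ψ) := by
  obtain ⟨m, rfl⟩ : ∃ m, n = m + 3 := ⟨n - 3, by omega⟩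
  obtain ⟨a, β, η, γ, ζ, hg, hp, hk⟩ := D.exists_profiles hn hsym
  have hdata := D.radialData hg hp hk hhor hdec
  obtain ⟨τ, T, b, C, L, hfall⟩ := hflat.exists_fallOff hg hp hk
  obtain ⟨l, hl₁, hl₂⟩ := hdata.exists_tendsto_misnerSharp hfall
  have hhalf : D.halfAreaRadius = 1 / 2 * radius β 1 ^ (m + 1) := halfAreaRadius_eq hn hg hp
  have hle := fun z hz => hdata.misnerSharp_le_of_tendsto hl₂ (z := z) hz
  have hr := hp.radius_pos hp.lt_one
  refine ⟨l, ?_, ?_, fun heq => ?_⟩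
  · have hsq : Filter.Tendsto (fun r : ℝ => r ^ 2) Filter.atTop Filter.atTop :=
      Filter.tendsto_pow_atTop two_ne_zero
    refine (hl₁.comp hsq).congr' ?_
    filter_upwards [Filter.eventually_ge_atTop 1] with r hr
    exact (hawkingMass_eq hn D.g_smooth hg hp hr).symm
  · rw [hhalf, ← hdata.misnerSharp_one]
    exact hle 1 le_rfl
  -- The increasing mass is squeezed between its horizon value and its limit, which coincide.
  · have hM : ∀ z, 1 ≤ z → misnerSharp m (radius β) (slope β η) (tangEig β γ) z =
        1 / 2 * radius β 1 ^ (m + 1) := fun z hz => by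
      refine le_antisymm ((hle z hz).trans (by rw [heq, hhalf])) ?_
      rw [← hdata.misnerSharp_one]
      exact hdata.monotoneOn_misnerSharp (Set.mem_Ici.2 le_rfl) hz hz
    obtain ⟨X, Y, W, hE⟩ := hdata.exists_isEmbedding hM
    exact ⟨profileMap X Y, isSchwarzschildEmbedding_profileMap hg hp hk
      (hhalf ▸ horizonRadius_half_pow hr) hr rfl hE⟩
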